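/- Let $d\in\mathbb N$, $\alpha\in(0,2)$ with $\alpha<d$, and $\theta\in[\frac d\alpha,\infty]$, $\frac1\theta+\frac1{\theta'}=1$. Let $\Omega\subset\mathbb R^d$ be open; $B_r(z)$ denotes an open ball, and $\sup$ of a function $u$ means essential supremum (with values in $[0,\infty]$). **Kernels and forms.** Let $K:\mathbb R^d\times\mathbb R^d\to[0,\infty]$ be measurable, $K_s(x,y)=\frac12(K(x,y)+K(y,x))$, $K_a(x,y)=\frac12(K(x,y)-K(y,x))$, and assume $x\mapsto\int(|x-y|^2\wedge1)K_s(x,y)\,dy\in L^1_{loc}(\mathbb R^d)$. For a symmetric kernel $k$ and $U\subset\mathbb R^d$ let $\mathcal E^k_U(v,v)=\int_U\int_U(v(x)-v(y))^2k(x,y)\,dy\,dx$. Put $$\mathcal E(u,v)=\iint(u(x)-u(y))(v(x)-v(y))K_s(x,y)\,dy\,dx+\iint(u(x)-u(y))(v(x)+v(y))K_a(x,y)\,dy\,dx,\qquad \widehat{\mathcal E}(u,v)=\mathcal E(v,u).$$ **Assumptions** (each with a constant): * (Cutoff), for a symmetric kernel $k$, with constant $c$: for all $0<\rho\le r\le1$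 and $z$ with $B_{r+\rho}(z)\subset\Omega$ there is a radially decreasing $\tau$ centred at $z$ with $0\le\tau\le1$, $\operatorname{supp}\tau\subset\overline{B_{r+\rho}(z)}$, $\tau=1$ on $B_r(z)$, Lipschitz constant at most $\frac32\rho^{-1}$, and $\int(\tau(x)-\tau(y))^2k(x,y)\,dy\le c\rho^{-\alpha}$ for all $x\in B_{r+\rho}(z)$. * (Sob), with constant $c$: $\|v^2\|_{L^{d/(d-\alpha)}(B_r)}\le c\,\mathcal E^{K_s}_{B_{r+\rho}}(v,v)+c\rho^{-\alpha}\|v^2\|_{L^1(B_{r+\rho})}$ for all concentric balls $B_r\subset B_{r+\rho}\subset\Omega$ with $0<\rho\le r\le1$ and all $v\in L^2(B_{r+\rho})$. * (K1$_{loc}$), with constants $c_J,C$: there is a measurable symmetric kernel $J:\mathbb R^d\times\mathbb R^d\to[0,\infty]$ satisfying (Cutoff) with constant $c_J$ such that for every ball $B_{2r}\subset\Omega$ with $r\le1$: $\big\|\int_{B_{2r}}\frac{|K_a(\cdot,y)|^2}{J(\cdot,y)}dy\big\|_{L^\theta(B_{2r})}\le C$ and $\mathcal E^J_{B_{2r}}(v,v)\le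 C\,\mathcal E^{K_s}_{B_{2r}}(v,v)$ for all $v\in L^2(B_{2r})$. * (K1$_{glob}$): the same, with the first inequality replaced by $\big\|\int_{\mathbb R^d}\frac{|K_a(\cdot,y)|^2}{J(\cdot,y)}dy\big\|_{L^\theta(\mathbb R^d)}\le C$. * (UJS), with constant $c$: $K(x,y)\le c\,\frac1{|B_r(x)|}\int_{B_r(x)}K(z,y)\,dz$ for all $x,y\in\mathbb R^d$ and all $0<r\le\frac14\wedge\frac{|x-y|}4$ with $B_r(x)\subset\Omega$. * ($\widehat{\text{UJS}}$), with constant $c$: $K(y,x)\le c\,\frac1{|B_r(x)|}\int_{B_r(x)}K(y,z)\,dz$ for the same $x,y,r$. **Solutions.** For a ball $B$, $V(B|\mathbb R^d)$ is the set of measurable $v:\mathbb R^d\to\mathbb R$ with $v\in L^2(B)$ and $\int_B\int_{\mathbb R^d}(v(x)-v(y))^2K_s(x,y)\,dy\,dx<\infty$; $H_B(\mathbb R^d)$ is the set of $v\in V(\mathbb R^d|\mathbb R^d)$ with $v=0$ off $B$. For $f\in L^\infty(B)$, $u$ is a weak solution of $-Lu=f$ in $B$ if $u\in V(B|\mathbb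 R^d)$ and $\mathcal E(u,\phi)\le\int_Bf\phi$ for all $\phi\in H_B(\mathbb R^d)$ with $\phi\le0$ and for all those with $\phi\ge0$; it is a weak solution of the dual equation $-\widehat Lu=f$ in $B$ if $u\in V(B|\mathbb R^d)\cap L^{2\theta'}(\mathbb R^d)$ and the same holds with $\widehat{\mathcal E}(u,\phi)$. (Only $\phi$ for which both double integrals converge absolutely are tested.) **Theorem.** Assume (Cutoff) for $K_s$ and (Sob). Consider, for a ball $B_{2R}=B_{2R}(x_0)\subset\Omega$ with $0<R\le1$, $$\sup_{B_{R/2}}u\le c\Big(\frac1{|B_R|}\int_{B_R}u^2\,dx\Big)^{1/2}+\delta\sup_{B_R}u+cR^\alpha\|f\|_{L^\infty(B_{2R})}.\qquad(*)$$ (i) Assume (K1$_{loc}$) and (UJS). If $\theta\in(\frac d\alpha,\infty]$, then for every $\delta\in(0,1]$ there is $c>0$, depending only on $\delta,d,\alpha,\theta$ and the constants in the assumptions, such that $(*)$ holds for every $B_{2R}(x_0)\subset\Omega$ with $0<R\le1$, every $f\in L^\infty(B_{2R}(x_0))$ and every weak solution $u$ of $-Lu=f$ in $B_{2R}(x_0)$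 with $u\ge0$ a.e. in $\mathbb R^d$. If $\theta=\frac d\alpha$, then for every compact $D\subset\Omega$ and every $\delta\in(0,1]$ there is $c>0$, depending on $K,\Omega,D,\delta$, such that the same holds for all such balls with centre $x_0\in D$. (ii) Assume (K1$_{glob}$), ($\widehat{\text{UJS}}$) and $\theta\in(\frac d\alpha,\infty]$. Then for every $\delta\in(0,1]$ there is $c>0$, depending only on $\delta,d,\alpha,\theta$ and the constants in the assumptions, such that $(*)$ holds for every $B_{2R}(x_0)\subset\Omega$ with $0<R\le1$, every $f\in L^\infty(B_{2R}(x_0))$ and every weak solution $u$ of $-\widehat Lu=f$ in $B_{2R}(x_0)$ with $u\ge0$ a.e. in $\mathbb R^d$. -/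

import Mathlib

open MeasureTheory Set Metric
open scoped ENNReal

namespace NonlocalForm

/-- A (not necessarily symmetric) kernel `ℝᵈ × ℝᵈ → [0, ∞]`. -/
abbrev Kernel (d : ℕ) : Type :=
  EuclideanSpace ℝ (Fin d) → EuclideanSpace ℝ (Fin d) → ℝ≥0∞

variable {d : ℕ}

/-- The symmetric part `K_s(x,y) = (K(x,y) + K(y,x)) / 2`. -/
noncomputable def symPart (K : Kernel d) : Kernel d :=
  fun x y => (K x y + K y x) / 2

/-- The antisymmetric part `K_a(x,y) = (K(x,y) - K(y,x)) / 2`, a real number wherever `K` is finite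
(which is the case almost everywhere under the Lévy condition below). -/
noncomputable def antiPart (K : Kernel d)
    (x y : EuclideanSpace ℝ (Fin d)) : ℝ :=
  ((K x y).toReal - (K y x).toReal) / 2

/-- A jumping kernel: jointly measurable, and its symmetric part satisfies the Lévy condition
`x ↦ ∫ (|x - y|² ∧ 1) K_s(x,y) dy ∈ L¹_loc(ℝᵈ)`. -/
structure IsJumpingKernel (K : Kernel d) : Prop where
  measurable : Measurable (Function.uncurry K)
  levy : ∀ S : Set (EuclideanSpace ℝ (Fin d)), IsCompact S →
    ∫⁻ x in S, ∫⁻ y, ENNReal.ofReal (min (dist x y ^ 2) 1) * symPart K x y < ∞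

/-- `𝓔^k_U(v,v) = ∫_U ∫_U (v(x) - v(y))² k(x,y) dy dx ∈ [0, ∞]`. -/
noncomputable def energyOn (k : Kernel d) (U : Set (EuclideanSpace ℝ (Fin d)))
    (v : EuclideanSpace ℝ (Fin d) → ℝ) : ℝ≥0∞ :=
  ∫⁻ x in U, ∫⁻ y in U, ENNReal.ofReal ((v x - v y) ^ 2) * k x y

/-- The carré du champ `Γ^k(τ,τ)(x) = ∫ (τ(x) - τ(y))² k(x,y) dy ∈ [0, ∞]`. -/
noncomputable def carreDuChamp (k : Kernel d)
    (τ : EuclideanSpace ℝ (Fin d) → ℝ) (x : EuclideanSpace ℝ (Fin d)) : ℝ≥0∞ :=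
  ∫⁻ y, ENNReal.ofReal ((τ x - τ y) ^ 2) * k x y

/-- `τ` is a radially decreasing cutoff function between `B_r(z)` and `B_{r+ρ}(z)`; the bound
`|∇τ| ≤ (3/2) ρ⁻¹` is expressed as a Lipschitz bound. -/
structure IsCutoffFunction (z : EuclideanSpace ℝ (Fin d)) (r ρ : ℝ)
    (τ : EuclideanSpace ℝ (Fin d) → ℝ) : Prop where
  radial_antitone : ∀ x y, dist x z ≤ dist y z → τ y ≤ τ x
  support_subset : tsupport τ ⊆ closedBall z (r + ρ)
  nonneg : ∀ x, 0 ≤ τ x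
  le_one : ∀ x, τ x ≤ 1
  eq_one : ∀ x ∈ ball z r, τ x = 1
  lipschitz : ∀ x y, |τ x - τ y| ≤ 3 / 2 * ρ⁻¹ * dist x y

/-- The condition (Cutoff) with exponent `α` and constant `c` for a symmetric kernel `k`. -/
def Cutoff (α c : ℝ) (Ω : Set (EuclideanSpace ℝ (Fin d))) (k : Kernel d) : Prop :=
  ∀ (z : EuclideanSpace ℝ (Fin d)) (r ρ : ℝ), 0 < ρ → ρ ≤ r → r ≤ 1 → ball z (r + ρ) ⊆ Ω →
    ∃ τ : EuclideanSpace ℝ (Fin d) → ℝ, IsCutoffFunction z r ρ τ ∧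
      ∀ x ∈ ball z (r + ρ), carreDuChamp k τ x ≤ ENNReal.ofReal (c * ρ ^ (-α))

/-- The Sobolev inequality (Sob) with exponent `α` and constant `c` for a symmetric kernel `k`. -/
def Sob (α c : ℝ) (Ω : Set (EuclideanSpace ℝ (Fin d))) (k : Kernel d) : Prop :=
  ∀ (z : EuclideanSpace ℝ (Fin d)) (r ρ : ℝ), 0 < ρ → ρ ≤ r → r ≤ 1 → ball z (r + ρ) ⊆ Ω →
    ∀ v : EuclideanSpace ℝ (Fin d) → ℝ, MemLp v 2 (volume.restrict (ball z (r + ρ))) →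
      eLpNorm (fun x => v x ^ 2) (ENNReal.ofReal (d / (d - α))) (volume.restrict (ball z r)) ≤
        ENNReal.ofReal c * energyOn k (ball z (r + ρ)) v +
          ENNReal.ofReal (c * ρ ^ (-α)) *
            eLpNorm (fun x => v x ^ 2) 1 (volume.restrict (ball z (r + ρ)))

/-- The drift weight `x ↦ ∫_U |K_a(x,y)|² / J(x,y) dy ∈ [0, ∞]`
(with `0 / 0 = 0` and `a / 0 = ∞` for `a > 0`). -/
noncomputable def driftWeight (K J : Kernel d) (U : Set (EuclideanSpace ℝ (Fin d)))
    (x : EuclideanSpace ℝ (Fin d)) : ℝ≥0∞ :=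
  ∫⁻ y in U, ENNReal.ofReal (antiPart K x y ^ 2) / J x y

/-- The comparison kernel in (K1): a measurable symmetric kernel satisfying (Cutoff). -/
structure IsComparisonKernel (α c : ℝ) (Ω : Set (EuclideanSpace ℝ (Fin d)))
    (J : Kernel d) : Prop where
  measurable : Measurable (Function.uncurry J)
  symm : ∀ x y, J x y = J y x
  cutoff : Cutoff α c Ω J

/-- The energy comparison in (K1): `𝓔^J_B(v,v) ≤ C 𝓔^{K_s}_B(v,v)` on all balls
`B = B_{2r} ⊆ Ω`, `r ≤ 1`. -/
def EnergyComparison (C : ℝ) (Ω : Set (EuclideanSpace ℝ (Fin d))) (K J : Kernel d) : Prop :=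
  ∀ (z : EuclideanSpace ℝ (Fin d)) (r : ℝ), 0 < r → r ≤ 1 → ball z (2 * r) ⊆ Ω →
    ∀ v : EuclideanSpace ℝ (Fin d) → ℝ, MemLp v 2 (volume.restrict (ball z (2 * r))) →
      energyOn J (ball z (2 * r)) v ≤
        ENNReal.ofReal C * energyOn (symPart K) (ball z (2 * r)) v

/-- The condition (K1_loc), where `J` satisfies (Cutoff) with constant `cJ`. -/
def K1loc (α cJ C : ℝ) (θ : ℝ≥0∞) (Ω : Set (EuclideanSpace ℝ (Fin d))) (K : Kernel d) : Prop :=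
  ∃ J : Kernel d, IsComparisonKernel α cJ Ω J ∧ EnergyComparison C Ω K J ∧
    ∀ (z : EuclideanSpace ℝ (Fin d)) (r : ℝ), 0 < r → r ≤ 1 → ball z (2 * r) ⊆ Ω →
      eLpNorm (driftWeight K J (ball z (2 * r))) θ (volume.restrict (ball z (2 * r))) ≤
        ENNReal.ofReal C

/-- The condition (K1_glob), where `J` satisfies (Cutoff) with constant `cJ`. -/
def K1glob (α cJ C : ℝ) (θ : ℝ≥0∞) (Ω : Set (EuclideanSpace ℝ (Fin d))) (K : Kernel d) : Prop :=
  ∃ J : Kernel d, IsComparisonKernel α cJ Ω J ∧ EnergyComparison C Ω K J ∧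
    eLpNorm (driftWeight K J univ) θ volume ≤ ENNReal.ofReal C

/-- The condition (UJS) with constant `c`. -/
def UJS (c : ℝ) (Ω : Set (EuclideanSpace ℝ (Fin d))) (K : Kernel d) : Prop :=
  ∀ (x y : EuclideanSpace ℝ (Fin d)) (r : ℝ), 0 < r → r ≤ min (1 / 4) (dist x y / 4) →
    ball x r ⊆ Ω → K x y ≤ ENNReal.ofReal c * ⨍⁻ z in ball x r, K z y ∂volume

/-- The dual condition to (UJS) with constant `c`. -/
def UJSdual (c : ℝ) (Ω : Set (EuclideanSpace ℝ (Fin d))) (K : Kernel d) : Prop :=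
  ∀ (x y : EuclideanSpace ℝ (Fin d)) (r : ℝ), 0 < r → r ≤ min (1 / 4) (dist x y / 4) →
    ball x r ⊆ Ω → K y x ≤ ENNReal.ofReal c * ⨍⁻ z in ball x r, K y z ∂volume

/-- The space `V(U | ℝᵈ)` associated with a symmetric kernel `k`. -/
structure MemV (k : Kernel d) (U : Set (EuclideanSpace ℝ (Fin d)))
    (v : EuclideanSpace ℝ (Fin d) → ℝ) : Prop where
  aestronglyMeasurable : AEStronglyMeasurable v volume
  memLp : MemLp v 2 (volume.restrict U)
  energy_lt_top : ∫⁻ x in U, ∫⁻ y, ENNReal.ofReal ((v x - v y) ^ 2) * k x y < ∞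

/-- The space `H_U(ℝᵈ)` of test functions associated with a symmetric kernel `k`. -/
structure MemH (k : Kernel d) (U : Set (EuclideanSpace ℝ (Fin d)))
    (v : EuclideanSpace ℝ (Fin d) → ℝ) : Prop where
  memV : MemV k univ v
  eq_zero : ∀ x, x ∉ U → v x = 0

/-- The integrand `(u(x) - u(y)) (v(x) - v(y)) K_s(x,y)` of `𝓔^{K_s}(u,v)`. -/
noncomputable def symIntegrand (K : Kernel d) (u v : EuclideanSpace ℝ (Fin d) → ℝ)
    (p : EuclideanSpace ℝ (Fin d) × EuclideanSpace ℝ (Fin d)) : ℝ :=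
  (u p.1 - u p.2) * (v p.1 - v p.2) * (symPart K p.1 p.2).toReal

/-- The integrand `(u(x) - u(y)) (v(x) + v(y)) K_a(x,y)` of `𝓔^{K_a}(u,v)`. -/
noncomputable def antiIntegrand (K : Kernel d) (u v : EuclideanSpace ℝ (Fin d) → ℝ)
    (p : EuclideanSpace ℝ (Fin d) × EuclideanSpace ℝ (Fin d)) : ℝ :=
  (u p.1 - u p.2) * (v p.1 + v p.2) * antiPart K p.1 p.2

/-- `𝓔(u,v)` is well defined: both integrals converge absolutely. -/
def FormDefined (K : Kernel d) (u v : EuclideanSpace ℝ (Fin d) → ℝ) : Prop :=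
  Integrable (symIntegrand K u v) ((volume : Measure (EuclideanSpace ℝ (Fin d))).prod volume) ∧
    Integrable (antiIntegrand K u v) ((volume : Measure (EuclideanSpace ℝ (Fin d))).prod volume)

/-- The bilinear form `𝓔(u,v) = 𝓔^{K_s}(u,v) + 𝓔^{K_a}(u,v)`. Formally it equals
`2 ∫∫ (u(x) - u(y)) v(x) K(x,y) dy dx`, an integral that need not converge absolutely. -/
noncomputable def form (K : Kernel d) (u v : EuclideanSpace ℝ (Fin d) → ℝ) : ℝ :=
  (∫ p, symIntegrand K u v p ∂((volume : Measure (EuclideanSpace ℝ (Fin d))).prod volume)) +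
    ∫ p, antiIntegrand K u v p ∂((volume : Measure (EuclideanSpace ℝ (Fin d))).prod volume)

/-- Weak solutions to `-L u = f` in `U`: `𝓔(u,φ) ≤ (f,φ)` for all test functions `φ ≤ 0`
(supersolution) and for all test functions `φ ≥ 0` (subsolution). Only test functions for which
`𝓔(u,φ)` is well defined are used. -/
structure IsWeakSolution (K : Kernel d) (U : Set (EuclideanSpace ℝ (Fin d)))
    (f u : EuclideanSpace ℝ (Fin d) → ℝ) : Prop where
  rhs_memLp : MemLp f ∞ (volume.restrict U)
  memV : MemV (symPart K) U u
  super : ∀ φ, MemH (symPart K) U φ → (∀ x, φ x ≤ 0) → FormDefined K u φ →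
    form K u φ ≤ ∫ x in U, f x * φ x
  sub : ∀ φ, MemH (symPart K) U φ → (∀ x, 0 ≤ φ x) → FormDefined K u φ →
    form K u φ ≤ ∫ x in U, f x * φ x

/-- Weak solutions to the dual equation `-L̂ u = f` in `U`, governed by the dual form
`𝓔̂(u,φ) = 𝓔(φ,u)`; here `u ∈ L^{2θ'}(ℝᵈ)` with `1/θ + 1/θ' = 1`. -/
structure IsWeakSolutionDual (θ : ℝ≥0∞) (K : Kernel d) (U : Set (EuclideanSpace ℝ (Fin d)))
    (f u : EuclideanSpace ℝ (Fin d) → ℝ) : Prop where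
  rhs_memLp : MemLp f ∞ (volume.restrict U)
  memV : MemV (symPart K) U u
  memLp : MemLp u (2 * θ.conjExponent) volume
  super : ∀ φ, MemH (symPart K) U φ → (∀ x, φ x ≤ 0) → FormDefined K φ u →
    form K φ u ≤ ∫ x in U, f x * φ x
  sub : ∀ φ, MemH (symPart K) U φ → (∀ x, 0 ≤ φ x) → FormDefined K φ u →
    form K φ u ≤ ∫ x in U, f x * φ x

/-- The (essential) supremum over `U` of a nonnegative function, in `[0, ∞]`. -/
noncomputable def supOn (U : Set (EuclideanSpace ℝ (Fin d)))
    (u : EuclideanSpace ℝ (Fin d) → ℝ) : ℝ≥0∞ :=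
  essSup (fun x => ENNReal.ofReal (u x)) (volume.restrict U)

/-- The estimate
`sup_{B_{R/2}} u ≤ c (⨍_{B_R} u²)^{1/2} + δ sup_{B_R} u + c R^α ‖f‖_{L^∞(B_{2R})}`. -/
def LocalBound (α δ c : ℝ) (x₀ : EuclideanSpace ℝ (Fin d)) (R : ℝ)
    (f u : EuclideanSpace ℝ (Fin d) → ℝ) : Prop :=
  supOn (ball x₀ (R / 2)) u ≤
    ENNReal.ofReal c * (⨍⁻ x in ball x₀ R, ENNReal.ofReal (u x ^ 2) ∂volume) ^ (1 / 2 : ℝ) +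
      ENNReal.ofReal δ * supOn (ball x₀ R) u +
      ENNReal.ofReal (c * R ^ α) * eLpNorm f ∞ (volume.restrict (ball x₀ (2 * R)))

end NonlocalForm

namespace NonlocalForm

variable {d : ℕ}

/-! ### Pointwise inequalities -/

lemma mul_mul_le_of_sq_eq {a j q p r : ℝ} (h : a ^ 2 = q * j) (hj : 0 ≤ j) (hq : 0 ≤ q)
    (hp : 0 ≤ p) (hr : 0 ≤ r) (hpr : 4 * p * r = 1) (X Y : ℝ) :
    X * Y * a ≤ p * (X ^ 2 * j) + r * (Y ^ 2 * q) := by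
  have h1 : 0 ≤ p * (X ^ 2 * j) := by positivity
  have h2 : 0 ≤ r * (Y ^ 2 * q) := by positivity
  refine le_of_sq_le_sq ?_ (add_nonneg h1 h2)
  have h3 : (X * Y * a) ^ 2 = 4 * (p * (X ^ 2 * j)) * (r * (Y ^ 2 * q)) := by
    linear_combination X ^ 2 * Y ^ 2 * h - X ^ 2 * Y ^ 2 * q * j * hpr
  rw [h3]
  nlinarith [sq_nonneg (p * (X ^ 2 * j) - r * (Y ^ 2 * q))]

/-- The lower bound for the integrand of the form near the support of the cutoff function. -/
lemma near_primal {wx wy tx ty s a j q ε K : ℝ} (has : |a| ≤ s) (hsj : s ≤ j)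
    (h : a ^ 2 = q * j) (hq : 0 ≤ q) (hε : 0 < ε) (hε1 : ε ≤ 1) (hK : K * ε = 2) :
    (tx * wx - ty * wy) ^ 2 * s ≤
      (wx - wy) * (tx ^ 2 * wx - ty ^ 2 * wy) * s + (wx - wy) * (tx ^ 2 * wx + ty ^ 2 * wy) * a +
      (ε * (tx * wx - ty * wy) ^ 2 + K * (tx - ty) ^ 2 * (wx ^ 2 + wy ^ 2)) * j +
      K * (tx ^ 2 * wx ^ 2 + ty ^ 2 * wy ^ 2) * q := by
  have hs : 0 ≤ s := (abs_nonneg a).trans has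
  have hj : 0 ≤ j := hs.trans hsj
  have hK2 : 2 ≤ K := by nlinarith
  have B1 := mul_mul_le_of_sq_eq h hj hq (p := ε / 4) (r := K / 2) (by positivity) (by positivity)
    (by linarith)
  have B2 := mul_mul_le_of_sq_eq h hj hq (p := 1 / 2) (r := 1 / 2) (by positivity) (by positivity)
    (by norm_num)
  have e1 := B1 (-(tx * wx - ty * wy)) (tx * wx)
  have e2 := B1 (-(tx * wx - ty * wy)) (ty * wy)
  have e3 := B2 ((tx - ty) * wy) (tx * wx)
  have e4 := B2 ((tx - ty) * wx) (ty * wy)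
  have e5 : wx * wy * (tx - ty) ^ 2 * s ≤ 1 / 2 * ((wx ^ 2 + wy ^ 2) * (tx - ty) ^ 2 * j) := by
    have : wx * wy * ((tx - ty) ^ 2 * s) ≤ (wx ^ 2 + wy ^ 2) / 2 * ((tx - ty) ^ 2 * s) := by
      gcongr
      nlinarith [sq_nonneg (wx - wy)]
    have h2 : (wx ^ 2 + wy ^ 2) / 2 * ((tx - ty) ^ 2 * s) ≤
      (wx ^ 2 + wy ^ 2) / 2 * ((tx - ty) ^ 2 * j) := by gcongr
    linarith
  have e6 : 0 ≤ ε * ((tx * wx - ty * wy) ^ 2 * j) := by positivity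
  have e7 : 2 * ((wx ^ 2 + wy ^ 2) * (tx - ty) ^ 2 * j) ≤
      K * ((wx ^ 2 + wy ^ 2) * (tx - ty) ^ 2 * j) := by gcongr
  have e8 : 0 ≤ (wx ^ 2 + wy ^ 2) * (tx - ty) ^ 2 * j := by positivity
  have e9 : 2 * ((tx ^ 2 * wx ^ 2 + ty ^ 2 * wy ^ 2) * q) ≤
      K * ((tx ^ 2 * wx ^ 2 + ty ^ 2 * wy ^ 2) * q) := by gcongr
  have e10 : 0 ≤ (tx ^ 2 * wx ^ 2 + ty ^ 2 * wy ^ 2) * q := by positivity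
  linarith

lemma near_primal' {wx wy tx ty s a j q ε K Nx Ny : ℝ} (has : |a| ≤ s) (hsj : s ≤ j)
    (h : a ^ 2 = q * j) (hq : 0 ≤ q) (hε : 0 < ε) (hε1 : ε ≤ 1) (hK : K * ε = 2)
    (hNx : wx ^ 2 ≤ Nx) (hNy : wy ^ 2 ≤ Ny) :
    (tx * wx - ty * wy) ^ 2 * s ≤
      (wx - wy) * (tx ^ 2 * wx - ty ^ 2 * wy) * s + (wx - wy) * (tx ^ 2 * wx + ty ^ 2 * wy) * a +
      (ε * (tx * wx - ty * wy) ^ 2 + K * (tx - ty) ^ 2 * (Nx + Ny)) * j +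
      K * (tx ^ 2 * Nx + ty ^ 2 * Ny) * q := by
  have hj : 0 ≤ j := ((abs_nonneg a).trans has).trans hsj
  have hK0 : 0 ≤ K := by nlinarith
  refine (near_primal has hsj h hq hε hε1 hK).trans ?_
  gcongr

lemma near_dual {wx wy tx ty s a j q ε K κ Nx Ny : ℝ} (hwx : 0 ≤ wx) (hwy : 0 ≤ wy)
    (has : |a| ≤ s) (hsj : s ≤ j)
    (h : a ^ 2 = q * j) (hq : 0 ≤ q) (hε : 0 < ε) (hε1 : ε ≤ 1) (hK : K * ε = 2)
    (hNx : wx ^ 2 ≤ Nx) (hNy : wy ^ 2 ≤ Ny) (hNx' : 0 < wx → wx ^ 2 + κ ^ 2 ≤ Nx)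
    (hNy' : 0 < wy → wy ^ 2 + κ ^ 2 ≤ Ny) :
    (tx * wx - ty * wy) ^ 2 * s ≤
      (wx - wy) * (tx ^ 2 * wx - ty ^ 2 * wy) * s +
        (tx ^ 2 * wx - ty ^ 2 * wy) * (wx + wy + 2 * κ) * a +
      (ε * (tx * wx - ty * wy) ^ 2 + K * (tx - ty) ^ 2 * (Nx + Ny)) * j +
      K * (tx ^ 2 * Nx + ty ^ 2 * Ny) * q := by
  have hs : 0 ≤ s := (abs_nonneg a).trans has
  have hj : 0 ≤ j := hs.trans hsj
  have hK2 : 2 ≤ K := by nlinarith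
  have B1 := mul_mul_le_of_sq_eq h hj hq (p := ε / 4) (r := K / 2) (by positivity) (by positivity)
    (by linarith)
  have B2 := mul_mul_le_of_sq_eq h hj hq (p := 1 / 2) (r := 1 / 2) (by positivity) (by positivity)
    (by norm_num)
  have e1 := B1 (-(tx * wx - ty * wy)) (tx * wx)
  have e2 := B1 (-(tx * wx - ty * wy)) (ty * wy)
  have e3 := B2 (-(tx - ty) * wy) (tx * wx)
  have e4 := B2 (-(tx - ty) * wx) (ty * wy)
  have e5 : wx * wy * (tx - ty) ^ 2 * s ≤ 1 / 2 * ((wx ^ 2 + wy ^ 2) * (tx - ty) ^ 2 * j) := by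
    have : wx * wy * ((tx - ty) ^ 2 * s) ≤ (wx ^ 2 + wy ^ 2) / 2 * ((tx - ty) ^ 2 * s) := by
      gcongr
      nlinarith [sq_nonneg (wx - wy)]
    have h2 : (wx ^ 2 + wy ^ 2) / 2 * ((tx - ty) ^ 2 * s) ≤
      (wx ^ 2 + wy ^ 2) / 2 * ((tx - ty) ^ 2 * j) := by gcongr
    linarith
  have e6 : 0 ≤ ε * ((tx * wx - ty * wy) ^ 2 * j) := by positivity
  have e7 : 2 * ((Nx + Ny) * (tx - ty) ^ 2 * j) ≤ K * ((Nx + Ny) * (tx - ty) ^ 2 * j) := by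
    have : 0 ≤ Nx := (sq_nonneg _).trans hNx
    have : 0 ≤ Ny := (sq_nonneg _).trans hNy
    gcongr
  have t0 : 0 ≤ κ ^ 2 * ((tx - ty) ^ 2 * j) := by positivity
  have t1 : 0 ≤ κ ^ 2 * (tx ^ 2 * q) := by positivity
  have t2 : 0 ≤ κ ^ 2 * (ty ^ 2 * q) := by positivity
  have t3 : 0 ≤ wx ^ 2 * (tx ^ 2 * q) := by positivity
  have t4 : 0 ≤ wy ^ 2 * (ty ^ 2 * q) := by positivity
  have t5 : 0 ≤ (wx ^ 2 + wy ^ 2) * (tx - ty) ^ 2 * j := by positivity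
  have m1 : 2 * (κ ^ 2 * (tx ^ 2 * q)) ≤ K * (κ ^ 2 * (tx ^ 2 * q)) := by gcongr
  have m2 : 2 * (κ ^ 2 * (ty ^ 2 * q)) ≤ K * (κ ^ 2 * (ty ^ 2 * q)) := by gcongr
  have m3 : 2 * (wx ^ 2 * (tx ^ 2 * q)) ≤ K * (wx ^ 2 * (tx ^ 2 * q)) := by gcongr
  have m4 : 2 * (wy ^ 2 * (ty ^ 2 * q)) ≤ K * (wy ^ 2 * (ty ^ 2 * q)) := by gcongr
  have n1 : wx ^ 2 * ((tx - ty) ^ 2 * j) ≤ Nx * ((tx - ty) ^ 2 * j) := by gcongr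
  have n2 : wy ^ 2 * ((tx - ty) ^ 2 * j) ≤ Ny * ((tx - ty) ^ 2 * j) := by gcongr
  have n3 : wx ^ 2 * (K * tx ^ 2 * q) ≤ Nx * (K * tx ^ 2 * q) := by gcongr
  have n4 : wy ^ 2 * (K * ty ^ 2 * q) ≤ Ny * (K * ty ^ 2 * q) := by gcongr
  have n5 : 0 < wx → (wx ^ 2 + κ ^ 2) * ((tx - ty) ^ 2 * j) ≤ Nx * ((tx - ty) ^ 2 * j) :=
    fun hx => by have := hNx' hx; gcongr
  have n6 : 0 < wy → (wy ^ 2 + κ ^ 2) * ((tx - ty) ^ 2 * j) ≤ Ny * ((tx - ty) ^ 2 * j) :=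
    fun hy => by have := hNy' hy; gcongr
  have n7 : 0 < wx → (wx ^ 2 + κ ^ 2) * (K * tx ^ 2 * q) ≤ Nx * (K * tx ^ 2 * q) :=
    fun hx => by have := hNx' hx; gcongr
  have n8 : 0 < wy → (wy ^ 2 + κ ^ 2) * (K * ty ^ 2 * q) ≤ Ny * (K * ty ^ 2 * q) :=
    fun hy => by have := hNy' hy; gcongr
  rcases hwx.eq_or_lt with hx | hx <;> rcases hwy.eq_or_lt with hy | hy
  · subst hx; subst hy; linarith
  · subst hx
    have f1 := B1 (ty * wy) (κ * ty)
    have := n6 hy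
    have := n8 hy
    linarith
  · subst hy
    have f1 := B1 (-(tx * wx)) (κ * tx)
    have := n5 hx
    have := n7 hx
    linarith
  · have f1 := B1 (-(tx * wx - ty * wy)) (κ * tx)
    have f2 := B1 (-(tx * wx - ty * wy)) (κ * ty)
    have f3 := B2 (-(tx - ty) * κ) (tx * wx)
    have f4 := B2 (-(tx - ty) * κ) (ty * wy)
    have := n5 hx
    have := n7 hx
    have := n6 hy
    have := n8 hy
    linarith

/-- Truncation from below does not increase the integrand. -/
lemma trunc_primal {ux uy tx ty k s a : ℝ} (has : |a| ≤ s) :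
    (max (ux - k) 0 - max (uy - k) 0) * (tx ^ 2 * max (ux - k) 0 - ty ^ 2 * max (uy - k) 0) * s +
      (max (ux - k) 0 - max (uy - k) 0) * (tx ^ 2 * max (ux - k) 0 + ty ^ 2 * max (uy - k) 0) * a ≤
    (ux - uy) * (tx ^ 2 * max (ux - k) 0 - ty ^ 2 * max (uy - k) 0) * s +
      (ux - uy) * (tx ^ 2 * max (ux - k) 0 + ty ^ 2 * max (uy - k) 0) * a := by
  obtain ⟨h1, h2⟩ := abs_le.1 has
  rcases le_total ux k with hx | hx <;> rcases le_total uy k with hy | hy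
  · simp [hx, hy]
  · have e : 0 ≤ (k - ux) * (ty ^ 2 * (uy - k)) * (s - a) :=
      mul_nonneg (mul_nonneg (by linarith) (mul_nonneg (sq_nonneg _) (by linarith))) (by linarith)
    rw [max_eq_right (by linarith : ux - k ≤ 0), max_eq_left (by linarith : 0 ≤ uy - k)]
    linarith
  · have e : 0 ≤ (k - uy) * (tx ^ 2 * (ux - k)) * (s + a) :=
      mul_nonneg (mul_nonneg (by linarith) (mul_nonneg (sq_nonneg _) (by linarith))) (by linarith)
    rw [max_eq_left (by linarith : 0 ≤ ux - k), max_eq_right (by linarith : uy - k ≤ 0)]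
    linarith
  · rw [max_eq_left (by linarith : 0 ≤ ux - k), max_eq_left (by linarith : 0 ≤ uy - k)]
    linarith

lemma trunc_dual {ux uy tx ty k s a : ℝ} (has : |a| ≤ s) :
    (max (ux - k) 0 - max (uy - k) 0) * (tx ^ 2 * max (ux - k) 0 - ty ^ 2 * max (uy - k) 0) * s +
      (tx ^ 2 * max (ux - k) 0 - ty ^ 2 * max (uy - k) 0) *
        (max (ux - k) 0 + max (uy - k) 0 + 2 * k) * a ≤
    (ux - uy) * (tx ^ 2 * max (ux - k) 0 - ty ^ 2 * max (uy - k) 0) * s +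
      (tx ^ 2 * max (ux - k) 0 - ty ^ 2 * max (uy - k) 0) * (ux + uy) * a := by
  obtain ⟨h1, h2⟩ := abs_le.1 has
  rcases le_total ux k with hx | hx <;> rcases le_total uy k with hy | hy
  · simp [hx, hy]
  · have e : 0 ≤ (k - ux) * (ty ^ 2 * (uy - k)) * (s + a) :=
      mul_nonneg (mul_nonneg (by linarith) (mul_nonneg (sq_nonneg _) (by linarith))) (by linarith)
    rw [max_eq_right (by linarith : ux - k ≤ 0), max_eq_left (by linarith : 0 ≤ uy - k)]
    linarith
  · have e : 0 ≤ (k - uy) * (tx ^ 2 * (ux - k)) * (s - a) :=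
      mul_nonneg (mul_nonneg (by linarith) (mul_nonneg (sq_nonneg _) (by linarith))) (by linarith)
    rw [max_eq_left (by linarith : 0 ≤ ux - k), max_eq_right (by linarith : uy - k ≤ 0)]
    linarith
  · rw [max_eq_left (by linarith : 0 ≤ ux - k), max_eq_left (by linarith : 0 ≤ uy - k)]
    linarith

/-! ### Double integrals -/

section Abstract

variable {X : Type*} [MeasurableSpace X] {μ : Measure X}

lemma lintegral_le_add_ofReal_integral {F : X → ℝ} (hF : Integrable F μ) {G H : X → ℝ≥0∞}
    (h : ∀ᵐ p ∂μ, G p + ENNReal.ofReal (-F p) ≤ H p + ENNReal.ofReal (F p)) :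
    ∫⁻ p, G p ∂μ ≤ ∫⁻ p, H p ∂μ + ENNReal.ofReal (∫ p, F p ∂μ) := by
  have hm := hF.aestronglyMeasurable.aemeasurable
  have ha : ∫⁻ p, ENNReal.ofReal (F p) ∂μ ≠ ∞ :=
    (lt_of_le_of_lt (lintegral_ofReal_le_lintegral_enorm F) hF.2).ne
  have hb : ∫⁻ p, ENNReal.ofReal (-F p) ∂μ ≠ ∞ :=
    (lt_of_le_of_lt (lintegral_ofReal_le_lintegral_enorm (-F)) hF.neg.2).ne
  have h1 := lintegral_mono_ae h
  have hmn : AEMeasurable (fun p => ENNReal.ofReal (-F p)) μ := hm.neg.ennreal_ofReal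
  rw [lintegral_add_right' _ hmn, lintegral_add_right' _ hm.ennreal_ofReal] at h1
  rw [integral_eq_lintegral_pos_part_sub_lintegral_neg_part hF]
  set a := ∫⁻ p, ENNReal.ofReal (F p) ∂μ
  set b := ∫⁻ p, ENNReal.ofReal (-F p) ∂μ
  have h2 : a ≤ b + ENNReal.ofReal (a.toReal - b.toReal) := by
    rw [ENNReal.ofReal_sub _ ENNReal.toReal_nonneg, ENNReal.ofReal_toReal ha,
      ENNReal.ofReal_toReal hb]
    exact le_add_tsub
  refine (ENNReal.add_le_add_iff_right hb).1 (h1.trans ?_)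
  calc _ ≤ ∫⁻ p, H p ∂μ + (b + ENNReal.ofReal (a.toReal - b.toReal)) := by gcongr
    _ = _ := by ring

lemma ofReal_add_le_of_le {g h F : ℝ} (hg : 0 ≤ g) (hh : 0 ≤ h) (H : g ≤ F + h) :
    ENNReal.ofReal g + ENNReal.ofReal (-F) ≤ ENNReal.ofReal h + ENNReal.ofReal F := by
  rcases le_total 0 F with hF | hF
  · rw [ENNReal.ofReal_of_nonpos (neg_nonpos.2 hF), add_zero, ← ENNReal.ofReal_add hh hF]
    exact ENNReal.ofReal_le_ofReal (by linarith)
  · rw [ENNReal.ofReal_of_nonpos hF, add_zero, ← ENNReal.ofReal_add hg (by linarith)]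
    exact ENNReal.ofReal_le_ofReal (by linarith)

open Classical in
/-- The function on `X × X` which is `g` on `B × B`, is `P` on `B × Bᶜ`, extended symmetrically. -/
noncomputable def quad (B : Set X) (g P : X → X → ℝ≥0∞) (x y : X) : ℝ≥0∞ :=
  if x ∈ B then if y ∈ B then g x y else P x y else if y ∈ B then P y x else 0

lemma measurable_quad {B : Set X} (hB : MeasurableSet B) {g P : X → X → ℝ≥0∞}
    (hg : Measurable (Function.uncurry g)) (hP : Measurable (Function.uncurry P)) :
    Measurable (Function.uncurry (quad B g P)) := by
  have h1 : MeasurableSet {p : X × X | p.1 ∈ B} := measurable_fst hB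
  have h2 : MeasurableSet {p : X × X | p.2 ∈ B} := measurable_snd hB
  exact Measurable.ite h1 (Measurable.ite h2 hg hP)
    (Measurable.ite h2 (hP.comp measurable_swap) measurable_const)

lemma lintegral_lintegral_eq_quad [SFinite μ] {B : Set X} (hB : MeasurableSet B)
    {g P : X → X → ℝ≥0∞} (hg : Measurable (Function.uncurry g))
    (hP : Measurable (Function.uncurry P)) :
    ∫⁻ p, quad B g P p.1 p.2 ∂μ.prod μ =
      ∫⁻ x in B, ∫⁻ y in B, g x y ∂μ ∂μ + 2 * ∫⁻ x in B, ∫⁻ y in Bᶜ, P x y ∂μ ∂μ := by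
  have hq := measurable_quad hB hg hP
  rw [lintegral_prod (fun p => quad B g P p.1 p.2) hq.aemeasurable, ← lintegral_add_compl _ hB]
  have e1 : ∫⁻ x in B, ∫⁻ y, quad B g P x y ∂μ ∂μ =
      ∫⁻ x in B, ∫⁻ y in B, g x y ∂μ ∂μ + ∫⁻ x in B, ∫⁻ y in Bᶜ, P x y ∂μ ∂μ := by
    have hm : Measurable fun x => ∫⁻ y in B, g x y ∂μ :=
      hg.lintegral_prod_right' (ν := μ.restrict B)
    rw [← lintegral_add_left hm]
    refine setLIntegral_congr_fun hB fun x hx => ?_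
    rw [← lintegral_add_compl _ hB]
    congr 1
    · exact setLIntegral_congr_fun hB fun y hy => by simp [quad, hx, hy]
    · exact setLIntegral_congr_fun hB.compl fun y hy => by simp [quad, hx, (mem_compl_iff _ _).1 hy]
  have e2 : ∫⁻ x in Bᶜ, ∫⁻ y, quad B g P x y ∂μ ∂μ = ∫⁻ x in B, ∫⁻ y in Bᶜ, P x y ∂μ ∂μ := by
    rw [lintegral_lintegral_swap hP.aemeasurable]
    refine setLIntegral_congr_fun hB.compl fun x hx => ?_
    rw [← lintegral_add_compl _ hB]
    have h0 : ∫⁻ y in Bᶜ, quad B g P x y ∂μ = 0 := by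
      rw [setLIntegral_congr_fun hB.compl (g := fun _ => 0), lintegral_zero]
      intro y hy
      simp [quad, (mem_compl_iff _ _).1 hx, (mem_compl_iff _ _).1 hy]
    rw [h0, add_zero]
    exact setLIntegral_congr_fun hB fun y hy => by simp [quad, (mem_compl_iff _ _).1 hx, hy]
  rw [e1, e2]
  ring

lemma lintegral_lintegral_add {Y : Type*} [MeasurableSpace Y] {ν : Measure Y} [SFinite ν]
    {f : X → Y → ℝ≥0∞} (hf : Measurable (Function.uncurry f)) (g : X → Y → ℝ≥0∞) :
    ∫⁻ x, ∫⁻ y, f x y + g x y ∂ν ∂μ =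
      ∫⁻ x, ∫⁻ y, f x y ∂ν ∂μ + ∫⁻ x, ∫⁻ y, g x y ∂ν ∂μ := by
  have h1 : ∀ x, ∫⁻ y, f x y + g x y ∂ν = ∫⁻ y, f x y ∂ν + ∫⁻ y, g x y ∂ν := fun x =>
    lintegral_add_left hf.of_uncurry_left _
  have h2 : Measurable fun x => ∫⁻ y, f x y ∂ν := hf.lintegral_prod_right'
  simp_rw [h1]
  exact lintegral_add_left h2 _

lemma lintegral_lintegral_const_mul {Y : Type*} [MeasurableSpace Y] {ν : Measure Y} [SFinite ν]
    {f : X → Y → ℝ≥0∞} (hf : Measurable (Function.uncurry f)) (c : ℝ≥0∞) :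
    ∫⁻ x, ∫⁻ y, c * f x y ∂ν ∂μ = c * ∫⁻ x, ∫⁻ y, f x y ∂ν ∂μ := by
  have h1 : ∀ x, ∫⁻ y, c * f x y ∂ν = c * ∫⁻ y, f x y ∂ν := fun x =>
    lintegral_const_mul _ hf.of_uncurry_left
  have h2 : Measurable fun x => ∫⁻ y, f x y ∂ν := hf.lintegral_prod_right'
  simp_rw [h1]
  exact lintegral_const_mul _ h2

lemma ae_swap [SFinite μ] {p : X × X → Prop} (h : ∀ᵐ z ∂μ.prod μ, p z) :
    ∀ᵐ z ∂μ.prod μ, p z.swap :=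
  (Measure.measurePreserving_swap (μ := μ) (ν := μ)).quasiMeasurePreserving.ae h

/-- A symmetric function vanishing off `B × X ∪ X × B` is integrable once it is controlled on
`B × X`. -/
lemma lintegral_le_of_symmetric [SFinite μ] {B : Set X} (hB : MeasurableSet B)
    {F : X × X → ℝ≥0∞} (hsymm : ∀ x y, F (x, y) = F (y, x))
    (h0 : ∀ x ∉ B, ∀ y ∉ B, F (x, y) = 0) {h N : X → X → ℝ≥0∞}
    (hh : Measurable (Function.uncurry h)) (hN : Measurable (Function.uncurry N))
    (hBB : ∀ᵐ p ∂μ.prod μ, p.1 ∈ B → p.2 ∈ B → F p ≤ h p.1 p.2)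
    (hBC : ∀ᵐ p ∂μ.prod μ, p.1 ∈ B → p.2 ∉ B → F p ≤ N p.1 p.2) :
    ∫⁻ p, F p ∂μ.prod μ ≤
      ∫⁻ x in B, ∫⁻ y in B, h x y ∂μ ∂μ + 2 * ∫⁻ x in B, ∫⁻ y in Bᶜ, N x y ∂μ ∂μ := by
  rw [← lintegral_lintegral_eq_quad hB hh hN]
  refine lintegral_mono_ae ?_
  filter_upwards [hBB, hBC, ae_swap hBC] with p h1 h2 h3
  obtain ⟨x, y⟩ := p
  by_cases hx : x ∈ B <;> by_cases hy : y ∈ B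
  · simpa [quad, hx, hy] using h1 hx hy
  · simpa [quad, hx, hy] using h2 hx hy
  · have := h3 hy hx
    rw [Prod.swap, ← hsymm] at this
    simpa [quad, hx, hy] using this
  · simp [h0 x hx y hy]

/-- Integration of a pointwise lower bound for a symmetric integrable function. -/
lemma lintegral_add_le_of_symmetric [SFinite μ] {B : Set X} (hB : MeasurableSet B)
    {F : X × X → ℝ} (hF : Integrable F (μ.prod μ)) (hsymm : ∀ x y, F (x, y) = F (y, x))
    (h0 : ∀ x ∉ B, ∀ y ∉ B, F (x, y) = 0) {g h P N : X → X → ℝ≥0∞}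
    (hg : Measurable (Function.uncurry g)) (hh : Measurable (Function.uncurry h))
    (hP : Measurable (Function.uncurry P)) (hN : Measurable (Function.uncurry N))
    (hBB : ∀ᵐ p ∂μ.prod μ, p.1 ∈ B → p.2 ∈ B →
      g p.1 p.2 + ENNReal.ofReal (-F p) ≤ h p.1 p.2 + ENNReal.ofReal (F p))
    (hBC : ∀ᵐ p ∂μ.prod μ, p.1 ∈ B → p.2 ∉ B →
      P p.1 p.2 + ENNReal.ofReal (-F p) ≤ N p.1 p.2 + ENNReal.ofReal (F p)) :
    ∫⁻ x in B, ∫⁻ y in B, g x y ∂μ ∂μ + 2 * ∫⁻ x in B, ∫⁻ y in Bᶜ, P x y ∂μ ∂μ ≤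
      ∫⁻ x in B, ∫⁻ y in B, h x y ∂μ ∂μ + 2 * ∫⁻ x in B, ∫⁻ y in Bᶜ, N x y ∂μ ∂μ +
        ENNReal.ofReal (∫ p, F p ∂μ.prod μ) := by
  rw [← lintegral_lintegral_eq_quad hB hg hP, ← lintegral_lintegral_eq_quad hB hh hN]
  refine lintegral_le_add_ofReal_integral hF ?_
  filter_upwards [hBB, hBC, ae_swap hBC] with p h1 h2 h3
  obtain ⟨x, y⟩ := p
  by_cases hx : x ∈ B <;> by_cases hy : y ∈ B
  · simpa [quad, hx, hy] using h1 hx hy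
  · simpa [quad, hx, hy] using h2 hx hy
  · have := h3 hy hx
    rw [Prod.swap, ← hsymm] at this
    simpa [quad, hx, hy] using this
  · simp [h0 x hx y hy, quad, hx, hy]

lemma le_two_mul_of_le_half_add {a b : ℝ≥0∞} (ha : a ≠ ∞) (h : a ≤ a / 2 + b) : a ≤ 2 * b := by
  have h1 : a / 2 ≤ b := by
    have h2 : a / 2 + a / 2 ≤ a / 2 + b := by rwa [ENNReal.add_halves]
    exact (ENNReal.add_le_add_iff_left (ENNReal.div_ne_top ha (by norm_num))).1 h2
  calc a = 2 * (a / 2) := by rw [ENNReal.mul_div_cancel (by norm_num) (by norm_num)]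
    _ ≤ 2 * b := by gcongr

end Abstract

/-! ### Cutoff functions -/

/-- The bound `∫ (|x-y|²/ρ² ∧ 1) k(x,y) dy ≤ Λ ρ^{-α}` for `x ∈ S` and `ρ ≤ ρ₀`. -/
def LevyBound (α Λ ρ₀ : ℝ) (S : Set (EuclideanSpace ℝ (Fin d))) (k : Kernel d) : Prop :=
  ∀ x ∈ S, ∀ ρ, 0 < ρ → ρ ≤ ρ₀ →
    ∫⁻ y, ENNReal.ofReal (min (dist x y ^ 2 / ρ ^ 2) 1) * k x y ≤ ENNReal.ofReal (Λ * ρ ^ (-α))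

lemma Cutoff.tail_le {α c : ℝ} {Ω : Set (EuclideanSpace ℝ (Fin d))} {k : Kernel d}
    (h : Cutoff α c Ω k) {x : EuclideanSpace ℝ (Fin d)} {s : ℝ} (hs : 0 < s) (hs1 : s ≤ 1)
    (hx : ball x s ⊆ Ω) :
    ∫⁻ y in {y | s < dist x y}, k x y ≤ ENNReal.ofReal (c * (s / 2) ^ (-α)) := by
  obtain ⟨τ, hτ, hΓ⟩ := h x (s / 2) (s / 2) (by positivity) le_rfl (by linarith)
    (by rwa [add_halves])
  have h1 := hΓ x (mem_ball_self (by linarith))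
  refine le_trans ?_ h1
  have hmeas : MeasurableSet {y | s < dist x y} :=
    measurableSet_lt measurable_const (by fun_prop)
  rw [← lintegral_indicator hmeas]
  refine lintegral_mono fun y => ?_
  by_cases hy : s < dist x y
  · have h2 : τ x = 1 := hτ.eq_one x (mem_ball_self (by linarith))
    have h3 : τ y = 0 := by
      by_contra hne
      have := hτ.support_subset (subset_tsupport _ hne)
      rw [mem_closedBall, dist_comm] at this
      linarith
    simp [hy, h2, h3]
  · simp [hy]

/-- The constant comparing (Cutoff) with the Lévy bound. -/
noncomputable def levyConst (α : ℝ) : ℝ := 4 ^ α * (1 - 2 ^ (α - 2))⁻¹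

lemma levyConst_nonneg {α : ℝ} (hα : α < 2) : 0 ≤ levyConst α := by
  have : (2 : ℝ) ^ (α - 2) < 1 := Real.rpow_lt_one_of_one_lt_of_neg (by norm_num) (by linarith)
  have : 0 ≤ (1 - (2 : ℝ) ^ (α - 2))⁻¹ := inv_nonneg.2 (by linarith)
  unfold levyConst
  positivity

lemma Cutoff.lintegral_le {α c : ℝ} (hα : α < 2) (hc : 0 ≤ c)
    {Ω : Set (EuclideanSpace ℝ (Fin d))} {k : Kernel d}
    (hk : Measurable (Function.uncurry k)) (h : Cutoff α c Ω k) {x : EuclideanSpace ℝ (Fin d)}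
    {ρ : ℝ} (hρ : 0 < ρ) (hρ1 : ρ ≤ 1) (hx : ball x ρ ⊆ Ω) :
    ∫⁻ y, ENNReal.ofReal (min (dist x y ^ 2 / ρ ^ 2) 1) * k x y ≤
      ENNReal.ofReal (c * levyConst α * ρ ^ (-α)) := by
  set S : ℕ → Set (EuclideanSpace ℝ (Fin d)) := fun j => {y | ρ * (1 / 2) ^ (j + 1) < dist x y}
  have hS : ∀ j, MeasurableSet (S j) := fun j =>
    measurableSet_lt measurable_const (by fun_prop)
  have hkx : Measurable (k x) := hk.of_uncurry_left
  have hpt : ∀ y, ENNReal.ofReal (min (dist x y ^ 2 / ρ ^ 2) 1) * k x y ≤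
      ∑' j, (S j).indicator (fun y => ENNReal.ofReal ((1 / 4) ^ j) * k x y) y := by
    intro y
    have key : ∀ j, y ∈ S j → min (dist x y ^ 2 / ρ ^ 2) 1 ≤ (1 / 4) ^ j →
        ENNReal.ofReal (min (dist x y ^ 2 / ρ ^ 2) 1) * k x y ≤
          ∑' j, (S j).indicator (fun y => ENNReal.ofReal ((1 / 4) ^ j) * k x y) y := by
      intro j hj hle
      refine le_trans ?_ (ENNReal.le_tsum j)
      rw [indicator_of_mem hj]
      gcongr
    rcases (dist_nonneg (x := x) (y := y)).eq_or_lt with h0 | h0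
    · simp [← h0]
    rcases le_or_gt (dist x y / ρ) 1 with h1 | h1
    · obtain ⟨n, hn1, hn2⟩ := exists_nat_pow_near_of_lt_one (div_pos h0 hρ) h1
        (by norm_num : (0 : ℝ) < 1 / 2) (by norm_num)
      refine key n ?_ ?_
      · rw [lt_div_iff₀ hρ] at hn1
        simp only [S, mem_ofPred_eq]
        linarith
      · refine (min_le_left _ _).trans ?_
        rw [← div_pow]
        calc (dist x y / ρ) ^ 2 ≤ ((1 / 2) ^ n) ^ 2 := by gcongr
          _ = (1 / 4) ^ n := by rw [← pow_mul, mul_comm, pow_mul]; norm_num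
    · refine key 0 ?_ (by simp)
      rw [lt_div_iff₀ hρ] at h1
      simp only [S, mem_ofPred_eq]
      linarith
  have hq : (2 : ℝ) ^ (α - 2) < 1 := Real.rpow_lt_one_of_one_lt_of_neg (by norm_num) (by linarith)
  have hq0 : (0 : ℝ) ≤ 2 ^ (α - 2) := by positivity
  calc ∫⁻ y, ENNReal.ofReal (min (dist x y ^ 2 / ρ ^ 2) 1) * k x y
      ≤ ∫⁻ y, ∑' j, (S j).indicator (fun y => ENNReal.ofReal ((1 / 4) ^ j) * k x y) y :=
        lintegral_mono hpt
    _ = ∑' j, ∫⁻ y, (S j).indicator (fun y => ENNReal.ofReal ((1 / 4) ^ j) * k x y) y :=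
        lintegral_tsum fun j => ((hkx.const_mul _).indicator (hS j)).aemeasurable
    _ = ∑' j, ENNReal.ofReal ((1 / 4) ^ j) * ∫⁻ y in S j, k x y := by
        congr 1; ext j
        rw [lintegral_indicator (hS j), lintegral_const_mul _ hkx]
    _ ≤ ∑' j : ℕ, ENNReal.ofReal (c * 4 ^ α * ρ ^ (-α) * (2 ^ (α - 2)) ^ j) := by
        refine ENNReal.tsum_le_tsum fun j => ?_
        have hp : (0 : ℝ) < (1 / 2) ^ (j + 1) := by positivity
        have hp1 : (1 / 2 : ℝ) ^ (j + 1) ≤ 1 := pow_le_one₀ (by norm_num) (by norm_num)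
        have hle : ρ * (1 / 2) ^ (j + 1) ≤ ρ := by nlinarith
        have h2 := h.tail_le (s := ρ * (1 / 2) ^ (j + 1)) (by positivity) (hle.trans hρ1)
          ((ball_subset_ball hle).trans hx)
        refine (mul_le_mul_right h2 _).trans ?_
        rw [← ENNReal.ofReal_mul (by positivity)]
        refine ENNReal.ofReal_le_ofReal (le_of_eq ?_)
        have e1 : ρ * (1 / 2) ^ (j + 1) / 2 = ρ * ((1 / 4) * (1 / 2 : ℝ) ^ j) := by ring
        rw [e1, Real.mul_rpow hρ.le (by positivity), Real.mul_rpow (by norm_num) (by positivity),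
          Real.rpow_sub (by norm_num), div_pow]
        have e2 : (1 / 4 : ℝ) ^ (-α) = 4 ^ α := by
          rw [one_div, Real.inv_rpow (by norm_num), Real.rpow_neg (by norm_num), inv_inv]
        have e3 : ((1 / 2 : ℝ) ^ j) ^ (-α) = (2 ^ α) ^ j := by
          rw [one_div, inv_pow, Real.inv_rpow (by positivity), Real.rpow_neg (by positivity),
            inv_inv, ← Real.rpow_natCast_mul (by norm_num), ← Real.rpow_mul_natCast (by norm_num),
            mul_comm]
        rw [e2, e3]
        have e4 : (2 : ℝ) ^ (2 : ℝ) = 4 := by norm_num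
        rw [e4, one_pow, div_pow]
        ring
    _ = ENNReal.ofReal (c * levyConst α * ρ ^ (-α)) := by
        rw [← ENNReal.ofReal_tsum_of_nonneg (fun j => by positivity)
          ((summable_geometric_of_lt_one hq0 hq).mul_left _), tsum_mul_left,
          tsum_geometric_of_lt_one hq0 hq, levyConst]
        ring_nf

/-- A piecewise linear radial cutoff function, equal to `1` on `B_r(z)` and to `0` off
`B_{r+ρ/2}(z)`. -/
noncomputable def cut (z : EuclideanSpace ℝ (Fin d)) (r ρ : ℝ) (x : EuclideanSpace ℝ (Fin d)) : ℝ :=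
  max 0 (min 1 ((r + ρ / 2 - dist x z) * (2 / ρ)))

section Cut

variable {z x y : EuclideanSpace ℝ (Fin d)} {r ρ : ℝ}

lemma cut_nonneg : 0 ≤ cut z r ρ x := le_max_left _ _

lemma cut_le_one : cut z r ρ x ≤ 1 := max_le zero_le_one (min_le_left _ _)

lemma continuous_cut : Continuous (cut z r ρ) := by
  unfold cut; fun_prop

lemma cut_eq_one (hρ : 0 < ρ) (h : dist x z ≤ r) : cut z r ρ x = 1 := by
  have : 1 ≤ (r + ρ / 2 - dist x z) * (2 / ρ) := by
    rw [mul_div_assoc', le_div_iff₀ hρ]; linarith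
  rw [cut, min_eq_left this, max_eq_right zero_le_one]

lemma cut_eq_zero (hρ : 0 < ρ) (h : r + ρ / 2 ≤ dist x z) : cut z r ρ x = 0 := by
  have : (r + ρ / 2 - dist x z) * (2 / ρ) ≤ 0 :=
    mul_nonpos_of_nonpos_of_nonneg (by linarith) (by positivity)
  rw [cut, max_eq_left]
  exact (min_le_right _ _).trans this

lemma abs_cut_sub_le_dist (hρ : 0 < ρ) : |cut z r ρ x - cut z r ρ y| ≤ 2 / ρ * dist x y := by
  have h1 := abs_max_sub_max_le_abs (min 1 ((r + ρ / 2 - dist x z) * (2 / ρ)))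
    (min 1 ((r + ρ / 2 - dist y z) * (2 / ρ))) 0
  have h2 := abs_min_sub_min_le_max 1 ((r + ρ / 2 - dist x z) * (2 / ρ)) 1
    ((r + ρ / 2 - dist y z) * (2 / ρ))
  rw [max_comm, max_comm (min 1 ((r + ρ / 2 - dist y z) * (2 / ρ)))] at h1
  refine h1.trans (h2.trans ?_)
  rw [sub_self, abs_zero, max_eq_right (abs_nonneg _), ← sub_mul, abs_mul,
    abs_of_pos (by positivity : 0 < 2 / ρ), mul_comm]
  gcongr
  have := abs_dist_sub_le y x z
  rw [dist_comm y x] at this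
  rwa [show r + ρ / 2 - dist x z - (r + ρ / 2 - dist y z) = dist y z - dist x z by ring]

lemma sq_cut_sub_le (hρ : 0 < ρ) :
    (cut z r ρ x - cut z r ρ y) ^ 2 ≤ 4 * min (dist x y ^ 2 / ρ ^ 2) 1 := by
  have h1 := abs_cut_sub_le_dist (z := z) (r := r) (x := x) (y := y) hρ
  have h2 : |cut z r ρ x - cut z r ρ y| ≤ 1 := by
    rw [abs_le]
    constructor <;> linarith [cut_nonneg (z := z) (r := r) (ρ := ρ) (x := x),
      cut_nonneg (z := z) (r := r) (ρ := ρ) (x := y), cut_le_one (z := z) (r := r) (ρ := ρ) (x := x),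
      cut_le_one (z := z) (r := r) (ρ := ρ) (x := y)]
  rw [mul_min_of_nonneg _ _ (by norm_num), ← sq_abs]
  refine le_min ?_ ?_
  · calc _ ≤ (2 / ρ * dist x y) ^ 2 := by gcongr
      _ = _ := by ring
  · nlinarith [abs_nonneg (cut z r ρ x - cut z r ρ y)]

lemma LevyBound.cut_le {α Λ ρ₀ : ℝ} {S : Set (EuclideanSpace ℝ (Fin d))} {k : Kernel d}
    (h : LevyBound α Λ ρ₀ S k) (hρ : 0 < ρ) (hρ₀ : ρ ≤ ρ₀) (hx : x ∈ S) :
    ∫⁻ y, ENNReal.ofReal ((cut z r ρ x - cut z r ρ y) ^ 2) * k x y ≤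
      ENNReal.ofReal (4 * (Λ * ρ ^ (-α))) := by
  rw [ENNReal.ofReal_mul (by norm_num)]
  refine le_trans ?_ (mul_le_mul_right (h x hx ρ hρ hρ₀) _)
  rw [← lintegral_const_mul' _ _ ENNReal.ofReal_ne_top]
  refine lintegral_mono fun y => ?_
  simp only
  rw [← mul_assoc, ← ENNReal.ofReal_mul (by norm_num)]
  gcongr
  exact sq_cut_sub_le hρ

lemma LevyBound.compl_ball_le {α Λ ρ₀ : ℝ} {S : Set (EuclideanSpace ℝ (Fin d))} {k : Kernel d}
    (h : LevyBound α Λ ρ₀ S k) (hρ : 0 < ρ) (hρ₀ : ρ ≤ ρ₀) (hx : x ∈ S)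
    (hxz : dist x z ≤ r + ρ / 2) :
    ∫⁻ y in (ball z (r + ρ))ᶜ, k x y ≤ ENNReal.ofReal (4 * (Λ * ρ ^ (-α))) := by
  rw [ENNReal.ofReal_mul (by norm_num)]
  refine le_trans ?_ (mul_le_mul_right (h x hx ρ hρ hρ₀) _)
  rw [← lintegral_const_mul' _ _ ENNReal.ofReal_ne_top,
    ← lintegral_indicator measurableSet_ball.compl]
  refine lintegral_mono fun y => ?_
  by_cases hy : y ∈ (ball z (r + ρ))ᶜ
  · rw [indicator_of_mem hy, ← mul_assoc, ← ENNReal.ofReal_mul (by norm_num)]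
    have h1 : ρ / 2 ≤ dist x y := by
      have := dist_triangle y x z
      rw [mem_compl_iff, mem_ball, not_lt] at hy
      rw [dist_comm y x] at this
      linarith
    have h2 : (1 : ℝ) ≤ 4 * min (dist x y ^ 2 / ρ ^ 2) 1 := by
      rw [mul_min_of_nonneg _ _ (by norm_num)]
      refine le_min ?_ (by norm_num)
      rw [mul_div_assoc', le_div_iff₀ (by positivity)]
      nlinarith
    calc k x y = ENNReal.ofReal 1 * k x y := by simp
      _ ≤ _ := by gcongr
  · simp [indicator_of_notMem hy]

end Cut

/-! ### The local setting -/

/-- The hypotheses on the kernels in a fixed ball `B_R(x₀)`; here `J` dominates `K_s`. -/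
structure LocalSetting (α Λ η ℓ : ℝ) (K J : Kernel d) (x₀ : EuclideanSpace ℝ (Fin d)) (R : ℝ) :
    Prop where
  measurable_K : Measurable (Function.uncurry K)
  measurable_J : Measurable (Function.uncurry J)
  symm_J : ∀ x y, J x y = J y x
  symPart_le : ∀ x y, symPart K x y ≤ J x y
  R_pos : 0 < R
  R_le_one : R ≤ 1
  one_le : 1 ≤ Λ
  drift_nonneg : 0 ≤ ℓ
  levy : LevyBound α Λ R (ball x₀ R) J
  energy : ∀ s, 0 < s → s ≤ R → ∀ v : EuclideanSpace ℝ (Fin d) → ℝ,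
    MemLp v 2 (volume.restrict (ball x₀ s)) →
      energyOn J (ball x₀ s) v ≤ ENNReal.ofReal Λ * energyOn (symPart K) (ball x₀ s) v
  sob : ∀ r ρ, 0 < ρ → ρ ≤ r → r + ρ ≤ R → ∀ v : EuclideanSpace ℝ (Fin d) → ℝ,
    MemLp v 2 (volume.restrict (ball x₀ (r + ρ))) →
      eLpNorm (fun x => v x ^ 2) (ENNReal.ofReal (d / (d - α))) (volume.restrict (ball x₀ r)) ≤
        ENNReal.ofReal Λ * energyOn (symPart K) (ball x₀ (r + ρ)) v +
          ENNReal.ofReal (Λ * ρ ^ (-α)) *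
            eLpNorm (fun x => v x ^ 2) 1 (volume.restrict (ball x₀ (r + ρ)))
  drift : ∀ g : EuclideanSpace ℝ (Fin d) → ℝ≥0∞, Measurable g →
    ∫⁻ x in ball x₀ R, g x * driftWeight K J (ball x₀ R) x ≤
      ENNReal.ofReal ℓ * (∫⁻ x in ball x₀ R, g x) +
        ENNReal.ofReal η * (∫⁻ x in ball x₀ R, g x ^ (d / (d - α))) ^ (((d : ℝ) - α) / d)

/-- The integrand of `𝓔(u,φ)` (`b = false`) or of the dual form `𝓔(φ,u)` (`b = true`). -/
noncomputable def pairing (b : Bool) (K : Kernel d) (u φ : EuclideanSpace ℝ (Fin d) → ℝ)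
    (p : EuclideanSpace ℝ (Fin d) × EuclideanSpace ℝ (Fin d)) : ℝ :=
  symIntegrand K u φ p + bif b then antiIntegrand K φ u p else antiIntegrand K u φ p

/-- The kernel governing the tails: `K(x,y)`, or `K(y,x)` for the dual equation. -/
def farKernel (b : Bool) (K : Kernel d) : Kernel d := fun x y => bif b then K y x else K x y

/-- A nonnegative function, bounded by `M` in `B_R(x₀)`, which satisfies the tested equation with
a right-hand side bounded by `F`. -/
structure LocalSolution (b : Bool) (K : Kernel d) (x₀ : EuclideanSpace ℝ (Fin d)) (R M F : ℝ)
    (u : EuclideanSpace ℝ (Fin d) → ℝ) : Prop where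
  measurable : Measurable u
  nonneg : ∀ x, 0 ≤ u x
  le_bound : ∀ x ∈ ball x₀ R, u x ≤ M
  bound_pos : 0 < M
  rhs_nonneg : 0 ≤ F
  energy : ∫⁻ x in ball x₀ R, ∫⁻ y, ENNReal.ofReal ((u x - u y) ^ 2) * symPart K x y < ∞
  test : ∀ φ, MemH (symPart K) (ball x₀ R) φ → ((∀ x, φ x ≤ 0) ∨ ∀ x, 0 ≤ φ x) →
    Integrable (symIntegrand K u φ)
      ((volume : Measure (EuclideanSpace ℝ (Fin d))).prod volume) →
    Integrable (bif b then antiIntegrand K φ u else antiIntegrand K u φ)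
      ((volume : Measure (EuclideanSpace ℝ (Fin d))).prod volume) →
    ∫ p, pairing b K u φ p ∂((volume : Measure (EuclideanSpace ℝ (Fin d))).prod volume) ≤
      F * ∫ x in ball x₀ R, |φ x|

section Kernels

variable {K J : Kernel d}

lemma measurable_symPart (hK : Measurable (Function.uncurry K)) :
    Measurable (Function.uncurry (symPart K)) :=
  (hK.add (hK.comp measurable_swap)).div_const 2

lemma measurable_antiPart (hK : Measurable (Function.uncurry K)) :
    Measurable (Function.uncurry (antiPart K)) :=
  (hK.ennreal_toReal.sub (hK.comp measurable_swap).ennreal_toReal).div_const 2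

lemma measurable_farKernel {b : Bool} (hK : Measurable (Function.uncurry K)) :
    Measurable (Function.uncurry (farKernel b K)) := by
  cases b
  · exact hK
  · exact hK.comp measurable_swap

lemma symPart_symm (x y : EuclideanSpace ℝ (Fin d)) : symPart K x y = symPart K y x := by
  simp [symPart, add_comm]

lemma antiPart_symm (x y : EuclideanSpace ℝ (Fin d)) : antiPart K x y = -antiPart K y x := by
  simp only [antiPart]; ring

lemma ofReal_abs_antiPart_le (x y : EuclideanSpace ℝ (Fin d)) :
    ENNReal.ofReal |antiPart K x y| ≤ symPart K x y := by
  have h : |antiPart K x y| ≤ ((K x y).toReal + (K y x).toReal) / 2 := by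
    unfold antiPart
    rw [abs_le]
    have := ENNReal.toReal_nonneg (a := K x y)
    have := ENNReal.toReal_nonneg (a := K y x)
    constructor <;> linarith
  refine (ENNReal.ofReal_le_ofReal h).trans ?_
  rw [symPart, ENNReal.ofReal_div_of_pos (by norm_num),
    ENNReal.ofReal_add ENNReal.toReal_nonneg ENNReal.toReal_nonneg]
  norm_num
  gcongr <;> exact ENNReal.ofReal_toReal_le

lemma measurable_driftIntegrand (hK : Measurable (Function.uncurry K))
    (hJ : Measurable (Function.uncurry J)) :
    Measurable (Function.uncurry fun x y => ENNReal.ofReal (antiPart K x y ^ 2) / J x y) :=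
  (((measurable_antiPart hK).pow_const 2).ennreal_ofReal).div hJ

lemma measurable_driftWeight (hK : Measurable (Function.uncurry K))
    (hJ : Measurable (Function.uncurry J)) (U : Set (EuclideanSpace ℝ (Fin d))) :
    Measurable (driftWeight K J U) :=
  (measurable_driftIntegrand hK hJ).lintegral_prod_right' (ν := volume.restrict U)

lemma measurable_sub_sq_mul {v : EuclideanSpace ℝ (Fin d) → ℝ} {k : Kernel d} (hv : Measurable v)
    (hk : Measurable (Function.uncurry k)) :
    Measurable (Function.uncurry fun x y => ENNReal.ofReal ((v x - v y) ^ 2) * k x y) :=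
  ((((hv.comp measurable_fst).sub (hv.comp measurable_snd)).pow_const 2).ennreal_ofReal).mul hk

lemma pairing_symm (b : Bool) (u φ : EuclideanSpace ℝ (Fin d) → ℝ)
    (x y : EuclideanSpace ℝ (Fin d)) : pairing b K u φ (x, y) = pairing b K u φ (y, x) := by
  cases b <;>
  · simp only [pairing, symIntegrand, antiIntegrand, cond_true, cond_false, symPart_symm x y,
      antiPart_symm x y]
    ring

lemma two_mul_abs_mul_le (δ a : ℝ) (j : ℝ≥0∞) :
    ENNReal.ofReal (2 * |δ * a|) ≤ ENNReal.ofReal (δ ^ 2) * j + ENNReal.ofReal (a ^ 2) / j := by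
  rcases eq_or_ne j ∞ with rfl | hj
  · rcases eq_or_ne δ 0 with rfl | hδ
    · simp
    · have : 0 < δ ^ 2 := by positivity
      rw [ENNReal.mul_top (ENNReal.ofReal_pos.2 this).ne']
      simp
  rcases eq_or_ne j 0 with rfl | hj0
  · rcases eq_or_ne a 0 with rfl | ha
    · simp
    · have : 0 < a ^ 2 := by positivity
      rw [ENNReal.div_zero (ENNReal.ofReal_pos.2 this).ne']
      simp
  have hpos := ENNReal.toReal_pos hj0 hj
  rw [← ENNReal.ofReal_toReal hj, ← ENNReal.ofReal_mul (by positivity),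
    ← ENNReal.ofReal_div_of_pos hpos, ← ENNReal.ofReal_add (by positivity) (by positivity)]
  refine ENNReal.ofReal_le_ofReal ?_
  set t := j.toReal
  rw [abs_mul, ← sq_abs δ, ← sq_abs a, ← sub_nonneg]
  have : |δ| ^ 2 * t + |a| ^ 2 / t - 2 * (|δ| * |a|) = (|δ| * t - |a|) ^ 2 / t := by
    field_simp; ring
  rw [this]
  positivity

end Kernels

section Setting

variable {α Λ η ℓ : ℝ} {K J : Kernel d} {x₀ : EuclideanSpace ℝ (Fin d)} {R : ℝ}

lemma LocalSetting.levy_symPart (S : LocalSetting α Λ η ℓ K J x₀ R) :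
    LevyBound α Λ R (ball x₀ R) (symPart K) := fun x hx ρ h1 h2 =>
  (lintegral_mono fun y => by gcongr; exact S.symPart_le x y).trans (S.levy x hx ρ h1 h2)

lemma LocalSetting.ae_ne_top (S : LocalSetting α Λ η ℓ K J x₀ R) (hd : 0 < d) :
    ∀ᵐ p ∂((volume : Measure (EuclideanSpace ℝ (Fin d))).prod volume),
      p.1 ∈ ball x₀ R → J p.1 p.2 ≠ ∞ := by
  have : Nonempty (Fin d) := ⟨⟨0, hd⟩⟩
  have hm : MeasurableSet {p : EuclideanSpace ℝ (Fin d) × EuclideanSpace ℝ (Fin d) |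
      p.1 ∈ ball x₀ R → J p.1 p.2 ≠ ∞} := by
    have h1 : MeasurableSet {p : EuclideanSpace ℝ (Fin d) × EuclideanSpace ℝ (Fin d) |
      p.1 ∈ ball x₀ R} := measurable_fst measurableSet_ball
    have h2 : MeasurableSet {p : EuclideanSpace ℝ (Fin d) × EuclideanSpace ℝ (Fin d) |
      J p.1 p.2 ≠ ∞} := (S.measurable_J (measurableSet_singleton ∞)).compl
    exact h1.imp h2
  rw [Measure.ae_prod_iff_ae_ae hm]
  refine Filter.Eventually.of_forall fun x => ?_
  by_cases hx : x ∈ ball x₀ R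
  · have h1 := S.levy x hx R S.R_pos le_rfl
    have hmeas : Measurable fun y => ENNReal.ofReal (min (dist x y ^ 2 / R ^ 2) 1) * J x y :=
      Measurable.mul (by fun_prop) S.measurable_J.of_uncurry_left
    have h2 := ae_lt_top hmeas (h1.trans_lt ENNReal.ofReal_lt_top).ne
    have h3 : ∀ᵐ y : EuclideanSpace ℝ (Fin d), y ≠ x := by
      simp [ae_iff]
    filter_upwards [h2, h3] with y hy hyx _ hJ
    have hR := S.R_pos
    have : 0 < dist x y := dist_pos.2 hyx.symm
    have h4 : 0 < min (dist x y ^ 2 / R ^ 2) 1 := by positivity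
    rw [hJ, ENNReal.mul_top (by simpa using h4)] at hy
    exact lt_irrefl _ hy
  · exact Filter.Eventually.of_forall fun y h => absurd h hx

end Setting

/-! ### Admissible test functions -/

/-- `w` is a nonnegative function bounded by `m` in `B_R(x₀)` whose increments are dominated by those
of `u`. -/
structure Truncation (x₀ : EuclideanSpace ℝ (Fin d)) (R m : ℝ)
    (u w : EuclideanSpace ℝ (Fin d) → ℝ) : Prop where
  measurable : Measurable w
  nonneg : ∀ x ∈ ball x₀ R, 0 ≤ w x
  le_bound : ∀ x ∈ ball x₀ R, w x ≤ m
  abs_sub_le : ∀ x y, |w x - w y| ≤ |u x - u y|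

section

variable {α Λ η ℓ : ℝ} {K J : Kernel d} {x₀ : EuclideanSpace ℝ (Fin d)} {R M F m r ρ : ℝ}
  {b : Bool} {u w ψ : EuclideanSpace ℝ (Fin d) → ℝ}

lemma Truncation.abs_cut_sq_mul_sub_le (T : Truncation x₀ R m u w) (hρ : 0 < ρ) (hR : r + ρ ≤ R)
    {x : EuclideanSpace ℝ (Fin d)} (hx : x ∈ ball x₀ R) (y : EuclideanSpace ℝ (Fin d)) :
    |cut x₀ r ρ x ^ 2 * w x - cut x₀ r ρ y ^ 2 * w y| ≤
      |u x - u y| + 2 * m * |cut x₀ r ρ x - cut x₀ r ρ y| := by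
  have hx0 := cut_nonneg (z := x₀) (r := r) (ρ := ρ) (x := x)
  have hx1 := cut_le_one (z := x₀) (r := r) (ρ := ρ) (x := x)
  have hy0 := cut_nonneg (z := x₀) (r := r) (ρ := ρ) (x := y)
  have hy1 := cut_le_one (z := x₀) (r := r) (ρ := ρ) (x := y)
  have hw0 := T.nonneg x hx
  have hw1 := T.le_bound x hx
  by_cases hy : y ∈ ball x₀ R
  · have hv0 := T.nonneg y hy
    have hv1 := T.le_bound y hy
    have e : cut x₀ r ρ x ^ 2 * w x - cut x₀ r ρ y ^ 2 * w y = cut x₀ r ρ x ^ 2 * (w x - w y) +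
      (cut x₀ r ρ x + cut x₀ r ρ y) * w y * (cut x₀ r ρ x - cut x₀ r ρ y) := by ring
    rw [e]
    refine (abs_add_le _ _).trans ?_
    rw [abs_mul, abs_mul, abs_of_nonneg (by positivity : 0 ≤ cut x₀ r ρ x ^ 2),
      abs_of_nonneg (by positivity : 0 ≤ (cut x₀ r ρ x + cut x₀ r ρ y) * w y)]
    have h1 : cut x₀ r ρ x ^ 2 * |w x - w y| ≤ 1 * |u x - u y| :=
      mul_le_mul (pow_le_one₀ hx0 hx1) (T.abs_sub_le x y) (abs_nonneg _) zero_le_one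
    have h2 : (cut x₀ r ρ x + cut x₀ r ρ y) * w y ≤ 2 * m :=
      mul_le_mul (by linarith) hv1 hv0 (by norm_num)
    have h3 := mul_le_mul_of_nonneg_right h2 (abs_nonneg (cut x₀ r ρ x - cut x₀ r ρ y))
    linarith
  · rw [mem_ball, not_lt] at hy
    rw [cut_eq_zero (x := y) hρ (by linarith)]
    have : 0 ≤ m := hw0.trans hw1
    have h1 : cut x₀ r ρ x ^ 2 * w x ≤ 2 * m * cut x₀ r ρ x := by
      have : cut x₀ r ρ x * (cut x₀ r ρ x * w x) ≤ cut x₀ r ρ x * (1 * m) := by gcongr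
      nlinarith
    rw [abs_of_nonneg (by simpa using by positivity), sub_zero, abs_of_nonneg hx0]
    linarith [abs_nonneg (u x - u y)]

lemma Truncation.abs_cut_mul_sub_le (T : Truncation x₀ R m u w) (hρ : 0 < ρ) (hR : r + ρ ≤ R)
    {x : EuclideanSpace ℝ (Fin d)} (hx : x ∈ ball x₀ R) (y : EuclideanSpace ℝ (Fin d)) :
    |cut x₀ r ρ x * w x - cut x₀ r ρ y * w y| ≤
      |u x - u y| + 2 * m * |cut x₀ r ρ x - cut x₀ r ρ y| := by
  have hx0 := cut_nonneg (z := x₀) (r := r) (ρ := ρ) (x := x)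
  have hx1 := cut_le_one (z := x₀) (r := r) (ρ := ρ) (x := x)
  have hw0 := T.nonneg x hx
  have hw1 := T.le_bound x hx
  have hm : 0 ≤ m := hw0.trans hw1
  by_cases hy : y ∈ ball x₀ R
  · have hv0 := T.nonneg y hy
    have hv1 := T.le_bound y hy
    have e : cut x₀ r ρ x * w x - cut x₀ r ρ y * w y = cut x₀ r ρ x * (w x - w y) +
      w y * (cut x₀ r ρ x - cut x₀ r ρ y) := by ring
    rw [e]
    refine (abs_add_le _ _).trans ?_
    rw [abs_mul, abs_mul, abs_of_nonneg hx0, abs_of_nonneg hv0]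
    have h1 : cut x₀ r ρ x * |w x - w y| ≤ 1 * |u x - u y| :=
      mul_le_mul hx1 (T.abs_sub_le x y) (abs_nonneg _) zero_le_one
    have h3 := mul_le_mul_of_nonneg_right (by linarith : w y ≤ 2 * m)
      (abs_nonneg (cut x₀ r ρ x - cut x₀ r ρ y))
    linarith
  · rw [mem_ball, not_lt] at hy
    rw [cut_eq_zero (x := y) hρ (by linarith)]
    have h1 : cut x₀ r ρ x * w x ≤ cut x₀ r ρ x * m := by gcongr
    rw [abs_of_nonneg (by simpa using by positivity), sub_zero, abs_of_nonneg hx0]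
    have : 0 ≤ cut x₀ r ρ x * m := by positivity
    linarith [abs_nonneg (u x - u y)]

lemma LocalSetting.energy_lt_top (S : LocalSetting α Λ η ℓ K J x₀ R)
    (U : LocalSolution b K x₀ R M F u) (hρ : 0 < ρ) (hρR : ρ ≤ R)
    (hψ : ∀ x ∈ ball x₀ R, ∀ y,
      |ψ x - ψ y| ≤ |u x - u y| + 2 * m * |cut x₀ r ρ x - cut x₀ r ρ y|) :
    ∫⁻ x in ball x₀ R, ∫⁻ y, ENNReal.ofReal ((ψ x - ψ y) ^ 2) * symPart K x y < ∞ := by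
  have hms := measurable_symPart S.measurable_K
  have hτ : Measurable (cut x₀ r ρ) := continuous_cut.measurable
  have hle : ∀ x ∈ ball x₀ R, ∫⁻ y, ENNReal.ofReal ((ψ x - ψ y) ^ 2) * symPart K x y ≤
      ENNReal.ofReal 2 * (∫⁻ y, ENNReal.ofReal ((u x - u y) ^ 2) * symPart K x y) +
        ENNReal.ofReal (8 * m ^ 2) * ENNReal.ofReal (4 * (Λ * ρ ^ (-α))) := by
    intro x hx
    refine le_trans ?_ (add_le_add_right
      (mul_le_mul_right (S.levy_symPart.cut_le (z := x₀) (r := r) hρ hρR hx) _) _)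
    rw [← lintegral_const_mul' _ _ ENNReal.ofReal_ne_top,
      ← lintegral_const_mul' _ _ ENNReal.ofReal_ne_top, ← lintegral_add_left
      ((measurable_sub_sq_mul U.measurable hms).of_uncurry_left.const_mul _)]
    refine lintegral_mono fun y => ?_
    simp only
    rw [← mul_assoc, ← mul_assoc, ← add_mul, ← ENNReal.ofReal_mul (by norm_num),
      ← ENNReal.ofReal_mul (by positivity), ← ENNReal.ofReal_add (by positivity) (by positivity)]
    gcongr
    rw [← sq_abs (ψ x - ψ y), ← sq_abs (u x - u y), ← sq_abs (cut x₀ r ρ x - cut x₀ r ρ y)]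
    calc |ψ x - ψ y| ^ 2 ≤ (|u x - u y| + 2 * m * |cut x₀ r ρ x - cut x₀ r ρ y|) ^ 2 := by
          gcongr; exact hψ x hx y
      _ ≤ _ := by nlinarith [sq_nonneg (|u x - u y| - 2 * m * |cut x₀ r ρ x - cut x₀ r ρ y|)]
  refine (setLIntegral_mono' measurableSet_ball hle).trans_lt ?_
  have hm1 : Measurable fun x => ∫⁻ y, ENNReal.ofReal ((u x - u y) ^ 2) * symPart K x y :=
    (measurable_sub_sq_mul U.measurable hms).lintegral_prod_right'
  rw [lintegral_add_left (hm1.const_mul _), lintegral_const_mul _ hm1, setLIntegral_const]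
  exact ENNReal.add_lt_top.2 ⟨ENNReal.mul_lt_top ENNReal.ofReal_lt_top U.energy,
    ENNReal.mul_lt_top (ENNReal.mul_lt_top ENNReal.ofReal_lt_top ENNReal.ofReal_lt_top)
      measure_ball_lt_top⟩

/-- A test function: supported in `B_{r+ρ/2}`, bounded by `m`, with controlled increments. -/
structure TestFunction (x₀ : EuclideanSpace ℝ (Fin d)) (R r ρ m : ℝ)
    (u φ : EuclideanSpace ℝ (Fin d) → ℝ) : Prop where
  measurable : Measurable φ
  eq_zero : ∀ x, r + ρ / 2 ≤ dist x x₀ → φ x = 0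
  abs_le : ∀ x, |φ x| ≤ m
  abs_sub_le : ∀ x ∈ ball x₀ R, ∀ y,
    |φ x - φ y| ≤ |u x - u y| + 2 * m * |cut x₀ r ρ x - cut x₀ r ρ y|

lemma Truncation.testFunction (T : Truncation x₀ R m u w) (hm : 0 ≤ m) (hρ : 0 < ρ)
    (hR : r + ρ ≤ R) : TestFunction x₀ R r ρ m u (fun x => cut x₀ r ρ x ^ 2 * w x) where
  measurable := (continuous_cut.measurable.pow_const 2).mul T.measurable
  eq_zero x hx := by simp [cut_eq_zero hρ hx]
  abs_le x := by
    by_cases hx : x ∈ ball x₀ R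
    · have h0 := T.nonneg x hx
      rw [abs_of_nonneg (by positivity)]
      calc _ ≤ 1 * m := mul_le_mul (pow_le_one₀ cut_nonneg cut_le_one) (T.le_bound x hx) h0
            zero_le_one
        _ = m := one_mul m
    · rw [mem_ball, not_lt] at hx
      rw [cut_eq_zero hρ (by linarith)]
      simpa using hm
  abs_sub_le x hx y := T.abs_cut_sq_mul_sub_le hρ hR hx y

lemma TestFunction.neg {φ : EuclideanSpace ℝ (Fin d) → ℝ} (T : TestFunction x₀ R r ρ m u φ) :
    TestFunction x₀ R r ρ m u (fun x => -φ x) where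
  measurable := T.measurable.neg
  eq_zero x hx := by simp [T.eq_zero x hx]
  abs_le x := by simpa using T.abs_le x
  abs_sub_le x hx y := by
    rw [show -φ x - -φ y = -(φ x - φ y) by ring, abs_neg]
    exact T.abs_sub_le x hx y

variable {φ : EuclideanSpace ℝ (Fin d) → ℝ}

lemma lintegral_lt_top_of_symmetric {B : Set (EuclideanSpace ℝ (Fin d))} (hB : MeasurableSet B)
    {G : EuclideanSpace ℝ (Fin d) × EuclideanSpace ℝ (Fin d) → ℝ≥0∞}
    (hsymm : ∀ x y, G (x, y) = G (y, x))
    (h0 : ∀ x ∉ B, ∀ y ∉ B, G (x, y) = 0) {h : EuclideanSpace ℝ (Fin d) →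
      EuclideanSpace ℝ (Fin d) → ℝ≥0∞}
    (hh : Measurable (Function.uncurry h)) (hG : ∀ x ∈ B, ∀ y, G (x, y) ≤ h x y)
    (hfin : ∫⁻ x in B, ∫⁻ y, h x y < ∞) :
    ∫⁻ p, G p ∂((volume : Measure (EuclideanSpace ℝ (Fin d))).prod volume) < ∞ := by
  refine (lintegral_le_of_symmetric hB hsymm h0 hh hh
    (Filter.Eventually.of_forall fun p hx _ => hG p.1 hx p.2)
    (Filter.Eventually.of_forall fun p hx _ => hG p.1 hx p.2)).trans_lt ?_
  refine ENNReal.add_lt_top.2 ⟨?_, ENNReal.mul_lt_top (by norm_num) ?_⟩ <;>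
  · refine lt_of_le_of_lt (lintegral_mono fun x => ?_) hfin
    exact setLIntegral_le_lintegral _ _

lemma TestFunction.zero_of_notMem (T : TestFunction x₀ R r ρ m u φ) (hρ : 0 < ρ) (hR : r + ρ ≤ R)
    {x : EuclideanSpace ℝ (Fin d)} (hx : x ∉ ball x₀ R) : φ x = 0 := by
  rw [mem_ball, not_lt] at hx
  exact T.eq_zero x (by linarith)

lemma TestFunction.memH (S : LocalSetting α Λ η ℓ K J x₀ R)
    (U : LocalSolution b K x₀ R M F u) (T : TestFunction x₀ R r ρ m u φ) (hr : 0 ≤ r)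
    (hρ : 0 < ρ) (hR : r + ρ ≤ R) : MemH (symPart K) (ball x₀ R) φ where
  memV :=
    { aestronglyMeasurable := T.measurable.aestronglyMeasurable
      memLp := by
        rw [Measure.restrict_univ]
        have : IsFiniteMeasure (volume.restrict (ball x₀ R)) :=
          ⟨by simpa using measure_ball_lt_top⟩
        have h1 : MemLp φ 2 (volume.restrict (ball x₀ R)) :=
          MemLp.of_bound T.measurable.aestronglyMeasurable m
            (Filter.Eventually.of_forall fun x => T.abs_le x)
        rw [← memLp_indicator_iff_restrict measurableSet_ball] at h1
        convert h1 using 1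
        ext x
        by_cases hx : x ∈ ball x₀ R
        · simp [hx]
        · simp [hx, T.zero_of_notMem hρ hR hx]
      energy_lt_top := by
        have hm := measurable_sub_sq_mul T.measurable (measurable_symPart S.measurable_K)
        have h1 := lintegral_lt_top_of_symmetric (B := ball x₀ R) measurableSet_ball
          (G := fun p => ENNReal.ofReal ((φ p.1 - φ p.2) ^ 2) * symPart K p.1 p.2)
          (fun x y => by
            simp only
            rw [symPart_symm, show (φ x - φ y) ^ 2 = (φ y - φ x) ^ 2 by ring])
          (fun x hx y hy => by
            simp [T.zero_of_notMem hρ hR hx, T.zero_of_notMem hρ hR hy])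
          hm (fun x _ y => le_rfl) (S.energy_lt_top U hρ (by linarith) T.abs_sub_le)
        rw [Measure.restrict_univ, ← lintegral_prod
          (fun p => ENNReal.ofReal ((φ p.1 - φ p.2) ^ 2) * symPart K p.1 p.2) hm.aemeasurable]
        exact h1 }
  eq_zero x hx := T.zero_of_notMem hρ hR hx

lemma measurable_symIntegrand (hK : Measurable (Function.uncurry K)) (hu : Measurable u)
    (hφ : Measurable φ) : Measurable (symIntegrand K u φ) :=
  (((hu.comp measurable_fst).sub (hu.comp measurable_snd)).mul
    ((hφ.comp measurable_fst).sub (hφ.comp measurable_snd))).mul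
      (measurable_symPart hK).ennreal_toReal

lemma measurable_antiIntegrand (hK : Measurable (Function.uncurry K)) (hu : Measurable u)
    (hφ : Measurable φ) : Measurable (antiIntegrand K u φ) :=
  (((hu.comp measurable_fst).sub (hu.comp measurable_snd)).mul
    ((hφ.comp measurable_fst).add (hφ.comp measurable_snd))).mul (measurable_antiPart hK)

lemma TestFunction.energy_add_lt_top (S : LocalSetting α Λ η ℓ K J x₀ R)
    (U : LocalSolution b K x₀ R M F u) (T : TestFunction x₀ R r ρ m u φ) (hρ : 0 < ρ)
    (hρR : ρ ≤ R) :
    ∫⁻ x in ball x₀ R, ∫⁻ y, (ENNReal.ofReal ((u x - u y) ^ 2) * symPart K x y +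
      ENNReal.ofReal ((φ x - φ y) ^ 2) * symPart K x y) < ∞ := by
  have hms := measurable_symPart S.measurable_K
  rw [lintegral_lintegral_add (measurable_sub_sq_mul U.measurable hms)]
  exact ENNReal.add_lt_top.2 ⟨U.energy, S.energy_lt_top U hρ hρR T.abs_sub_le⟩

lemma TestFunction.integrable_sym (S : LocalSetting α Λ η ℓ K J x₀ R)
    (U : LocalSolution b K x₀ R M F u) (T : TestFunction x₀ R r ρ m u φ) (hr : 0 ≤ r)
    (hρ : 0 < ρ) (hR : r + ρ ≤ R) : Integrable (symIntegrand K u φ)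
      ((volume : Measure (EuclideanSpace ℝ (Fin d))).prod volume) := by
  have hms := measurable_symPart S.measurable_K
  refine ⟨(measurable_symIntegrand S.measurable_K U.measurable
    T.measurable).aestronglyMeasurable, ?_⟩
  refine lintegral_lt_top_of_symmetric (B := ball x₀ R) measurableSet_ball
    (h := fun x y => ENNReal.ofReal ((u x - u y) ^ 2) * symPart K x y +
      ENNReal.ofReal ((φ x - φ y) ^ 2) * symPart K x y) ?_ ?_
    ((measurable_sub_sq_mul U.measurable hms).add (measurable_sub_sq_mul T.measurable hms)) ?_
    (T.energy_add_lt_top S U hρ (by linarith))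
  · intro x y
    congr 1
    simp only [symIntegrand, symPart_symm x y]
    ring
  · intro x hx y hy
    simp [symIntegrand, T.zero_of_notMem hρ hR hx, T.zero_of_notMem hρ hR hy]
  · intro x _ y
    simp only [symIntegrand]
    rw [← ofReal_norm, Real.norm_eq_abs, abs_mul, abs_of_nonneg ENNReal.toReal_nonneg,
      ENNReal.ofReal_mul (abs_nonneg _), ← add_mul, ← ENNReal.ofReal_add (by positivity)
        (by positivity)]
    gcongr
    · rw [abs_mul, ← sq_abs (u x - u y), ← sq_abs (φ x - φ y)]
      nlinarith [sq_nonneg (|u x - u y| - |φ x - φ y|), sq_nonneg (|u x - u y|),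
        sq_nonneg |φ x - φ y|]
    · exact ENNReal.ofReal_toReal_le

lemma LocalSetting.driftWeight_lt_top (S : LocalSetting α Λ η ℓ K J x₀ R) (hα : α < d) :
    ∫⁻ x in ball x₀ R, driftWeight K J (ball x₀ R) x < ∞ := by
  have h := S.drift (fun _ => 1) measurable_const
  simp only [one_mul, ENNReal.one_rpow, setLIntegral_const] at h
  refine h.trans_lt (ENNReal.add_lt_top.2 ⟨ENNReal.mul_lt_top ENNReal.ofReal_lt_top
    measure_ball_lt_top, ENNReal.mul_lt_top ENNReal.ofReal_lt_top
    (ENNReal.rpow_lt_top_of_nonneg ?_ measure_ball_lt_top.ne)⟩)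
  have : (0 : ℝ) ≤ d := Nat.cast_nonneg d
  exact div_nonneg (by linarith) this

lemma LocalSetting.energyOn_lt_top (S : LocalSetting α Λ η ℓ K J x₀ R) {s : ℝ} (hs : 0 < s)
    (hsR : s ≤ R) (hψ : Measurable ψ) (hb : ∀ x ∈ ball x₀ R, |ψ x| ≤ m)
    (hfin : ∫⁻ x in ball x₀ R, ∫⁻ y, ENNReal.ofReal ((ψ x - ψ y) ^ 2) * symPart K x y < ∞) :
    energyOn (symPart K) (ball x₀ s) ψ < ∞ ∧ energyOn J (ball x₀ s) ψ < ∞ ∧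
      energyOn J (ball x₀ s) ψ ≤ ENNReal.ofReal Λ * energyOn (symPart K) (ball x₀ s) ψ := by
  have hsub : ball x₀ s ⊆ ball x₀ R := ball_subset_ball hsR
  have h1 : energyOn (symPart K) (ball x₀ s) ψ < ∞ := by
    refine lt_of_le_of_lt ?_ hfin
    refine (lintegral_mono fun x => setLIntegral_le_lintegral _ _).trans ?_
    exact lintegral_mono_set hsub
  have : IsFiniteMeasure (volume.restrict (ball x₀ s)) := ⟨by simpa using measure_ball_lt_top⟩
  have h2 := S.energy s hs hsR ψ (MemLp.of_bound hψ.aestronglyMeasurable m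
    ((ae_restrict_mem measurableSet_ball).mono fun x hx => hb x (hsub hx)))
  exact ⟨h1, h2.trans_lt (ENNReal.mul_lt_top ENNReal.ofReal_lt_top h1), h2⟩

lemma TestFunction.integrable_anti (S : LocalSetting α Λ η ℓ K J x₀ R) (hα : α < d)
    (U : LocalSolution b K x₀ R M F u) (T : TestFunction x₀ R r ρ m u φ) (hm : 0 ≤ m)
    (hr : 0 ≤ r) (hρ : 0 < ρ) (hR : r + ρ ≤ R) :
    Integrable (bif b then antiIntegrand K φ u else antiIntegrand K u φ)
      ((volume : Measure (EuclideanSpace ℝ (Fin d))).prod volume) := by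
  have hms := measurable_symPart S.measurable_K
  have hQ := measurable_driftIntegrand S.measurable_K S.measurable_J
  have hu := measurable_sub_sq_mul U.measurable S.measurable_J
  have hφ := measurable_sub_sq_mul T.measurable S.measurable_J
  have hM := U.bound_pos
  have hind : Measurable (Function.uncurry fun x y => (ball x₀ (r + ρ / 2)).indicator
      (fun _ => ENNReal.ofReal (2 * M * m)) x * symPart K x y) :=
    ((measurable_const.indicator measurableSet_ball).comp measurable_fst).mul hms
  refine ⟨?_, ?_⟩
  · cases b
    · exact (measurable_antiIntegrand S.measurable_K U.measurable T.measurable).aestronglyMeasurable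
    · exact (measurable_antiIntegrand S.measurable_K T.measurable U.measurable).aestronglyMeasurable
  refine (lintegral_le_of_symmetric (B := ball x₀ R) measurableSet_ball
    (h := fun x y => ENNReal.ofReal (m + M) * ((ENNReal.ofReal ((u x - u y) ^ 2) * J x y +
      ENNReal.ofReal ((φ x - φ y) ^ 2) * J x y) + ENNReal.ofReal (antiPart K x y ^ 2) / J x y))
    (N := fun x y => (ENNReal.ofReal ((u x - u y) ^ 2) * symPart K x y +
      ENNReal.ofReal ((φ x - φ y) ^ 2) * symPart K x y) + (ball x₀ (r + ρ / 2)).indicator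
      (fun _ => ENNReal.ofReal (2 * M * m)) x * symPart K x y)
    ?_ ?_ (((hu.add hφ).add hQ).const_mul _)
    (((measurable_sub_sq_mul U.measurable hms).add (measurable_sub_sq_mul T.measurable hms)).add
      hind) (Filter.Eventually.of_forall ?_) (Filter.Eventually.of_forall ?_)).trans_lt ?_
  · intro x y
    congr 1
    cases b <;>
    · simp only [antiIntegrand, antiPart_symm x y, cond_true, cond_false]
      ring
  · intro x hx y hy
    cases b <;>
    simp [antiIntegrand, T.zero_of_notMem hρ hR hx, T.zero_of_notMem hρ hR hy]
  · rintro ⟨x, y⟩ hx hy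
    have a1 := T.abs_le x
    have a2 := T.abs_le y
    have u1 := U.le_bound x hx
    have u2 := U.le_bound y hy
    have u3 := U.nonneg x
    have u4 := U.nonneg y
    have key : ∀ t c : ℝ, |c| ≤ 2 * (m + M) → ENNReal.ofReal |t * c * antiPart K x y| ≤
        ENNReal.ofReal (m + M) * ENNReal.ofReal (2 * |t * antiPart K x y|) := by
      intro t c hc
      rw [← ENNReal.ofReal_mul (by positivity)]
      refine ENNReal.ofReal_le_ofReal ?_
      rw [show t * c * antiPart K x y = c * (t * antiPart K x y) by ring, abs_mul c]
      nlinarith [abs_nonneg (t * antiPart K x y)]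
    rw [← ofReal_norm, Real.norm_eq_abs]
    cases b
    · refine (key (u x - u y) (φ x + φ y) ((abs_add_le _ _).trans (by linarith))).trans ?_
      refine mul_le_mul_right ((two_mul_abs_mul_le _ _ (J x y)).trans ?_) _
      gcongr
      exact le_self_add
    · refine (key (φ x - φ y) (u x + u y) ?_).trans ?_
      · rw [abs_of_nonneg (by linarith)]; linarith
      refine mul_le_mul_right ((two_mul_abs_mul_le _ _ (J x y)).trans ?_) _
      gcongr
      exact le_add_self
  · rintro ⟨x, y⟩ hx hy
    have hy0 := T.zero_of_notMem hρ hR hy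
    have a1 := T.abs_le x
    have u1 := U.le_bound x hx
    have u3 := U.nonneg x
    have u4 := U.nonneg y
    have hind0 : ENNReal.ofReal (2 * M * |φ x|) ≤ (ball x₀ (r + ρ / 2)).indicator
      (fun _ => ENNReal.ofReal (2 * M * m)) x := by
      by_cases hxb : x ∈ ball x₀ (r + ρ / 2)
      · rw [indicator_of_mem hxb]
        gcongr
      · rw [mem_ball, not_lt] at hxb
        simp [T.eq_zero x hxb]
    simp only at *
    rw [← ofReal_norm, Real.norm_eq_abs, ← add_mul, ← add_mul, ← ENNReal.ofReal_add (by positivity)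
      (by positivity)]
    have key : ∀ t : ℝ, |t| ≤ (u x - u y) ^ 2 + (φ x - φ y) ^ 2 + 2 * M * |φ x| →
        ENNReal.ofReal |t * antiPart K x y| ≤ (ENNReal.ofReal ((u x - u y) ^ 2 + (φ x - φ y) ^ 2) +
          (ball x₀ (r + ρ / 2)).indicator (fun _ => ENNReal.ofReal (2 * M * m)) x) *
            symPart K x y := by
      intro t ht
      rw [abs_mul, ENNReal.ofReal_mul (abs_nonneg _)]
      refine mul_le_mul' ?_ (ofReal_abs_antiPart_le x y)
      refine le_trans ?_ (add_le_add_right hind0 _)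
      rw [← ENNReal.ofReal_add (by positivity) (by positivity)]
      exact ENNReal.ofReal_le_ofReal ht
    have hA := abs_nonneg (φ x)
    have hB := abs_nonneg (u x - u y)
    cases b
    · refine key _ ?_
      rw [hy0, add_zero, sub_zero, abs_mul, ← sq_abs (u x - u y), ← sq_abs (φ x)]
      nlinarith [mul_nonneg hM.le hA, sq_nonneg (|φ x| - |u x - u y|)]
    · refine key _ ?_
      have h3 : |u x + u y| ≤ |u x - u y| + 2 * M := by
        rw [abs_of_nonneg (by linarith)]
        linarith [neg_abs_le (u x - u y)]
      rw [hy0, sub_zero, abs_mul, ← sq_abs (u x - u y), ← sq_abs (φ x)]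
      nlinarith [mul_nonneg hM.le hA, sq_nonneg (|φ x| - |u x - u y|),
        mul_le_mul_of_nonneg_left h3 hA]
  · rw [lintegral_lintegral_const_mul ((hu.add hφ).add hQ),
      lintegral_lintegral_add (hu.add hφ), lintegral_lintegral_add hu,
      lintegral_lintegral_add ((measurable_sub_sq_mul U.measurable hms).add
        (measurable_sub_sq_mul T.measurable hms))]
    have hE := T.energy_add_lt_top S U hρ (by linarith)
    have e1 := (S.energyOn_lt_top S.R_pos le_rfl U.measurable (m := M) (fun x hx => by
      rw [abs_of_nonneg (U.nonneg x)]; exact U.le_bound x hx) U.energy).2.1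
    have e2 := (S.energyOn_lt_top S.R_pos le_rfl T.measurable (fun x _ => T.abs_le x)
      (S.energy_lt_top U hρ (by linarith) T.abs_sub_le)).2.1
    refine ENNReal.add_lt_top.2 ⟨ENNReal.mul_lt_top ENNReal.ofReal_lt_top (ENNReal.add_lt_top.2
      ⟨ENNReal.add_lt_top.2 ⟨e1, e2⟩, S.driftWeight_lt_top hα⟩),
      ENNReal.mul_lt_top (by norm_num) (ENNReal.add_lt_top.2 ⟨?_, ?_⟩)⟩
    · exact (lintegral_mono fun x => setLIntegral_le_lintegral _ _).trans_lt hE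
    · have h1 : ∀ x ∈ ball x₀ R, ∫⁻ y in (ball x₀ R)ᶜ, (ball x₀ (r + ρ / 2)).indicator
          (fun _ => ENNReal.ofReal (2 * M * m)) x * symPart K x y ≤
          ENNReal.ofReal (2 * M * m) * ENNReal.ofReal (4 * (Λ * ρ ^ (-α))) := by
        intro x hx
        by_cases hxb : x ∈ ball x₀ (r + ρ / 2)
        · simp only [indicator_of_mem hxb]
          rw [lintegral_const_mul _ hms.of_uncurry_left]
          gcongr
          refine le_trans (lintegral_mono_set (compl_subset_compl.2 (ball_subset_ball hR))) ?_
          exact S.levy_symPart.compl_ball_le hρ (by linarith) hx (mem_ball.1 hxb).le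
        · simp [hxb]
      refine (setLIntegral_mono' measurableSet_ball h1).trans_lt ?_
      rw [setLIntegral_const]
      exact ENNReal.mul_lt_top (ENNReal.mul_lt_top ENNReal.ofReal_lt_top ENNReal.ofReal_lt_top)
        measure_ball_lt_top

end

/-! ### The energy estimate -/

lemma lintegral_lintegral_add_mul_of_symmetric {X : Type*} [MeasurableSpace X] {μ : Measure X}
    [SFinite μ] {A : X → ℝ≥0∞} {G : X → X → ℝ≥0∞} (hA : Measurable A)
    (hG : Measurable (Function.uncurry G)) (hs : ∀ x y, G x y = G y x) :
    ∫⁻ x, ∫⁻ y, (A x + A y) * G x y ∂μ ∂μ = 2 * ∫⁻ x, A x * ∫⁻ y, G x y ∂μ ∂μ := by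
  have h1 : Measurable (Function.uncurry fun x y => A x * G x y) := (hA.comp measurable_fst).mul hG
  simp_rw [add_mul]
  rw [lintegral_lintegral_add h1]
  have h2 : ∫⁻ x, ∫⁻ y, A y * G x y ∂μ ∂μ = ∫⁻ x, ∫⁻ y, A x * G x y ∂μ ∂μ := by
    rw [lintegral_lintegral_swap ((hA.comp measurable_snd).mul hG).aemeasurable]
    simp_rw [hs]
  have h3 : ∀ x, ∫⁻ y, A x * G x y ∂μ = A x * ∫⁻ y, G x y ∂μ := fun x =>
    lintegral_const_mul _ hG.of_uncurry_left
  rw [h2, ← two_mul]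
  simp_rw [h3]

lemma ofReal_near_le {V s F c₁ c₂ j A A' T D D' q : ℝ} (hV : 0 ≤ V) (hs : 0 ≤ s) (h₁ : 0 ≤ c₁)
    (h₂ : 0 ≤ c₂) (hj : 0 ≤ j) (hA : 0 ≤ A) (hA' : 0 ≤ A') (hT : 0 ≤ T) (hD : 0 ≤ D) (hD' : 0 ≤ D')
    (hq : 0 ≤ q)
    (h : V * s ≤ F + (c₁ * V + c₂ * T * (A + A')) * j + c₂ * (D + D') * q) :
    ENNReal.ofReal V * ENNReal.ofReal s + ENNReal.ofReal (-F) ≤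
      ENNReal.ofReal c₁ * (ENNReal.ofReal V * ENNReal.ofReal j) +
        (ENNReal.ofReal c₂ * ((ENNReal.ofReal A + ENNReal.ofReal A') *
          (ENNReal.ofReal T * ENNReal.ofReal j)) +
          ENNReal.ofReal c₂ * ((ENNReal.ofReal D + ENNReal.ofReal D') * ENNReal.ofReal q)) +
        ENNReal.ofReal F := by
  rw [← ENNReal.ofReal_mul hV, ← ENNReal.ofReal_mul hV, ← ENNReal.ofReal_mul hT,
    ← ENNReal.ofReal_add hA hA', ← ENNReal.ofReal_add hD hD', ← ENNReal.ofReal_mul h₁,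
    ← ENNReal.ofReal_mul (add_nonneg hA hA'), ← ENNReal.ofReal_mul (add_nonneg hD hD'),
    ← ENNReal.ofReal_mul h₂, ← ENNReal.ofReal_mul h₂,
    ← ENNReal.ofReal_add (p := c₂ * ((A + A') * (T * j))) (by positivity) (by positivity),
    ← ENNReal.ofReal_add (p := c₁ * (V * j)) (by positivity) (by positivity)]
  exact ofReal_add_le_of_le (by positivity) (by positivity) (by linarith)

section

variable {α Λ η ℓ : ℝ} {K J : Kernel d} {x₀ : EuclideanSpace ℝ (Fin d)} {R M F m r ρ : ℝ}
  {b : Bool} {u w : EuclideanSpace ℝ (Fin d) → ℝ}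

lemma LocalSetting.abs_antiPart_le (S : LocalSetting α Λ η ℓ K J x₀ R)
    {x y : EuclideanSpace ℝ (Fin d)} (h : J x y ≠ ∞) :
    |antiPart K x y| ≤ (symPart K x y).toReal ∧ (symPart K x y).toReal ≤ (J x y).toReal := by
  have h1 := S.symPart_le x y
  have h2 : symPart K x y ≠ ∞ := (h1.trans_lt h.lt_top).ne
  exact ⟨(ENNReal.ofReal_le_iff_le_toReal h2).1 (ofReal_abs_antiPart_le x y),
    ENNReal.toReal_mono h h1⟩

lemma LocalSetting.antiPart_sq (S : LocalSetting α Λ η ℓ K J x₀ R)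
    {x y : EuclideanSpace ℝ (Fin d)} (h : J x y ≠ ∞) :
    antiPart K x y ^ 2 = antiPart K x y ^ 2 / (J x y).toReal * (J x y).toReal ∧
      ENNReal.ofReal (antiPart K x y ^ 2) / J x y =
        ENNReal.ofReal (antiPart K x y ^ 2 / (J x y).toReal) := by
  obtain ⟨h1, h2⟩ := S.abs_antiPart_le h
  rcases (ENNReal.toReal_nonneg (a := J x y)).eq_or_lt with h0 | h0
  · have ha : antiPart K x y = 0 := abs_eq_zero.1 (le_antisymm (by linarith) (abs_nonneg _))
    simp [ha]
  · refine ⟨by field_simp, ?_⟩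
    rw [ENNReal.ofReal_div_of_pos h0, ENNReal.ofReal_toReal h]

lemma LocalSetting.toReal_eq (S : LocalSetting α Λ η ℓ K J x₀ R)
    {x y : EuclideanSpace ℝ (Fin d)} (h : J x y ≠ ∞) :
    K x y ≠ ∞ ∧ K y x ≠ ∞ ∧
      (symPart K x y).toReal = ((K x y).toReal + (K y x).toReal) / 2 := by
  have h2 : symPart K x y ≠ ∞ := ((S.symPart_le x y).trans_lt h.lt_top).ne
  have h3 : K x y + K y x ≠ ∞ := fun hh => h2 (by
    rw [symPart, hh, ENNReal.top_div_of_ne_top (by norm_num)])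
  obtain ⟨h4, h5⟩ := ENNReal.add_ne_top.1 h3
  refine ⟨h4, h5, ?_⟩
  rw [symPart, ENNReal.toReal_div, ENNReal.toReal_add h4 h5]
  norm_num

lemma LocalSetting.energy_estimate (S : LocalSetting α Λ η ℓ K J x₀ R) (hd : 0 < d)
    (hρ : 0 < ρ) (hρR : ρ ≤ R) (hR : r + ρ ≤ R)
    {v N : EuclideanSpace ℝ (Fin d) → ℝ} (hv : Measurable v) (hN : Measurable N)
    (hN0 : ∀ x, 0 ≤ N x)
    (hE : energyOn (symPart K) (ball x₀ (r + ρ)) v < ∞)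
    (hEJ : energyOn J (ball x₀ (r + ρ)) v ≤
      ENNReal.ofReal Λ * energyOn (symPart K) (ball x₀ (r + ρ)) v)
    {f : EuclideanSpace ℝ (Fin d) × EuclideanSpace ℝ (Fin d) → ℝ}
    (hf : Integrable f ((volume : Measure (EuclideanSpace ℝ (Fin d))).prod volume))
    (hsymm : ∀ x y, f (x, y) = f (y, x))
    (h0 : ∀ x ∉ ball x₀ (r + ρ), ∀ y ∉ ball x₀ (r + ρ), f (x, y) = 0)
    (hnear : ∀ x ∈ ball x₀ (r + ρ), ∀ y ∈ ball x₀ (r + ρ), J x y ≠ ∞ →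
      (v x - v y) ^ 2 * (symPart K x y).toReal ≤ f (x, y) +
        (1 / (2 * Λ) * (v x - v y) ^ 2 +
          4 * Λ * (cut x₀ r ρ x - cut x₀ r ρ y) ^ 2 * (N x + N y)) * (J x y).toReal +
        4 * Λ * (cut x₀ r ρ x ^ 2 * N x + cut x₀ r ρ y ^ 2 * N y) *
          (antiPart K x y ^ 2 / (J x y).toReal))
    {P Q : EuclideanSpace ℝ (Fin d) → EuclideanSpace ℝ (Fin d) → ℝ≥0∞}
    (hP : Measurable (Function.uncurry P)) (hQ : Measurable (Function.uncurry Q))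
    (hfar : ∀ x ∈ ball x₀ (r + ρ), ∀ y ∉ ball x₀ (r + ρ), J x y ≠ ∞ →
      P x y + ENNReal.ofReal (-f (x, y)) ≤ Q x y + ENNReal.ofReal (f (x, y))) :
    energyOn (symPart K) (ball x₀ (r + ρ)) v +
        4 * (∫⁻ x in ball x₀ (r + ρ), ∫⁻ y in (ball x₀ (r + ρ))ᶜ, P x y) ≤
      ENNReal.ofReal (16 * Λ) *
        (ENNReal.ofReal (4 * (Λ * ρ ^ (-α))) * (∫⁻ x in ball x₀ (r + ρ), ENNReal.ofReal (N x)) +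
          ∫⁻ x in ball x₀ (r + ρ), ENNReal.ofReal (cut x₀ r ρ x ^ 2 * N x) *
            driftWeight K J (ball x₀ R) x) +
        4 * (∫⁻ x in ball x₀ (r + ρ), ∫⁻ y in (ball x₀ (r + ρ))ᶜ, Q x y) +
        2 * ENNReal.ofReal
          (∫ p, f p ∂((volume : Measure (EuclideanSpace ℝ (Fin d))).prod volume)) := by
  have hΛ : 0 < Λ := by linarith [S.one_le]
  have hsub : ball x₀ (r + ρ) ⊆ ball x₀ R := ball_subset_ball hR
  have hms := measurable_symPart S.measurable_K
  have hmQ := measurable_driftIntegrand S.measurable_K S.measurable_J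
  have hmτ : Measurable (cut x₀ r ρ) := continuous_cut.measurable
  set B := ball x₀ (r + ρ) with hB
  set g : EuclideanSpace ℝ (Fin d) → EuclideanSpace ℝ (Fin d) → ℝ≥0∞ :=
    fun x y => ENNReal.ofReal ((v x - v y) ^ 2) * symPart K x y with hg
  set h1 : EuclideanSpace ℝ (Fin d) → EuclideanSpace ℝ (Fin d) → ℝ≥0∞ :=
    fun x y => ENNReal.ofReal ((v x - v y) ^ 2) * J x y with hh1
  set G : EuclideanSpace ℝ (Fin d) → EuclideanSpace ℝ (Fin d) → ℝ≥0∞ :=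
    fun x y => ENNReal.ofReal ((cut x₀ r ρ x - cut x₀ r ρ y) ^ 2) * J x y with hG
  set q : EuclideanSpace ℝ (Fin d) → EuclideanSpace ℝ (Fin d) → ℝ≥0∞ :=
    fun x y => ENNReal.ofReal (antiPart K x y ^ 2) / J x y with hq
  set A : EuclideanSpace ℝ (Fin d) → ℝ≥0∞ := fun x => ENNReal.ofReal (N x) with hA
  set D : EuclideanSpace ℝ (Fin d) → ℝ≥0∞ := fun x => ENNReal.ofReal (cut x₀ r ρ x ^ 2 * N x)
    with hD
  have hmA : Measurable A := hN.ennreal_ofReal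
  have hmD : Measurable D := ((hmτ.pow_const 2).mul hN).ennreal_ofReal
  have hmh1 : Measurable (Function.uncurry h1) := measurable_sub_sq_mul hv S.measurable_J
  have hmG : Measurable (Function.uncurry G) := measurable_sub_sq_mul hmτ S.measurable_J
  have hmAG : Measurable (Function.uncurry fun x y => (A x + A y) * G x y) :=
    ((hmA.comp measurable_fst).add (hmA.comp measurable_snd)).mul hmG
  have hmDq : Measurable (Function.uncurry fun x y => (D x + D y) * q x y) :=
    ((hmD.comp measurable_fst).add (hmD.comp measurable_snd)).mul hmQ
  have key := lintegral_add_le_of_symmetric (B := B) measurableSet_ball hf hsymm h0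
    (g := g) (P := P) (N := Q)
    (h := fun x y => ENNReal.ofReal (1 / (2 * Λ)) * h1 x y +
      (ENNReal.ofReal (4 * Λ) * ((A x + A y) * G x y) +
        ENNReal.ofReal (4 * Λ) * ((D x + D y) * q x y)))
    (measurable_sub_sq_mul hv hms)
    ((hmh1.const_mul _).add ((hmAG.const_mul _).add (hmDq.const_mul _))) hP hQ ?_ ?_
  rotate_left
  · filter_upwards [S.ae_ne_top hd] with p hp hx hy
    obtain ⟨x, y⟩ := p
    have hJ := hp (hsub hx)
    obtain ⟨a1, a2⟩ := S.antiPart_sq hJ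
    have hs : symPart K x y ≠ ∞ := ((S.symPart_le x y).trans_lt hJ.lt_top).ne
    have hn := hnear x hx y hy hJ
    have hl := ofReal_near_le (sq_nonneg _) ENNReal.toReal_nonneg (by positivity) (by positivity)
      ENNReal.toReal_nonneg (hN0 x) (hN0 y) (sq_nonneg _)
      (mul_nonneg (sq_nonneg (cut x₀ r ρ x)) (hN0 x))
      (mul_nonneg (sq_nonneg (cut x₀ r ρ y)) (hN0 y))
      (div_nonneg (sq_nonneg _) ENNReal.toReal_nonneg) hn
    rw [ENNReal.ofReal_toReal hs, ENNReal.ofReal_toReal hJ, ← a2] at hl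
    exact hl
  · filter_upwards [S.ae_ne_top hd] with p hp hx hy
    exact hfar p.1 hx p.2 hy (hp (hsub hx))
  rw [lintegral_lintegral_add (hmh1.const_mul _), lintegral_lintegral_add (hmAG.const_mul _),
    lintegral_lintegral_const_mul hmh1, lintegral_lintegral_const_mul hmAG,
    lintegral_lintegral_const_mul hmDq, lintegral_lintegral_add_mul_of_symmetric hmA hmG ?_,
    lintegral_lintegral_add_mul_of_symmetric hmD hmQ ?_] at key
  rotate_left
  · intro x y
    simp only [hq]
    rw [antiPart_symm x y, neg_sq, S.symm_J x y]
  · intro x y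
    simp only [hG]
    rw [S.symm_J x y, show (cut x₀ r ρ x - cut x₀ r ρ y) ^ 2 =
      (cut x₀ r ρ y - cut x₀ r ρ x) ^ 2 by ring]
  have eG : ∫⁻ x in B, A x * ∫⁻ y in B, G x y ≤
      ENNReal.ofReal (4 * (Λ * ρ ^ (-α))) * ∫⁻ x in B, A x := by
    rw [← lintegral_const_mul _ hmA]
    refine setLIntegral_mono' measurableSet_ball fun x hx => ?_
    rw [mul_comm]
    gcongr
    exact (setLIntegral_le_lintegral _ _).trans (S.levy.cut_le hρ hρR (hsub hx))
  have eD : ∫⁻ x in B, D x * ∫⁻ y in B, q x y ≤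
      ∫⁻ x in B, D x * driftWeight K J (ball x₀ R) x := by
    refine lintegral_mono fun x => ?_
    exact mul_le_mul_right (lintegral_mono_set hsub) _
  have eE : ENNReal.ofReal (1 / (2 * Λ)) * ∫⁻ x in B, ∫⁻ y in B, h1 x y ≤
      energyOn (symPart K) B v / 2 := by
    refine (mul_le_mul_right hEJ _).trans ?_
    rw [← mul_assoc, ← ENNReal.ofReal_mul (by positivity),
      show 1 / (2 * Λ) * Λ = 2⁻¹ by field_simp, ENNReal.ofReal_inv_of_pos (by norm_num),
      ENNReal.ofReal_ofNat, ENNReal.div_eq_inv_mul]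
  have hE' : energyOn (symPart K) B v = ∫⁻ x in B, ∫⁻ y in B, g x y := rfl
  rw [← hE'] at key
  set E := energyOn (symPart K) B v
  set IP := ∫⁻ x in B, ∫⁻ y in Bᶜ, P x y
  set IQ := ∫⁻ x in B, ∫⁻ y in Bᶜ, Q x y
  set I1 := ∫⁻ x in B, A x
  set I2 := ∫⁻ x in B, D x * driftWeight K J (ball x₀ R) x
  set If := ENNReal.ofReal
    (∫ p, f p ∂((volume : Measure (EuclideanSpace ℝ (Fin d))).prod volume))
  set cρ := ENNReal.ofReal (4 * (Λ * ρ ^ (-α)))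
  have k1 : E + 2 * IP ≤ E / 2 + (ENNReal.ofReal (8 * Λ) * (cρ * I1 + I2) + 2 * IQ + If) := by
    refine key.trans ?_
    have e8 : ENNReal.ofReal (8 * Λ) = ENNReal.ofReal (4 * Λ) * 2 := by
      rw [show 8 * Λ = 4 * Λ * 2 by ring, ENNReal.ofReal_mul (by positivity)]; norm_num
    rw [e8]
    calc _ ≤ E / 2 + (ENNReal.ofReal (4 * Λ) * (2 * (cρ * I1)) +
          ENNReal.ofReal (4 * Λ) * (2 * I2)) + 2 * IQ + If := by gcongr
      _ = _ := by ring
  have k2 : E / 2 + 2 * IP ≤ ENNReal.ofReal (8 * Λ) * (cρ * I1 + I2) + 2 * IQ + If := by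
    have hfin : E / 2 ≠ ∞ := ENNReal.div_ne_top hE.ne (by norm_num)
    refine (ENNReal.add_le_add_iff_left hfin).1 ?_
    rwa [← add_assoc, ENNReal.add_halves]
  calc E + 4 * IP = 2 * (E / 2 + 2 * IP) := by
        rw [mul_add, ENNReal.mul_div_cancel (by norm_num) (by norm_num)]; ring
    _ ≤ 2 * (ENNReal.ofReal (8 * Λ) * (cρ * I1 + I2) + 2 * IQ + If) := by gcongr
    _ = _ := by
      rw [show 16 * Λ = 2 * (8 * Λ) by ring, ENNReal.ofReal_mul (p := 2) (by norm_num)]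
      norm_num
      ring

end

/-! ### The tail estimate -/

/-- The volume of the unit ball. -/
noncomputable def ballVol (d : ℕ) : ℝ :=
  (volume (ball (0 : EuclideanSpace ℝ (Fin d)) 1)).toReal

lemma ballVol_pos : 0 < ballVol d :=
  ENNReal.toReal_pos (measure_ball_pos _ _ one_pos).ne' measure_ball_lt_top.ne

lemma volume_ball_eq (x : EuclideanSpace ℝ (Fin d)) {r : ℝ} (hr : 0 < r) :
    volume (ball x r) = ENNReal.ofReal (ballVol d * r ^ d) := by
  rw [Measure.addHaar_ball_of_pos _ _ hr, finrank_euclideanSpace_fin, mul_comm,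
    ENNReal.ofReal_mul ballVol_pos.le, ballVol, ENNReal.ofReal_toReal measure_ball_lt_top.ne]

lemma ofReal_mul_eq_of_ne_top {c : ℝ} (hc : 0 ≤ c) {k : ℝ≥0∞} (hk : k ≠ ∞) :
    ENNReal.ofReal c * k = ENNReal.ofReal (c * k.toReal) := by
  rw [ENNReal.ofReal_mul hc, ENNReal.ofReal_toReal hk]

section

variable {α Λ η ℓ : ℝ} {K J : Kernel d} {x₀ : EuclideanSpace ℝ (Fin d)} {R M F m r ρ : ℝ}
  {b : Bool} {u w : EuclideanSpace ℝ (Fin d) → ℝ}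

lemma farKernel_le (x y : EuclideanSpace ℝ (Fin d)) : farKernel b K x y ≤ 2 * symPart K x y := by
  rw [symPart, ENNReal.mul_div_cancel (by norm_num) (by norm_num)]
  cases b
  · exact le_self_add
  · exact le_add_self

lemma kernel_le (x y : EuclideanSpace ℝ (Fin d)) : K x y ≤ 2 * symPart K x y :=
  farKernel_le (b := false) x y

lemma LocalSetting.far_compl_ball_le (S : LocalSetting α Λ η ℓ K J x₀ R) {k : Kernel d}
    (hk : ∀ x y, k x y ≤ 2 * symPart K x y) (hρ : 0 < ρ) (hρR : ρ ≤ R)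
    {x : EuclideanSpace ℝ (Fin d)} (hx : x ∈ ball x₀ R) (hxr : dist x x₀ ≤ r + ρ / 2) :
    ∫⁻ y in (ball x₀ (r + ρ))ᶜ, k x y ≤ ENNReal.ofReal (8 * Λ * ρ ^ (-α)) := by
  refine (lintegral_mono fun y => hk x y).trans ?_
  rw [lintegral_const_mul _ (measurable_symPart S.measurable_K).of_uncurry_left,
    show 8 * Λ * ρ ^ (-α) = 2 * (4 * (Λ * ρ ^ (-α))) by ring,
    ENNReal.ofReal_mul (p := 2) (by norm_num), ENNReal.ofReal_ofNat]
  gcongr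
  exact S.levy_symPart.compl_ball_le hρ hρR hx hxr

/-- The value of the pairing off the diagonal block. -/
lemma LocalSetting.pairing_far (S : LocalSetting α Λ η ℓ K J x₀ R)
    {x y : EuclideanSpace ℝ (Fin d)} (h : J x y ≠ ∞) {φ : EuclideanSpace ℝ (Fin d) → ℝ}
    (hy : φ y = 0) :
    pairing b K u φ (x, y) =
      φ x * (u x * (K x y).toReal - u y * (farKernel b K x y).toReal) := by
  obtain ⟨_, _, h3⟩ := S.toReal_eq h
  cases b <;>
  · simp only [pairing, symIntegrand, antiIntegrand, farKernel, cond_true, cond_false, h3, hy,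
      antiPart]
    ring

lemma LocalSetting.driftWeight_le (S : LocalSetting α Λ η ℓ K J x₀ R) (hα0 : 0 < α) (hα : α < d)
    (hη : 0 ≤ η) :
    ∫⁻ x in ball x₀ R, driftWeight K J (ball x₀ R) x ≤
      ENNReal.ofReal ((ℓ * ballVol d + η * ballVol d ^ (((d : ℝ) - α) / d)) *
        R ^ ((d : ℝ) - α)) := by
  have hd : (0 : ℝ) < d := hα0.trans hα
  have hR := S.R_pos
  have hω := ballVol_pos (d := d)
  have hΛ := S.drift_nonneg
  have h := S.drift (fun _ => 1) measurable_const
  simp only [one_mul, ENNReal.one_rpow, setLIntegral_const] at h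
  refine h.trans ?_
  rw [volume_ball_eq _ hR, ENNReal.ofReal_rpow_of_nonneg (by positivity)
    (div_nonneg (by linarith) hd.le), ← ENNReal.ofReal_mul hΛ, ← ENNReal.ofReal_mul hη,
    ← ENNReal.ofReal_add (by positivity) (by positivity)]
  refine ENNReal.ofReal_le_ofReal ?_
  rw [Real.mul_rpow hω.le (by positivity), ← Real.rpow_natCast R d, ← Real.rpow_mul hR.le,
    mul_div_cancel₀ _ hd.ne', add_mul]
  have : R ^ (d : ℝ) ≤ R ^ ((d : ℝ) - α) :=
    Real.rpow_le_rpow_of_exponent_ge hR S.R_le_one (by linarith)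
  have h2 : ℓ * ballVol d * R ^ (d : ℝ) ≤ ℓ * ballVol d * R ^ ((d : ℝ) - α) := by gcongr
  linarith

lemma LocalSolution.truncation_sub (U : LocalSolution b K x₀ R M F u) :
    Truncation x₀ R (2 * M) u (fun x => 2 * M - u x) where
  measurable := measurable_const.sub U.measurable
  nonneg x hx := by linarith [U.le_bound x hx, U.bound_pos]
  le_bound x hx := by linarith [U.nonneg x]
  abs_sub_le x y := by
    rw [show 2 * M - u x - (2 * M - u y) = -(u x - u y) by ring, abs_neg]

lemma LocalSolution.truncation_max (U : LocalSolution b K x₀ R M F u) {k : ℝ} (hk : 0 ≤ k) :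
    Truncation x₀ R M u (fun x => max (u x - k) 0) where
  measurable := (U.measurable.sub_const k).max measurable_const
  nonneg x _ := le_max_right _ _
  le_bound x hx := max_le (by linarith [U.le_bound x hx]) U.bound_pos.le
  abs_sub_le x y := by
    refine (abs_max_sub_max_le_abs _ _ _).trans ?_
    rw [show u x - k - (u y - k) = u x - u y by ring]

lemma LocalSolution.tail_energy (S : LocalSetting α Λ η ℓ K J x₀ R) (U : LocalSolution b K x₀ R M F u)
    (hα0 : 0 < α) (hα : α < d) (hr : 0 ≤ r) (hρ : 0 < ρ) (hR : r + ρ = R) :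
    4 * (∫⁻ x in ball x₀ R, ∫⁻ y in (ball x₀ R)ᶜ,
        ENNReal.ofReal (M * cut x₀ r ρ x ^ 2 * u y) * farKernel b K x y) ≤
      ENNReal.ofReal (16 * Λ) * (ENNReal.ofReal (4 * (Λ * ρ ^ (-α))) *
          (ENNReal.ofReal (8 * M ^ 2) * volume (ball x₀ R)) +
        ENNReal.ofReal (8 * M ^ 2) * ∫⁻ x in ball x₀ R, driftWeight K J (ball x₀ R) x) +
      4 * (ENNReal.ofReal (2 * M ^ 2) * ENNReal.ofReal (8 * Λ * ρ ^ (-α)) * volume (ball x₀ R)) +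
      2 * (ENNReal.ofReal (2 * M * F) * volume (ball x₀ R)) := by
  have hd : 0 < d := by exact_mod_cast hα0.trans hα
  have hM := U.bound_pos
  have hΛ := S.one_le
  have hρR : ρ ≤ R := by linarith
  have hR' : r + ρ ≤ R := hR.le
  have hF := U.rhs_nonneg
  have T := U.truncation_sub
  have T1 := (T.testFunction (r := r) (ρ := ρ) (by linarith) hρ hR').neg
  set φ : EuclideanSpace ℝ (Fin d) → ℝ := fun x => -(cut x₀ r ρ x ^ 2 * (2 * M - u x)) with hφ
  have hH := T1.memH S U hr hρ hR'
  have i1 := T1.integrable_sym S U hr hρ hR'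
  have i2 := T1.integrable_anti S hα U (by linarith) hr hρ hR'
  have hmv : Measurable fun x => cut x₀ r ρ x * (2 * M - u x) :=
    continuous_cut.measurable.mul T.measurable
  have hball : ∀ x ∈ ball x₀ R, φ x ≤ 0 := fun x hx => by
    have h1 := T.nonneg x hx
    simp only [hφ, Left.neg_nonpos_iff]
    positivity
  have hsign : ∀ x, φ x ≤ 0 := fun x => by
    by_cases hx : x ∈ ball x₀ R
    · exact hball x hx
    · exact (T1.zero_of_notMem hρ hR' hx).le
  have hint : Integrable (pairing b K u φ)
      ((volume : Measure (EuclideanSpace ℝ (Fin d))).prod volume) := by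
    cases b
    · exact i1.add i2
    · exact i1.add i2
  have htest := U.test φ hH (Or.inl hsign) i1 i2
  have hE := S.energyOn_lt_top S.R_pos le_rfl hmv (m := 2 * M) (fun x hx => by
    have h1 := T.nonneg x hx
    have h2 := T.le_bound x hx
    rw [abs_of_nonneg (mul_nonneg cut_nonneg h1)]
    calc _ ≤ 1 * (2 * M) := mul_le_mul cut_le_one h2 h1 zero_le_one
      _ = _ := one_mul _)
    (S.energy_lt_top U hρ hρR fun x hx y => T.abs_cut_mul_sub_le hρ hR' hx y)
  have hfarm := measurable_farKernel (b := b) S.measurable_K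
  have key := S.energy_estimate hd hρ hρR hR' hmv (N := fun _ => 8 * M ^ 2) measurable_const
    (fun _ => by positivity) (by rw [hR]; exact hE.1) (by rw [hR]; exact hE.2.2) hint
    (pairing_symm b u φ) ?_ ?_
    (P := fun x y => ENNReal.ofReal (M * cut x₀ r ρ x ^ 2 * u y) * farKernel b K x y)
    (Q := fun x y => ENNReal.ofReal (2 * M ^ 2 * cut x₀ r ρ x ^ 2) * K x y) ?_ ?_ ?_
  · rw [hR] at key
    refine le_add_self.trans (key.trans ?_)
    have hmW := measurable_driftWeight S.measurable_K S.measurable_J (ball x₀ R)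
    gcongr
    · rw [setLIntegral_const]
    · rw [← lintegral_const_mul _ hmW]
      refine lintegral_mono fun x => mul_le_mul' (ENNReal.ofReal_le_ofReal ?_) le_rfl
      have h1 : cut x₀ r ρ x ^ 2 ≤ 1 := pow_le_one₀ cut_nonneg cut_le_one
      nlinarith [sq_nonneg M]
    · rw [← setLIntegral_const]
      refine setLIntegral_mono' measurableSet_ball fun x hx => ?_
      rw [lintegral_const_mul _ S.measurable_K.of_uncurry_left]
      rcases le_or_gt (r + ρ / 2) (dist x x₀) with hxr | hxr
      · simp [cut_eq_zero hρ hxr]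
      · refine mul_le_mul' (ENNReal.ofReal_le_ofReal ?_) ?_
        · have h1 : cut x₀ r ρ x ^ 2 ≤ 1 := pow_le_one₀ cut_nonneg cut_le_one
          nlinarith [sq_nonneg M]
        · rw [← hR]
          exact S.far_compl_ball_le kernel_le hρ hρR hx hxr.le
    · refine (ENNReal.ofReal_le_ofReal htest).trans ?_
      rw [ENNReal.ofReal_mul hF]
      have hb : ∫ x in ball x₀ R, |φ x| ≤ 2 * M * (volume (ball x₀ R)).toReal := by
        have := norm_setIntegral_le_of_norm_le_const (f := fun x => |φ x|) (C := 2 * M)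
          (s := ball x₀ R) (μ := volume) measure_ball_lt_top
          (fun x _ => by simpa using T1.abs_le x)
        exact (le_abs_self _).trans this
      refine (mul_le_mul_right (ENNReal.ofReal_le_ofReal hb) _).trans ?_
      rw [ENNReal.ofReal_mul (by positivity), ENNReal.ofReal_toReal measure_ball_lt_top.ne,
        ← mul_assoc, ← ENNReal.ofReal_mul hF, mul_comm F]
  · intro x hx y hy
    rw [hR] at hx hy
    have e1 := T1.zero_of_notMem hρ hR' hx
    have e2 := T1.zero_of_notMem hρ hR' hy
    cases b <;> simp [pairing, symIntegrand, antiIntegrand, e1, e2]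
  · intro x hx y hy hJ
    rw [hR] at hx hy
    obtain ⟨a1, a2⟩ := S.abs_antiPart_le hJ
    have a3 := (S.antiPart_sq hJ).1
    have hx1 := T.nonneg x hx
    have hx2 := T.le_bound x hx
    have hy1 := T.nonneg y hy
    have hy2 := T.le_bound y hy
    have hε : 0 < 1 / (2 * Λ) := by positivity
    have hε1 : 1 / (2 * Λ) ≤ 1 := by rw [div_le_one (by positivity)]; linarith
    have hK2 : 4 * Λ * (1 / (2 * Λ)) = 2 := by field_simp; norm_num
    have hq : 0 ≤ antiPart K x y ^ 2 / (J x y).toReal :=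
      div_nonneg (sq_nonneg _) ENNReal.toReal_nonneg
    cases b
    · refine (near_primal' (Nx := 8 * M ^ 2) (Ny := 8 * M ^ 2) a1 a2 a3 hq hε hε1 hK2 (by nlinarith)
        (by nlinarith)).trans (le_of_eq ?_)
      simp only [pairing, symIntegrand, antiIntegrand, cond_false, hφ]
      ring
    · refine (near_dual (Nx := 8 * M ^ 2) (Ny := 8 * M ^ 2) (κ := -(2 * M)) hx1 hy1 a1 a2 a3 hq hε
        hε1 hK2 (by nlinarith) (by nlinarith) (fun _ => by nlinarith)
        (fun _ => by nlinarith)).trans (le_of_eq ?_)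
      simp only [pairing, symIntegrand, antiIntegrand, cond_true, hφ]
      ring
  · exact (((measurable_const.mul ((continuous_cut.measurable.comp measurable_fst).pow_const 2)).mul
      (U.measurable.comp measurable_snd)).ennreal_ofReal).mul hfarm
  · exact (measurable_const.mul
      ((continuous_cut.measurable.comp measurable_fst).pow_const 2)).ennreal_ofReal.mul
      S.measurable_K
  · intro x hx y hy hJ
    rw [hR] at hx hy
    have hy0 : φ y = 0 := T1.zero_of_notMem hρ hR' hy
    rw [S.pairing_far hJ hy0]
    obtain ⟨k1, k2, _⟩ := S.toReal_eq hJ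
    have k3 : farKernel b K x y ≠ ∞ := by cases b <;> assumption
    have p1 := ENNReal.toReal_nonneg (a := K x y)
    have p2 := ENNReal.toReal_nonneg (a := farKernel b K x y)
    have u1 := U.nonneg x
    have u2 := U.nonneg y
    have u3 := U.le_bound x hx
    rw [ofReal_mul_eq_of_ne_top (by positivity) k3, ofReal_mul_eq_of_ne_top (by positivity) k1]
    refine ofReal_add_le_of_le (by positivity) (by positivity) ?_
    simp only [hφ]
    have e1 : 0 ≤ (M - u x) * (cut x₀ r ρ x ^ 2 * u y * (farKernel b K x y).toReal) :=
      mul_nonneg (by linarith) (by positivity)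
    have e2 : 0 ≤ (2 * M ^ 2 - (2 * M - u x) * u x) * (cut x₀ r ρ x ^ 2 * (K x y).toReal) :=
      mul_nonneg (by nlinarith [sq_nonneg (M - u x)]) (by positivity)
    linarith

end

/-- The integrated tail is controlled by the supremum of the solution. -/
theorem exists_integral_tail_le {α Λ η ℓ : ℝ} (hα0 : 0 < α) (hα : α < d) (hΛ : 1 ≤ Λ) (hη : 0 ≤ η)
    (hℓ : 0 ≤ ℓ) :
    ∃ C : ℝ, 0 ≤ C ∧ ∀ (b : Bool) (K J : Kernel d) (x₀ : EuclideanSpace ℝ (Fin d)) (R M F : ℝ)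
      (u : EuclideanSpace ℝ (Fin d) → ℝ), LocalSetting α Λ η ℓ K J x₀ R →
      LocalSolution b K x₀ R M F u →
      ∫⁻ x in ball x₀ (13 / 16 * R), ∫⁻ y in (ball x₀ R)ᶜ,
        ENNReal.ofReal (u y) * farKernel b K x y ≤
      ENNReal.ofReal (C * R ^ ((d : ℝ) - α) * (M + R ^ α * F)) := by
  have hω := ballVol_pos (d := d)
  have hΛ0 : 0 < Λ := by linarith
  set Cw := ℓ * ballVol d + η * ballVol d ^ (((d : ℝ) - α) / d) with hCw
  have hCw0 : 0 ≤ Cw := by positivity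
  set s : ℝ := (3 / 16) ^ (-α) with hs
  have hs0 : 0 < s := by positivity
  refine ⟨512 * Λ ^ 2 * s * ballVol d + 128 * Λ * Cw + 64 * Λ * s * ballVol d + 4 * ballVol d,
    by positivity, ?_⟩
  intro b K J x₀ R M F u S U
  set C := 512 * Λ ^ 2 * s * ballVol d + 128 * Λ * Cw + 64 * Λ * s * ballVol d + 4 * ballVol d
  have hR := S.R_pos
  have hM := U.bound_pos
  have hF := U.rhs_nonneg
  have key := U.tail_energy S hα0 hα (r := 13 / 16 * R) (ρ := 3 / 16 * R) (by positivity)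
    (by positivity) (by ring)
  have hW := S.driftWeight_le hα0 hα hη
  set P := R ^ ((d : ℝ) - α) with hP
  have hP0 : 0 < P := by positivity
  have hρ : (3 / 16 * R) ^ (-α) = s * R ^ (-α) := Real.mul_rpow (by norm_num) hR.le
  have hRd : R ^ d = P * R ^ α := by
    rw [hP, ← Real.rpow_add hR, sub_add_cancel, Real.rpow_natCast]
  have hRα : R ^ (-α) * R ^ α = 1 := by rw [← Real.rpow_add hR]; simp
  have hRα0 : 0 < R ^ α := by positivity
  rw [volume_ball_eq _ hR, hρ] at key
  set I := ∫⁻ x in ball x₀ (13 / 16 * R), ∫⁻ y in (ball x₀ R)ᶜ,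
        ENNReal.ofReal (u y) * farKernel b K x y with hI
  have hlow : ENNReal.ofReal M * I ≤ ∫⁻ x in ball x₀ R, ∫⁻ y in (ball x₀ R)ᶜ,
      ENNReal.ofReal (M * cut x₀ (13 / 16 * R) (3 / 16 * R) x ^ 2 * u y) * farKernel b K x y := by
    have hm : Measurable (Function.uncurry fun x y => ENNReal.ofReal (u y) * farKernel b K x y) :=
      (U.measurable.comp measurable_snd).ennreal_ofReal.mul (measurable_farKernel S.measurable_K)
    rw [hI, ← lintegral_lintegral_const_mul hm]
    refine le_trans (setLIntegral_mono' measurableSet_ball fun x hx => ?_)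
      (lintegral_mono_set (ball_subset_ball (by linarith)))
    rw [cut_eq_one (by positivity) (mem_ball.1 hx).le]
    refine lintegral_mono fun y => ?_
    rw [← mul_assoc, ← ENNReal.ofReal_mul hM.le]
    simp
  have hup : 4 * (ENNReal.ofReal M * I) ≤ ENNReal.ofReal (M * (C * P * (M + R ^ α * F))) := by
    refine (mul_le_mul_right hlow 4).trans (key.trans ?_)
    calc _ ≤ ENNReal.ofReal (16 * Λ) * (ENNReal.ofReal (4 * (Λ * (s * R ^ (-α)))) *
          (ENNReal.ofReal (8 * M ^ 2) * ENNReal.ofReal (ballVol d * R ^ d)) +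
          ENNReal.ofReal (8 * M ^ 2) * ENNReal.ofReal (Cw * P)) +
          ENNReal.ofReal 4 * (ENNReal.ofReal (2 * M ^ 2) *
            ENNReal.ofReal (8 * Λ * (s * R ^ (-α))) * ENNReal.ofReal (ballVol d * R ^ d)) +
          ENNReal.ofReal 2 * (ENNReal.ofReal (2 * M * F) *
            ENNReal.ofReal (ballVol d * R ^ d)) := by
            rw [ENNReal.ofReal_ofNat, ENNReal.ofReal_ofNat]; gcongr
      _ = ENNReal.ofReal (16 * Λ * (4 * (Λ * (s * R ^ (-α))) * (8 * M ^ 2 * (ballVol d * R ^ d)) +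
          8 * M ^ 2 * (Cw * P)) + 4 * (2 * M ^ 2 * (8 * Λ * (s * R ^ (-α))) * (ballVol d * R ^ d)) +
          2 * (2 * M * F * (ballVol d * R ^ d))) := by
        rw [ENNReal.ofReal_add (by positivity) (by positivity),
          ENNReal.ofReal_add (by positivity) (by positivity),
          ENNReal.ofReal_mul (p := 16 * Λ) (by positivity),
          ENNReal.ofReal_add (by positivity) (by positivity),
          ENNReal.ofReal_mul (p := 4 * (Λ * (s * R ^ (-α)))) (by positivity),
          ENNReal.ofReal_mul (p := 8 * M ^ 2) (by positivity),
          ENNReal.ofReal_mul (p := 8 * M ^ 2) (by positivity),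
          ENNReal.ofReal_mul (p := 4)
            (q := 2 * M ^ 2 * (8 * Λ * (s * R ^ (-α))) * (ballVol d * R ^ d)) (by positivity),
          ENNReal.ofReal_mul (p := 2 * M ^ 2 * (8 * Λ * (s * R ^ (-α)))) (by positivity),
          ENNReal.ofReal_mul (p := 2 * M ^ 2) (by positivity),
          ENNReal.ofReal_mul (p := 2) (q := 2 * M * F * (ballVol d * R ^ d)) (by positivity),
          ENNReal.ofReal_mul (p := 2 * M * F) (by positivity)]
      _ ≤ _ := by
        refine ENNReal.ofReal_le_ofReal ?_
        rw [hRd]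
        have e1 : R ^ (-α) * (P * R ^ α) = P := by rw [mul_left_comm, hRα, mul_one]
        have e2 : 0 ≤ M * P * (4 * ballVol d * M +
          (512 * Λ ^ 2 * s * ballVol d + 128 * Λ * Cw + 64 * Λ * s * ballVol d) * (R ^ α * F)) := by
            positivity
        have e3 : 16 * Λ * (4 * (Λ * (s * R ^ (-α))) * (8 * M ^ 2 * (ballVol d * (P * R ^ α))) +
            8 * M ^ 2 * (Cw * P)) + 4 * (2 * M ^ 2 * (8 * Λ * (s * R ^ (-α))) *
              (ballVol d * (P * R ^ α))) + 2 * (2 * M * F * (ballVol d * (P * R ^ α))) =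
            (512 * Λ ^ 2 * s * ballVol d + 64 * Λ * s * ballVol d) * M ^ 2 *
              (R ^ (-α) * (P * R ^ α)) + 128 * Λ * Cw * M ^ 2 * P +
              4 * ballVol d * M * F * P * R ^ α := by ring
        rw [e3, e1]
        simp only [C]
        linarith
  have hMI : ENNReal.ofReal M * I ≤ ENNReal.ofReal M * ENNReal.ofReal (C * P * (M + R ^ α * F)) := by
    rw [← ENNReal.ofReal_mul hM.le]
    refine le_trans ?_ hup
    calc ENNReal.ofReal M * I = 1 * (ENNReal.ofReal M * I) := (one_mul _).symm
      _ ≤ _ := by gcongr; norm_num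
  exact (ENNReal.mul_le_mul_iff_right (ENNReal.ofReal_pos.2 hM).ne' ENNReal.ofReal_ne_top).1 hMI

/-- The pointwise tail bound. -/
def TailBound (b : Bool) (α C : ℝ) (K : Kernel d) (x₀ : EuclideanSpace ℝ (Fin d)) (R M F : ℝ)
    (u : EuclideanSpace ℝ (Fin d) → ℝ) : Prop :=
  ∀ x ∈ ball x₀ (3 / 4 * R), ∫⁻ y in (ball x₀ R)ᶜ, ENNReal.ofReal (u y) * farKernel b K x y ≤
    ENNReal.ofReal (C * R ^ (-α) * (M + R ^ α * F))

/-- The consequence of (UJS) which is used in a fixed ball. -/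
def LocalUJS (b : Bool) (c : ℝ) (K : Kernel d) (x₀ : EuclideanSpace ℝ (Fin d)) (R : ℝ) : Prop :=
  ∀ x ∈ ball x₀ (3 / 4 * R), ∀ y ∉ ball x₀ R,
    farKernel b K x y ≤ ENNReal.ofReal c * ⨍⁻ z in ball x (R / 16), farKernel b K z y ∂volume

theorem exists_tailBound {α Λ η ℓ c : ℝ} (hα0 : 0 < α) (hα : α < d) (hΛ : 1 ≤ Λ) (hη : 0 ≤ η)
    (hℓ : 0 ≤ ℓ) (hc : 0 ≤ c) :
    ∃ C : ℝ, 0 ≤ C ∧ ∀ (b : Bool) (K J : Kernel d) (x₀ : EuclideanSpace ℝ (Fin d)) (R M F : ℝ)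
      (u : EuclideanSpace ℝ (Fin d) → ℝ), LocalSetting α Λ η ℓ K J x₀ R →
      LocalSolution b K x₀ R M F u → LocalUJS b c K x₀ R → TailBound b α C K x₀ R M F u := by
  obtain ⟨C, hC, h⟩ := exists_integral_tail_le (d := d) hα0 hα hΛ hη hℓ
  have hω := ballVol_pos (d := d)
  refine ⟨c * C * 16 ^ d / ballVol d, by positivity, ?_⟩
  intro b K J x₀ R M F u S U hU x hx
  have hR := S.R_pos
  have hM := U.bound_pos
  have hF := U.rhs_nonneg
  have hI := h b K J x₀ R M F u S U
  have hfm := measurable_farKernel (b := b) S.measurable_K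
  have hsub : ball x (R / 16) ⊆ ball x₀ (13 / 16 * R) := by
    refine ball_subset_ball' ?_
    have := mem_ball.1 hx
    linarith
  have hm : Measurable (Function.uncurry fun x y => ENNReal.ofReal (u y) * farKernel b K x y) :=
    (U.measurable.comp measurable_snd).ennreal_ofReal.mul hfm
  set v := volume (ball x (R / 16)) with hv
  have hv' : v = ENNReal.ofReal (ballVol d * (R / 16) ^ d) := volume_ball_eq _ (by positivity)
  calc ∫⁻ y in (ball x₀ R)ᶜ, ENNReal.ofReal (u y) * farKernel b K x y
      ≤ ∫⁻ y in (ball x₀ R)ᶜ, (ENNReal.ofReal c * v⁻¹) *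
          ∫⁻ z in ball x (R / 16), ENNReal.ofReal (u y) * farKernel b K z y := by
        refine setLIntegral_mono' measurableSet_ball.compl fun y hy => ?_
        refine (mul_le_mul_right (hU x hx y hy) _).trans (le_of_eq ?_)
        rw [setLAverage_eq, lintegral_const_mul' _ _ ENNReal.ofReal_ne_top, div_eq_mul_inv]
        ring
    _ = (ENNReal.ofReal c * v⁻¹) * ∫⁻ z in ball x (R / 16), ∫⁻ y in (ball x₀ R)ᶜ,
          ENNReal.ofReal (u y) * farKernel b K z y := by
        have hm2 : Measurable fun y =>
            ∫⁻ z in ball x (R / 16), ENNReal.ofReal (u y) * farKernel b K z y :=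
          hm.lintegral_prod_left' (μ := volume.restrict (ball x (R / 16)))
        rw [lintegral_const_mul _ hm2, lintegral_lintegral_swap]
        exact (hm.comp measurable_swap).aemeasurable
    _ ≤ (ENNReal.ofReal c * v⁻¹) * ENNReal.ofReal (C * R ^ ((d : ℝ) - α) * (M + R ^ α * F)) := by
        gcongr
        exact (lintegral_mono_set hsub).trans hI
    _ = _ := by
        rw [hv', ← ENNReal.ofReal_inv_of_pos (by positivity), ← ENNReal.ofReal_mul hc,
          ← ENNReal.ofReal_mul (by positivity)]
        congr 1
        have : R ^ ((d : ℝ) - α) = R ^ d * R ^ (-α) := by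
          rw [sub_eq_add_neg, Real.rpow_add hR, Real.rpow_natCast]
        rw [this, div_pow]
        field_simp

/-! ### The Caccioppoli inequality -/

section

variable {α Λ η ℓ : ℝ} {K J : Kernel d} {x₀ : EuclideanSpace ℝ (Fin d)} {R M F r ρ : ℝ}
  {b : Bool} {u : EuclideanSpace ℝ (Fin d) → ℝ}

lemma LocalSolution.lintegral_far_le (S : LocalSetting α Λ η ℓ K J x₀ R)
    (U : LocalSolution b K x₀ R M F u) (hα0 : 0 < α) (hρ : 0 < ρ) (hr : 0 ≤ r)
    (hR : r + ρ ≤ 3 / 4 * R) {C : ℝ} (hC : 0 ≤ C) (hT : TailBound b α C K x₀ R M F u)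
    {x : EuclideanSpace ℝ (Fin d)} (hx : dist x x₀ ≤ r + ρ / 2) :
    ∫⁻ y in (ball x₀ (r + ρ))ᶜ, ENNReal.ofReal (u y) * farKernel b K x y ≤
      ENNReal.ofReal ((8 * Λ + C) * ρ ^ (-α) * (M + R ^ α * F)) := by
  have hR0 := S.R_pos
  have hM := U.bound_pos
  have hF := U.rhs_nonneg
  have hΛ := S.one_le
  have hx1 : x ∈ ball x₀ (3 / 4 * R) := mem_ball.2 (by linarith)
  have hx2 : x ∈ ball x₀ R := mem_ball.2 (by linarith)
  have hfm : Measurable (farKernel b K x) := (measurable_farKernel S.measurable_K).of_uncurry_left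
  have hRα : 0 < R ^ α := by positivity
  have hmono : R ^ (-α) ≤ ρ ^ (-α) :=
    Real.rpow_le_rpow_of_nonpos hρ (by linarith) (by linarith)
  have hsub : (ball x₀ (r + ρ))ᶜ ⊆ (ball x₀ R)ᶜ ∪ ((ball x₀ (r + ρ))ᶜ ∩ ball x₀ R) := by
    intro y hy
    by_cases h : y ∈ ball x₀ R
    · exact Or.inr ⟨hy, h⟩
    · exact Or.inl h
  refine (lintegral_mono_set hsub).trans ((lintegral_union_le _ _ _).trans ?_)
  have h2 : ∫⁻ y in (ball x₀ (r + ρ))ᶜ ∩ ball x₀ R, ENNReal.ofReal (u y) * farKernel b K x y ≤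
      ENNReal.ofReal M * ENNReal.ofReal (8 * Λ * ρ ^ (-α)) := by
    calc _ ≤ ∫⁻ y in (ball x₀ (r + ρ))ᶜ ∩ ball x₀ R, ENNReal.ofReal M * farKernel b K x y := by
          refine setLIntegral_mono' (measurableSet_ball.compl.inter measurableSet_ball)
            fun y hy => ?_
          gcongr
          exact U.le_bound y hy.2
      _ ≤ ∫⁻ y in (ball x₀ (r + ρ))ᶜ, ENNReal.ofReal M * farKernel b K x y :=
          lintegral_mono_set inter_subset_left
      _ = ENNReal.ofReal M * ∫⁻ y in (ball x₀ (r + ρ))ᶜ, farKernel b K x y :=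
          lintegral_const_mul _ hfm
      _ ≤ _ := by
          gcongr
          exact S.far_compl_ball_le farKernel_le hρ (by linarith) hx2 hx
  refine (add_le_add (hT x hx1) h2).trans ?_
  rw [← ENNReal.ofReal_mul hM.le, ← ENNReal.ofReal_add (by positivity) (by positivity)]
  refine ENNReal.ofReal_le_ofReal ?_
  have e1 : C * R ^ (-α) * (M + R ^ α * F) ≤ C * ρ ^ (-α) * (M + R ^ α * F) := by gcongr
  have e2 : 0 ≤ 8 * Λ * ρ ^ (-α) * (R ^ α * F) := by positivity
  linarith

open Classical in
/-- The Caccioppoli inequality for the truncations of a solution; the last term in `N` is only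
present for the dual equation. -/
theorem LocalSolution.caccioppoli (S : LocalSetting α Λ η ℓ K J x₀ R)
    (U : LocalSolution b K x₀ R M F u) (hα0 : 0 < α) (hα : α < d) (hρ : 0 < ρ) (hr : 0 ≤ r)
    (hR : r + ρ ≤ 3 / 4 * R) {C : ℝ} (hC : 0 ≤ C) (hT : TailBound b α C K x₀ R M F u)
    {k : ℝ} (hk : 0 ≤ k) {N : EuclideanSpace ℝ (Fin d) → ℝ}
    (hN : N = fun x => max (u x - k) 0 ^ 2 + if b = true ∧ k < u x then k ^ 2 else 0) :
    energyOn (symPart K) (ball x₀ (r + ρ)) (fun x => cut x₀ r ρ x * max (u x - k) 0) < ∞ ∧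
    energyOn (symPart K) (ball x₀ (r + ρ)) (fun x => cut x₀ r ρ x * max (u x - k) 0) ≤
      ENNReal.ofReal (16 * Λ) * (ENNReal.ofReal (4 * (Λ * ρ ^ (-α))) *
          (∫⁻ x in ball x₀ (r + ρ), ENNReal.ofReal (N x)) +
        ∫⁻ x in ball x₀ (r + ρ), ENNReal.ofReal (cut x₀ r ρ x ^ 2 * N x) *
          driftWeight K J (ball x₀ R) x) +
      ENNReal.ofReal ((4 * (8 * Λ + C) + 2) * ρ ^ (-α) * (M + R ^ α * F)) *
        ∫⁻ x in ball x₀ (r + ρ), ENNReal.ofReal (max (u x - k) 0) := by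
  have hd : 0 < d := by exact_mod_cast hα0.trans hα
  have hR0 := S.R_pos
  have hM := U.bound_pos
  have hΛ := S.one_le
  have hρR : ρ ≤ R := by linarith
  have hR' : r + ρ ≤ R := by linarith
  have hF := U.rhs_nonneg
  have hρα : 0 < ρ ^ (-α) := by positivity
  have hRα : 0 < R ^ α := by positivity
  have hsub : ball x₀ (r + ρ) ⊆ ball x₀ R := ball_subset_ball hR'
  have T := U.truncation_max hk
  have T1 := T.testFunction (r := r) (ρ := ρ) hM.le hρ hR'
  set w : EuclideanSpace ℝ (Fin d) → ℝ := fun x => max (u x - k) 0 with hw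
  have hw0 : ∀ x, 0 ≤ w x := fun x => le_max_right _ _
  set φ : EuclideanSpace ℝ (Fin d) → ℝ := fun x => cut x₀ r ρ x ^ 2 * w x with hφ
  have hH := T1.memH S U hr hρ hR'
  have i1 := T1.integrable_sym S U hr hρ hR'
  have i2 := T1.integrable_anti S hα U hM.le hr hρ hR'
  have hmv : Measurable fun x => cut x₀ r ρ x * w x :=
    continuous_cut.measurable.mul T.measurable
  have hsign : ∀ x, 0 ≤ φ x := fun x => mul_nonneg (sq_nonneg _) (hw0 x)
  have hφw : ∀ x, φ x ≤ w x := fun x => by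
    calc φ x ≤ 1 * w x := mul_le_mul_of_nonneg_right (pow_le_one₀ cut_nonneg cut_le_one) (hw0 x)
      _ = w x := one_mul _
  have hint : Integrable (pairing b K u φ)
      ((volume : Measure (EuclideanSpace ℝ (Fin d))).prod volume) := by
    cases b
    · exact i1.add i2
    · exact i1.add i2
  have htest := U.test φ hH (Or.inr hsign) i1 i2
  have hE := S.energyOn_lt_top (s := r + ρ) (by linarith) hR' hmv (m := M) (fun x hx => by
    have h1 := T.nonneg x hx
    have h2 := T.le_bound x hx
    rw [abs_of_nonneg (mul_nonneg cut_nonneg h1)]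
    calc _ ≤ 1 * M := mul_le_mul cut_le_one h2 h1 zero_le_one
      _ = _ := one_mul _)
    (S.energy_lt_top U hρ hρR fun x hx y => T.abs_cut_mul_sub_le hρ hR' hx y)
  refine ⟨hE.1, ?_⟩
  have hfarm := measurable_farKernel (b := b) S.measurable_K
  have hset : MeasurableSet {x | b = true ∧ k < u x} :=
    (MeasurableSet.const _).inter (measurableSet_lt measurable_const U.measurable)
  have hNm : Measurable N := by
    rw [hN]
    exact (T.measurable.pow_const 2).add (Measurable.ite hset measurable_const measurable_const)
  have hN0 : ∀ x, w x ^ 2 ≤ N x := fun x => by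
    rw [hN]
    have : (0 : ℝ) ≤ if b = true ∧ k < u x then k ^ 2 else 0 := by split_ifs <;> positivity
    simp only [hw]
    linarith
  have key := S.energy_estimate hd hρ hρR hR' hmv hNm
    (fun x => (sq_nonneg _).trans (hN0 x)) hE.1 hE.2.2 hint
    (pairing_symm b u φ) ?_ ?_
    (P := fun x y => 0)
    (Q := fun x y => ENNReal.ofReal (φ x * u y) * farKernel b K x y) measurable_const ?_ ?_
  · refine le_self_add.trans (key.trans ?_)
    rw [add_assoc]
    refine add_le_add le_rfl ?_
    have h1 : ∫⁻ x in ball x₀ (r + ρ), ∫⁻ y in (ball x₀ (r + ρ))ᶜ,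
        ENNReal.ofReal (φ x * u y) * farKernel b K x y ≤
        ENNReal.ofReal ((8 * Λ + C) * ρ ^ (-α) * (M + R ^ α * F)) *
          ∫⁻ x in ball x₀ (r + ρ), ENNReal.ofReal (w x) := by
      rw [← lintegral_const_mul _ T.measurable.ennreal_ofReal]
      refine setLIntegral_mono' measurableSet_ball fun x hx => ?_
      have hm : Measurable fun y => ENNReal.ofReal (u y) * farKernel b K x y :=
        U.measurable.ennreal_ofReal.mul hfarm.of_uncurry_left
      have hpt : ∀ y, ENNReal.ofReal (φ x * u y) * farKernel b K x y =
          ENNReal.ofReal (φ x) * (ENNReal.ofReal (u y) * farKernel b K x y) := fun y => by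
        rw [ENNReal.ofReal_mul (hsign x), mul_assoc]
      simp_rw [hpt]
      rw [lintegral_const_mul _ hm]
      rcases le_or_gt (r + ρ / 2) (dist x x₀) with hxr | hxr
      · simp [T1.eq_zero x hxr]
      · rw [mul_comm]
        refine mul_le_mul' ?_ (ENNReal.ofReal_le_ofReal (hφw x))
        exact U.lintegral_far_le S hα0 hρ hr hR hC hT hxr.le
    have h2 : ENNReal.ofReal (∫ p, pairing b K u φ p
        ∂((volume : Measure (EuclideanSpace ℝ (Fin d))).prod volume)) ≤
        ENNReal.ofReal (ρ ^ (-α) * (M + R ^ α * F)) *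
          ∫⁻ x in ball x₀ (r + ρ), ENNReal.ofReal (w x) := by
      refine (ENNReal.ofReal_le_ofReal htest).trans ?_
      rw [ENNReal.ofReal_mul hF]
      refine mul_le_mul' (ENNReal.ofReal_le_ofReal ?_) ?_
      · have e1 : 1 ≤ ρ ^ (-α) * R ^ α := by
          rw [Real.rpow_neg hρ.le, ← Real.inv_rpow hρ.le, ← Real.mul_rpow (by positivity) hR0.le]
          refine Real.one_le_rpow ?_ hα0.le
          rw [inv_mul_eq_div, le_div_iff₀ hρ]
          linarith
        have e2 : 0 ≤ ρ ^ (-α) * M := by positivity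
        nlinarith
      · refine ENNReal.ofReal_le_of_le_toReal ?_
        rw [integral_eq_lintegral_of_nonneg_ae (Filter.Eventually.of_forall fun x => abs_nonneg _)
          T1.measurable.abs.aestronglyMeasurable]
        have hfin : ∫⁻ x in ball x₀ (r + ρ), ENNReal.ofReal (w x) ≠ ∞ := by
          refine ((setLIntegral_mono' (g := fun _ => ENNReal.ofReal M) measurableSet_ball
            fun x hx => ENNReal.ofReal_le_ofReal (T.le_bound x (hsub hx))).trans_lt ?_).ne
          rw [setLIntegral_const]
          exact ENNReal.mul_lt_top ENNReal.ofReal_lt_top measure_ball_lt_top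
        refine ENNReal.toReal_mono hfin ?_
        have e3 : ∫⁻ x in ball x₀ R, ENNReal.ofReal |φ x| ≤
            ∫⁻ x, (ball x₀ (r + ρ)).indicator (fun x => ENNReal.ofReal (w x)) x := by
          refine (setLIntegral_le_lintegral _ _).trans (lintegral_mono fun x => ?_)
          by_cases hx : x ∈ ball x₀ (r + ρ)
          · rw [indicator_of_mem hx, abs_of_nonneg (hsign x)]
            exact ENNReal.ofReal_le_ofReal (hφw x)
          · rw [mem_ball, not_lt] at hx
            simp [T1.eq_zero x (by linarith)]
        rwa [lintegral_indicator measurableSet_ball] at e3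
    set X := ∫⁻ x in ball x₀ (r + ρ), ENNReal.ofReal (w x)
    calc _ ≤ 4 * (ENNReal.ofReal ((8 * Λ + C) * ρ ^ (-α) * (M + R ^ α * F)) * X) +
          2 * (ENNReal.ofReal (ρ ^ (-α) * (M + R ^ α * F)) * X) := by gcongr
      _ = (ENNReal.ofReal 4 * ENNReal.ofReal ((8 * Λ + C) * ρ ^ (-α) * (M + R ^ α * F)) +
          ENNReal.ofReal 2 * ENNReal.ofReal (ρ ^ (-α) * (M + R ^ α * F))) * X := by
          rw [ENNReal.ofReal_ofNat, ENNReal.ofReal_ofNat]; ring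
      _ = _ := by
          rw [← ENNReal.ofReal_mul (by norm_num), ← ENNReal.ofReal_mul (by norm_num),
            ← ENNReal.ofReal_add (by positivity) (by positivity)]
          congr 2
          ring
  · intro x hx y hy
    rw [mem_ball, not_lt] at hx hy
    have e1 := T1.eq_zero x (by linarith)
    have e2 := T1.eq_zero y (by linarith)
    cases b <;> simp [pairing, symIntegrand, antiIntegrand, e1, e2]
  · intro x hx y hy hJ
    obtain ⟨a1, a2⟩ := S.abs_antiPart_le hJ
    have a3 := (S.antiPart_sq hJ).1
    have hε : 0 < 1 / (2 * Λ) := by positivity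
    have hε1 : 1 / (2 * Λ) ≤ 1 := by rw [div_le_one (by positivity)]; linarith
    have hK2 : 4 * Λ * (1 / (2 * Λ)) = 2 := by field_simp; norm_num
    have hq : 0 ≤ antiPart K x y ^ 2 / (J x y).toReal :=
      div_nonneg (sq_nonneg _) ENNReal.toReal_nonneg
    cases b
    · have h1 := near_primal' (tx := cut x₀ r ρ x) (ty := cut x₀ r ρ y) a1 a2 a3 hq hε hε1 hK2
        (hN0 x) (hN0 y)
      have h2 := trunc_primal (ux := u x) (uy := u y) (tx := cut x₀ r ρ x) (ty := cut x₀ r ρ y)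
        (k := k) a1
      simp only [pairing, symIntegrand, antiIntegrand, cond_false, hφ]
      simp only [hw] at h1 ⊢
      linarith
    · have hN1 : ∀ x, 0 < w x → w x ^ 2 + k ^ 2 ≤ N x := fun x hx => by
        have hkx : k < u x := by
          by_contra hle
          simp only [hw] at hx
          rw [max_eq_right (by linarith)] at hx
          exact lt_irrefl _ hx
        simp [hN, hw, hkx]
      have h1 := near_dual (tx := cut x₀ r ρ x) (ty := cut x₀ r ρ y) (hw0 x) (hw0 y) a1 a2 a3 hq
        hε hε1 hK2 (hN0 x) (hN0 y) (hN1 x) (hN1 y)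
      have h2 := trunc_dual (ux := u x) (uy := u y) (tx := cut x₀ r ρ x) (ty := cut x₀ r ρ y)
        (k := k) a1
      simp only [pairing, symIntegrand, antiIntegrand, cond_true, hφ]
      simp only [hw] at h1 ⊢
      linarith
  · exact (((T1.measurable.comp measurable_fst).mul
      (U.measurable.comp measurable_snd)).ennreal_ofReal).mul hfarm
  · intro x hx y hy hJ
    rw [mem_ball, not_lt] at hy
    have hy0 : φ y = 0 := T1.eq_zero y (by linarith)
    rw [S.pairing_far hJ hy0]
    obtain ⟨k1, k2, _⟩ := S.toReal_eq hJ
    have k3 : farKernel b K x y ≠ ∞ := by cases b <;> assumption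
    have p1 := ENNReal.toReal_nonneg (a := K x y)
    have p2 := ENNReal.toReal_nonneg (a := farKernel b K x y)
    have u1 := U.nonneg x
    have u2 := U.nonneg y
    have u4 := hsign x
    rw [ofReal_mul_eq_of_ne_top (by positivity) k3, ← ENNReal.ofReal_zero]
    refine ofReal_add_le_of_le le_rfl (by positivity) ?_
    have : 0 ≤ φ x * (u x * (K x y).toReal) := by positivity
    linarith

end

/-! ### Growth of the truncations -/

section

variable {α Λ η ℓ γ : ℝ} {K J : Kernel d} {x₀ : EuclideanSpace ℝ (Fin d)} {R M F r ρ : ℝ}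
  {b : Bool} {u : EuclideanSpace ℝ (Fin d) → ℝ}

lemma LocalSetting.sob_lintegral (S : LocalSetting α Λ η ℓ K J x₀ R) (hα0 : 0 < α) (hα : α < d)
    (hρ : 0 < ρ) (hr : 0 ≤ r) (hR : r + ρ ≤ R) {v : EuclideanSpace ℝ (Fin d) → ℝ}
    (hv : MemLp v 2 (volume.restrict (ball x₀ (r + ρ)))) :
    (∫⁻ x in ball x₀ (r + ρ / 2), ENNReal.ofReal (v x ^ 2) ^ ((d : ℝ) / (d - α))) ^
        (((d : ℝ) - α) / d) ≤
      ENNReal.ofReal Λ * energyOn (symPart K) (ball x₀ (r + ρ)) v +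
        ENNReal.ofReal (Λ * 2 ^ α * ρ ^ (-α)) *
          ∫⁻ x in ball x₀ (r + ρ), ENNReal.ofReal (v x ^ 2) := by
  have hd : (0 : ℝ) < d := hα0.trans hα
  have hp : 0 < (d : ℝ) / (d - α) := div_pos hd (by linarith)
  have h := S.sob (r + ρ / 2) (ρ / 2) (by positivity) (by linarith) (by linarith) v
    (by rwa [add_assoc, add_halves])
  rw [add_assoc, add_halves, eLpNorm_one_eq_lintegral_enorm,
    eLpNorm_eq_lintegral_rpow_enorm_toReal (by simpa using hp) ENNReal.ofReal_ne_top,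
    ENNReal.toReal_ofReal hp.le, one_div_div] at h
  have he : ∀ x, ‖v x ^ 2‖ₑ = ENNReal.ofReal (v x ^ 2) := fun x =>
    Real.enorm_of_nonneg (sq_nonneg _)
  simp_rw [he] at h
  have e2 : Λ * (ρ / 2) ^ (-α) = Λ * 2 ^ α * ρ ^ (-α) := by
    rw [Real.div_rpow hρ.le (by norm_num), Real.rpow_neg (by norm_num : (0 : ℝ) ≤ 2)]
    field_simp
  rwa [e2] at h

/-- Hölder's inequality on the support of `g`. -/
lemma lintegral_le_rpow_mul_measure_rpow (hα0 : 0 < α) (hα : α < d)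
    {B A : Set (EuclideanSpace ℝ (Fin d))} (hA : MeasurableSet A)
    {g : EuclideanSpace ℝ (Fin d) → ℝ≥0∞} (hg : Measurable g) (h0 : ∀ x ∈ B, x ∉ A → g x = 0)
    (hB : MeasurableSet B) :
    ∫⁻ x in B, g x ≤ (∫⁻ x in B, g x ^ ((d : ℝ) / (d - α))) ^ (((d : ℝ) - α) / d) *
      volume (A ∩ B) ^ (α / d) := by
  have hd : (0 : ℝ) < d := hα0.trans hα
  have hpq : ((d : ℝ) / (d - α)).HolderConjugate (d / α) := by
    refine ⟨?_, div_pos hd (by linarith), div_pos hd hα0⟩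
    rw [inv_div, inv_div]
    field_simp
    ring
  have h := ENNReal.lintegral_mul_le_Lp_mul_Lq (volume.restrict B) hpq hg.aemeasurable
    (g := A.indicator 1) (measurable_one.indicator hA).aemeasurable
  have e1 : ∫⁻ x in B, (g * A.indicator (1 : EuclideanSpace ℝ (Fin d) → ℝ≥0∞)) x = ∫⁻ x in B, g x := by
    refine setLIntegral_congr_fun hB fun x hx => ?_
    by_cases hxA : x ∈ A
    · simp [hxA]
    · simp [hxA, h0 x hx hxA]
  have e2 : ∫⁻ x in B, A.indicator (1 : EuclideanSpace ℝ (Fin d) → ℝ≥0∞) x ^ ((d : ℝ) / α) =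
      volume (A ∩ B) := by
    have : ∀ x, A.indicator (1 : EuclideanSpace ℝ (Fin d) → ℝ≥0∞) x ^ ((d : ℝ) / α) =
        A.indicator 1 x := fun x => by
      by_cases hxA : x ∈ A
      · simp [hxA]
      · simp [hxA, div_pos hd hα0]
    simp_rw [this]
    rw [lintegral_indicator_one hA, Measure.restrict_apply hA]
  rw [e1, e2, one_div_div, one_div_div] at h
  exact h

lemma setLIntegral_eq_of_subset {X : Type*} [MeasurableSpace X] {μ : Measure X} {s t : Set X}
    (hs : MeasurableSet s) (hst : s ⊆ t) (ht : MeasurableSet t) {g : X → ℝ≥0∞}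
    (h0 : ∀ x ∉ s, g x = 0) :
    ∫⁻ x in t, g x ∂μ = ∫⁻ x in s, g x ∂μ := by
  rw [← lintegral_indicator hs, ← lintegral_indicator ht]
  congr 1
  ext x
  by_cases hx : x ∈ s
  · simp [hx, hst hx]
  · simp [hx, h0 x hx]

lemma ofReal_mul_ofReal_mul {a : ℝ} (ha : 0 ≤ a) (b : ℝ) (t : ℝ≥0∞) :
    ENNReal.ofReal a * (ENNReal.ofReal b * t) = ENNReal.ofReal (a * b) * t := by
  rw [← mul_assoc, ENNReal.ofReal_mul ha]

/-- The bound for the `L^{d/(d-α)}` norm of the localized truncations. -/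
theorem LocalSolution.higher_integrability (S : LocalSetting α Λ η ℓ K J x₀ R)
    (U : LocalSolution b K x₀ R M F u) (hα0 : 0 < α) (hα : α < d) (hρ : 0 < ρ) (hr : 0 ≤ r)
    (hR : r + ρ ≤ 3 / 4 * R) (hη' : 16 * Λ ^ 2 * η ≤ 1 / 2)
    {C : ℝ} (hC : 0 ≤ C) (hT : TailBound b α C K x₀ R M F u)
    (hdual : b = true → ∀ A ⊆ ball x₀ R, MeasurableSet A →
      ∫⁻ x in A, driftWeight K J (ball x₀ R) x ≤
        ENNReal.ofReal ℓ * volume A ^ (((d : ℝ) - α) / d + γ))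
    {k : ℝ} (hk : 0 ≤ k) :
    (∫⁻ x in ball x₀ (r + ρ), ENNReal.ofReal ((cut x₀ r ρ x * max (u x - k) 0) ^ 2) ^
        ((d : ℝ) / (d - α))) ^ (((d : ℝ) - α) / d) ≤
      ENNReal.ofReal (2 * (64 * Λ ^ 3 + 32 * Λ ^ 2 * ℓ + Λ * (4 * (8 * Λ + C) + 2) + Λ * 2 ^ α)) *
        (ENNReal.ofReal (ρ ^ (-α)) *
          ((∫⁻ x in ball x₀ (r + ρ), ENNReal.ofReal (max (u x - k) 0 ^ 2)) +
            ENNReal.ofReal (k ^ 2) * volume ({x | k < u x} ∩ ball x₀ (r + ρ)) +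
            ENNReal.ofReal (M + R ^ α * F) *
              ∫⁻ x in ball x₀ (r + ρ), ENNReal.ofReal (max (u x - k) 0)) +
          ENNReal.ofReal (k ^ 2) *
            volume ({x | k < u x} ∩ ball x₀ (r + ρ)) ^ (((d : ℝ) - α) / d + γ)) := by
  classical
  have hd : (0 : ℝ) < d := hα0.trans hα
  have hR0 := S.R_pos
  have hM := U.bound_pos
  have hΛ := S.one_le
  have hℓ := S.drift_nonneg
  have hR' : r + ρ ≤ R := by linarith
  have hF := U.rhs_nonneg
  have hsub : ball x₀ (r + ρ) ⊆ ball x₀ R := ball_subset_ball hR'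
  have hp : 0 < (d : ℝ) / (d - α) := div_pos hd (by linarith)
  have hp' : 0 ≤ ((d : ℝ) - α) / d := div_nonneg (by linarith) hd.le
  have T := U.truncation_max hk
  obtain ⟨hfin, hcac⟩ := U.caccioppoli S hα0 hα hρ hr hR hC hT hk rfl
  set w : EuclideanSpace ℝ (Fin d) → ℝ := fun x => max (u x - k) 0 with hw
  have hw0 : ∀ x, 0 ≤ w x := fun x => le_max_right _ _
  set v : EuclideanSpace ℝ (Fin d) → ℝ := fun x => cut x₀ r ρ x * w x with hv
  have hvm : Measurable v := continuous_cut.measurable.mul T.measurable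
  have hvg : Measurable fun x => ENNReal.ofReal (v x ^ 2) := (hvm.pow_const 2).ennreal_ofReal
  have hvw : ∀ x, v x ^ 2 ≤ w x ^ 2 := fun x => by
    have h1 : v x ≤ w x := by
      calc v x ≤ 1 * w x := mul_le_mul_of_nonneg_right cut_le_one (hw0 x)
        _ = w x := one_mul _
    have : 0 ≤ v x := mul_nonneg cut_nonneg (hw0 x)
    gcongr
  have hv0 : ∀ x ∉ ball x₀ (r + ρ / 2), ENNReal.ofReal (v x ^ 2) = 0 := fun x hx => by
    rw [mem_ball, not_lt] at hx
    simp [hv, cut_eq_zero hρ hx]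
  have hv0' : ∀ x ∉ ball x₀ (r + ρ), ENNReal.ofReal (v x ^ 2) = 0 := fun x hx => by
    refine hv0 x fun h => hx ?_
    exact ball_subset_ball (by linarith) h
  have hb1 : ∀ x ∈ ball x₀ (r + ρ), v x ^ 2 ≤ M ^ 2 := fun x hx => (hvw x).trans (by
    have := T.le_bound x (hsub hx)
    have := hw0 x
    gcongr)
  have hfm : IsFiniteMeasure (volume.restrict (ball x₀ (r + ρ))) :=
    ⟨by simpa using measure_ball_lt_top⟩
  have hLp : MemLp v 2 (volume.restrict (ball x₀ (r + ρ))) :=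
    MemLp.of_bound hvm.aestronglyMeasurable M
      ((ae_restrict_mem measurableSet_ball).mono fun x hx => by
        rw [Real.norm_eq_abs]
        exact abs_le_of_sq_le_sq (hb1 x hx) hM.le)
  have hsob := S.sob_lintegral hα0 hα hρ hr hR' hLp
  set B := ball x₀ (r + ρ) with hB
  set X := (∫⁻ x in B, ENNReal.ofReal (v x ^ 2) ^ ((d : ℝ) / (d - α))) ^ (((d : ℝ) - α) / d)
    with hX
  have hXfin : X ≠ ∞ := by
    refine ENNReal.rpow_ne_top_of_nonneg hp' ?_
    refine ((setLIntegral_mono' (g := fun _ => ENNReal.ofReal (M ^ 2) ^ ((d : ℝ) / (d - α)))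
      measurableSet_ball fun x hx => ?_).trans_lt ?_).ne
    · exact ENNReal.rpow_le_rpow (ENNReal.ofReal_le_ofReal (hb1 x hx)) hp.le
    · rw [setLIntegral_const]
      exact ENNReal.mul_lt_top (ENNReal.rpow_lt_top_of_nonneg hp.le ENNReal.ofReal_ne_top)
        measure_ball_lt_top
  have hX1 : ∫⁻ x in ball x₀ (r + ρ / 2), ENNReal.ofReal (v x ^ 2) ^ ((d : ℝ) / (d - α)) =
      ∫⁻ x in B, ENNReal.ofReal (v x ^ 2) ^ ((d : ℝ) / (d - α)) :=
    (setLIntegral_eq_of_subset measurableSet_ball (ball_subset_ball (by linarith))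
      measurableSet_ball fun x hx => by rw [hv0 x hx, ENNReal.zero_rpow_of_pos hp]).symm
  have hX2 : ∫⁻ x in ball x₀ R, ENNReal.ofReal (v x ^ 2) ^ ((d : ℝ) / (d - α)) =
      ∫⁻ x in B, ENNReal.ofReal (v x ^ 2) ^ ((d : ℝ) / (d - α)) :=
    setLIntegral_eq_of_subset measurableSet_ball hsub
      measurableSet_ball fun x hx => by rw [hv0' x hx, ENNReal.zero_rpow_of_pos hp]
  rw [hX1, ← hX] at hsob
  have hdrift := S.drift _ hvg
  rw [hX2, ← hX, setLIntegral_eq_of_subset measurableSet_ball hsub measurableSet_ball hv0',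
    setLIntegral_eq_of_subset measurableSet_ball hsub measurableSet_ball
      (fun x hx => by rw [hv0' x hx, zero_mul])] at hdrift
  set Y := ∫⁻ x in B, ENNReal.ofReal (w x ^ 2) with hY
  have hvY : ∫⁻ x in B, ENNReal.ofReal (v x ^ 2) ≤ Y :=
    lintegral_mono fun x => ENNReal.ofReal_le_ofReal (hvw x)
  set A := {x | k < u x} ∩ B with hA
  have hAm0 : MeasurableSet {x | k < u x} := measurableSet_lt measurable_const U.measurable
  have hAm : MeasurableSet A := hAm0.inter measurableSet_ball
  set Z := ∫⁻ x in B, ENNReal.ofReal (w x) with hZ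
  set V := volume A with hV
  set N : EuclideanSpace ℝ (Fin d) → ℝ :=
    fun x => w x ^ 2 + if b = true ∧ k < u x then k ^ 2 else 0 with hN
  have hIN : ∫⁻ x in B, ENNReal.ofReal (N x) ≤ Y + ENNReal.ofReal (k ^ 2) * V := by
    have h1 : ∀ x, ENNReal.ofReal (N x) ≤ ENNReal.ofReal (w x ^ 2) +
        {x | k < u x}.indicator (fun _ => ENNReal.ofReal (k ^ 2)) x := fun x => by
      refine ENNReal.ofReal_add_le.trans (add_le_add le_rfl ?_)
      by_cases hx : k < u x
      · simp only [hx, and_true, indicator_of_mem (show x ∈ {x | k < u x} from hx)]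
        split_ifs <;> simp
      · simp [hx]
    refine (lintegral_mono h1).trans ?_
    rw [lintegral_add_left (T.measurable.pow_const 2).ennreal_ofReal,
      lintegral_indicator_const hAm0, Measure.restrict_apply hAm0]
  have hID : ∫⁻ x in B, ENNReal.ofReal (cut x₀ r ρ x ^ 2 * N x) * driftWeight K J (ball x₀ R) x ≤
      (ENNReal.ofReal ℓ * Y + ENNReal.ofReal η * X) +
        ENNReal.ofReal ℓ * (ENNReal.ofReal (k ^ 2) * V ^ (((d : ℝ) - α) / d + γ)) := by
    have hWm := measurable_driftWeight S.measurable_K S.measurable_J (ball x₀ R)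
    have h1 : ∀ x, ENNReal.ofReal (cut x₀ r ρ x ^ 2 * N x) * driftWeight K J (ball x₀ R) x ≤
        ENNReal.ofReal (v x ^ 2) * driftWeight K J (ball x₀ R) x +
        {x | b = true ∧ k < u x}.indicator
          (fun x => ENNReal.ofReal (k ^ 2) * driftWeight K J (ball x₀ R) x) x := fun x => by
      have e1 : cut x₀ r ρ x ^ 2 * N x = v x ^ 2 +
        cut x₀ r ρ x ^ 2 * (if b = true ∧ k < u x then k ^ 2 else 0) := by
          simp only [hN, hv]; ring
      rw [e1]
      refine (mul_le_mul_left ENNReal.ofReal_add_le _).trans ?_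
      rw [add_mul]
      refine add_le_add le_rfl ?_
      by_cases hx : b = true ∧ k < u x
      · rw [indicator_of_mem (show x ∈ {x | b = true ∧ k < u x} from hx), if_pos hx]
        refine mul_le_mul' (ENNReal.ofReal_le_ofReal ?_) le_rfl
        have : cut x₀ r ρ x ^ 2 ≤ 1 := pow_le_one₀ cut_nonneg cut_le_one
        nlinarith [sq_nonneg k]
      · rw [if_neg hx]; simp
    refine (lintegral_mono h1).trans ?_
    have hset : MeasurableSet {x | b = true ∧ k < u x} := (MeasurableSet.const _).inter hAm0
    have hmul : Measurable fun x => ENNReal.ofReal (v x ^ 2) * driftWeight K J (ball x₀ R) x :=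
      hvg.mul hWm
    rw [lintegral_add_left hmul, lintegral_indicator hset, Measure.restrict_restrict hset]
    refine add_le_add (hdrift.trans ?_) ?_
    · gcongr
    · rw [lintegral_const_mul _ hWm]
      cases hb : b
      · simp
      · have e : {x | true = true ∧ k < u x} ∩ B = A := by
          simp [hA]
        rw [e]
        refine (mul_le_mul_right (hdual hb A (inter_subset_right.trans hsub) hAm) _).trans ?_
        rw [mul_left_comm]
  set E := energyOn (symPart K) B v
  have hρ1 : 1 ≤ ρ ^ (-α) :=
    Real.one_le_rpow_of_pos_of_le_one_of_nonpos hρ (by linarith [S.R_le_one]) (by linarith)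
  set m := M + R ^ α * F with hm
  have hm0 : 0 ≤ m := by positivity
  set V' := V ^ (((d : ℝ) - α) / d + γ)
  set C₂ := 4 * (8 * Λ + C) + 2 with hC₂
  have hC₂0 : 0 ≤ C₂ := by positivity
  have hs0 : 0 < ρ ^ (-α) := by positivity
  set s := ρ ^ (-α)
  have hbound : X ≤ X / 2 + ENNReal.ofReal (64 * Λ ^ 3 + 32 * Λ ^ 2 * ℓ + Λ * C₂ + Λ * 2 ^ α) *
      (ENNReal.ofReal s * (Y + ENNReal.ofReal (k ^ 2) * V + ENNReal.ofReal m * Z) +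
        ENNReal.ofReal (k ^ 2) * V') := by
    have hηX : ENNReal.ofReal (16 * Λ ^ 2 * η) * X ≤ X / 2 := by
      rw [ENNReal.div_eq_inv_mul]
      gcongr
      refine (ENNReal.ofReal_le_ofReal hη').trans ?_
      rw [one_div, ENNReal.ofReal_inv_of_pos (by norm_num), ENNReal.ofReal_ofNat]
    set k2 := ENNReal.ofReal (k ^ 2)
    have hΛ0 : 0 ≤ Λ := by linarith
    have h16 : 0 ≤ 16 * Λ := by linarith
    have h64 : 0 ≤ 64 * Λ ^ 3 := by positivity
    have h163 : 0 ≤ 16 * Λ ^ 2 * ℓ := by positivity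
    have q1 : ENNReal.ofReal Λ * (ENNReal.ofReal (16 * Λ) * (ENNReal.ofReal (4 * (Λ * s)) *
        (Y + k2 * V))) = ENNReal.ofReal (64 * Λ ^ 3) * (ENNReal.ofReal s * (Y + k2 * V)) := by
      rw [ofReal_mul_ofReal_mul h16, ofReal_mul_ofReal_mul hΛ0, ofReal_mul_ofReal_mul h64]
      congr 2; ring
    have q2 : ENNReal.ofReal Λ * (ENNReal.ofReal (16 * Λ) * (ENNReal.ofReal ℓ * Y)) ≤
        ENNReal.ofReal (16 * Λ ^ 2 * ℓ) * (ENNReal.ofReal s * Y) := by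
      rw [ofReal_mul_ofReal_mul h16, ofReal_mul_ofReal_mul hΛ0, ofReal_mul_ofReal_mul h163]
      refine mul_le_mul' (ENNReal.ofReal_le_ofReal ?_) le_rfl
      nlinarith
    have q3 : ENNReal.ofReal Λ * (ENNReal.ofReal (16 * Λ) * (ENNReal.ofReal η * X)) ≤ X / 2 := by
      refine le_trans (le_of_eq ?_) hηX
      rw [ofReal_mul_ofReal_mul h16, ofReal_mul_ofReal_mul hΛ0]
      congr 2; ring
    have q4 : ENNReal.ofReal Λ * (ENNReal.ofReal (16 * Λ) * (ENNReal.ofReal ℓ * (k2 * V'))) =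
        ENNReal.ofReal (16 * Λ ^ 2 * ℓ) * (k2 * V') := by
      rw [ofReal_mul_ofReal_mul h16, ofReal_mul_ofReal_mul hΛ0]
      congr 2; ring
    have q5 : ENNReal.ofReal Λ * (ENNReal.ofReal (C₂ * s * m) * Z) =
        ENNReal.ofReal (Λ * C₂) * (ENNReal.ofReal s * (ENNReal.ofReal m * Z)) := by
      rw [ofReal_mul_ofReal_mul hΛ0, ofReal_mul_ofReal_mul hs0.le,
        ofReal_mul_ofReal_mul (by positivity)]
      congr 2; ring
    have q6 : ENNReal.ofReal (Λ * 2 ^ α * s) * Y =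
        ENNReal.ofReal (Λ * 2 ^ α) * (ENNReal.ofReal s * Y) :=
      (ofReal_mul_ofReal_mul (by positivity) _ _).symm
    calc X ≤ ENNReal.ofReal Λ * E + ENNReal.ofReal (Λ * 2 ^ α * s) * Y := by
          refine hsob.trans ?_
          gcongr
      _ ≤ ENNReal.ofReal Λ * (ENNReal.ofReal (16 * Λ) * (ENNReal.ofReal (4 * (Λ * s)) *
          (Y + k2 * V) + ((ENNReal.ofReal ℓ * Y + ENNReal.ofReal η * X) +
          ENNReal.ofReal ℓ * (k2 * V'))) + ENNReal.ofReal (C₂ * s * m) * Z) +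
          ENNReal.ofReal (Λ * 2 ^ α * s) * Y := by
          refine add_le_add (mul_le_mul_right (hcac.trans ?_) _) le_rfl
          gcongr
      _ = ENNReal.ofReal Λ * (ENNReal.ofReal (16 * Λ) * (ENNReal.ofReal (4 * (Λ * s)) *
          (Y + k2 * V))) + ENNReal.ofReal Λ * (ENNReal.ofReal (16 * Λ) * (ENNReal.ofReal ℓ * Y)) +
          ENNReal.ofReal Λ * (ENNReal.ofReal (16 * Λ) * (ENNReal.ofReal η * X)) +
          ENNReal.ofReal Λ * (ENNReal.ofReal (16 * Λ) * (ENNReal.ofReal ℓ * (k2 * V'))) +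
          ENNReal.ofReal Λ * (ENNReal.ofReal (C₂ * s * m) * Z) +
          ENNReal.ofReal (Λ * 2 ^ α * s) * Y := by ring
      _ ≤ ENNReal.ofReal (64 * Λ ^ 3) * (ENNReal.ofReal s * (Y + k2 * V)) +
          ENNReal.ofReal (16 * Λ ^ 2 * ℓ) * (ENNReal.ofReal s * Y) + X / 2 +
          ENNReal.ofReal (16 * Λ ^ 2 * ℓ) * (k2 * V') +
          ENNReal.ofReal (Λ * C₂) * (ENNReal.ofReal s * (ENNReal.ofReal m * Z)) +
          ENNReal.ofReal (Λ * 2 ^ α) * (ENNReal.ofReal s * Y) := by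
          rw [q1, q4, q5, q6]
          gcongr
      _ ≤ ENNReal.ofReal (64 * Λ ^ 3) * (ENNReal.ofReal s * (Y + k2 * V + ENNReal.ofReal m * Z) +
            k2 * V') +
          ENNReal.ofReal (16 * Λ ^ 2 * ℓ) * (ENNReal.ofReal s * (Y + k2 * V + ENNReal.ofReal m * Z) +
            k2 * V') + X / 2 +
          ENNReal.ofReal (16 * Λ ^ 2 * ℓ) * (ENNReal.ofReal s * (Y + k2 * V + ENNReal.ofReal m * Z) +
            k2 * V') +
          ENNReal.ofReal (Λ * C₂) * (ENNReal.ofReal s * (Y + k2 * V + ENNReal.ofReal m * Z) +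
            k2 * V') +
          ENNReal.ofReal (Λ * 2 ^ α) * (ENNReal.ofReal s * (Y + k2 * V + ENNReal.ofReal m * Z) +
            k2 * V') := by
          have z1 : Y + k2 * V ≤ Y + k2 * V + ENNReal.ofReal m * Z := le_self_add
          have z2 : Y ≤ Y + k2 * V + ENNReal.ofReal m * Z := le_self_add.trans z1
          have z3 : ENNReal.ofReal m * Z ≤ Y + k2 * V + ENNReal.ofReal m * Z := le_add_self
          have y1 := (mul_le_mul_right z1 (ENNReal.ofReal s)).trans
            (le_self_add (b := k2 * V'))
          have y2 := (mul_le_mul_right z2 (ENNReal.ofReal s)).trans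
            (le_self_add (b := k2 * V'))
          have y3 := (mul_le_mul_right z3 (ENNReal.ofReal s)).trans
            (le_self_add (b := k2 * V'))
          have y4 : k2 * V' ≤ ENNReal.ofReal s * (Y + k2 * V + ENNReal.ofReal m * Z) + k2 * V' :=
            le_add_self
          gcongr
      _ = _ := by
          have e : ENNReal.ofReal (64 * Λ ^ 3 + 32 * Λ ^ 2 * ℓ + Λ * C₂ + Λ * 2 ^ α) =
              ENNReal.ofReal (64 * Λ ^ 3) + ENNReal.ofReal (16 * Λ ^ 2 * ℓ) +
                ENNReal.ofReal (16 * Λ ^ 2 * ℓ) + ENNReal.ofReal (Λ * C₂) +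
                ENNReal.ofReal (Λ * 2 ^ α) := by
            rw [show 64 * Λ ^ 3 + 32 * Λ ^ 2 * ℓ + Λ * C₂ + Λ * 2 ^ α =
              64 * Λ ^ 3 + 16 * Λ ^ 2 * ℓ + 16 * Λ ^ 2 * ℓ + Λ * C₂ + Λ * 2 ^ α by ring,
              ENNReal.ofReal_add (by positivity) (by positivity),
              ENNReal.ofReal_add (by positivity) (by positivity),
              ENNReal.ofReal_add (by positivity) (by positivity),
              ENNReal.ofReal_add (by positivity) (by positivity)]
          rw [e]
          ring
  refine (le_two_mul_of_le_half_add hXfin hbound).trans (le_of_eq ?_)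
  rw [← mul_assoc, ENNReal.ofReal_mul (p := 2) (by norm_num), ENNReal.ofReal_ofNat]

end

/-! ### The De Giorgi iteration -/

/-- The constant in the growth estimate. -/
noncomputable def growthConst (α Λ ℓ C : ℝ) : ℝ :=
  2 * (64 * Λ ^ 3 + 32 * Λ ^ 2 * ℓ + Λ * (4 * (8 * Λ + C) + 2) + Λ * 2 ^ α)

lemma growthConst_pos {α Λ ℓ C : ℝ} (hΛ : 1 ≤ Λ) (hℓ : 0 ≤ ℓ) (hC : 0 ≤ C) :
    0 < growthConst α Λ ℓ C := by
  have : 0 < Λ := by linarith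
  unfold growthConst
  positivity

section

variable {α Λ η ℓ γ : ℝ} {K J : Kernel d} {x₀ : EuclideanSpace ℝ (Fin d)} {R M F r ρ : ℝ}
  {b : Bool} {u : EuclideanSpace ℝ (Fin d) → ℝ}

theorem LocalSolution.growth (S : LocalSetting α Λ η ℓ K J x₀ R)
    (U : LocalSolution b K x₀ R M F u) (hα0 : 0 < α) (hα : α < d) (hρ : 0 < ρ) (hr : 0 ≤ r)
    (hR : r + ρ ≤ 3 / 4 * R) (hη : 16 * Λ ^ 2 * η ≤ 1 / 2) (hγ : 0 ≤ γ)
    {C : ℝ} (hC : 0 ≤ C) (hT : TailBound b α C K x₀ R M F u)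
    (hdual : b = true → ∀ A ⊆ ball x₀ R, MeasurableSet A →
      ∫⁻ x in A, driftWeight K J (ball x₀ R) x ≤
        ENNReal.ofReal ℓ * volume A ^ (((d : ℝ) - α) / d + γ))
    {l D G : ℝ} (hl : 0 ≤ l) (hD : 0 < D) (hG : 0 ≤ G)
    (h : ∫⁻ x in ball x₀ (r + ρ), ENNReal.ofReal (max (u x - l) 0 ^ 2) ≤ ENNReal.ofReal G) :
    ∫⁻ x in ball x₀ r, ENNReal.ofReal (max (u x - (l + D)) 0 ^ 2) ≤
      ENNReal.ofReal (growthConst α Λ ℓ C * (ρ ^ (-α) * (G + (l + D) ^ 2 * (G / D ^ 2) +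
        (M + R ^ α * F) * (G / D)) + (l + D) ^ 2 * (G / D ^ 2) ^ (((d : ℝ) - α) / d + γ)) *
          (G / D ^ 2) ^ (α / d)) := by
  have hd : (0 : ℝ) < d := hα0.trans hα
  have hR0 := S.R_pos
  have hM := U.bound_pos
  have hF := U.rhs_nonneg
  have hk : 0 ≤ l + D := by positivity
  have hc := growthConst_pos (α := α) S.one_le S.drift_nonneg hC
  have he : 0 ≤ ((d : ℝ) - α) / d + γ := add_nonneg (div_nonneg (by linarith) hd.le) hγ
  have key := U.higher_integrability S hα0 hα hρ hr hR hη hC hT hdual hk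
  rw [← growthConst] at key
  set k := l + D with hkdef
  set B := ball x₀ (r + ρ)
  have hum := U.measurable
  have hAm0 : MeasurableSet {x | k < u x} := measurableSet_lt measurable_const hum
  set A := {x | k < u x} ∩ B with hA
  have hV : volume A ≤ ENNReal.ofReal (G / D ^ 2) := by
    have h1 : ENNReal.ofReal (D ^ 2) * volume A ≤ ENNReal.ofReal G := by
      refine le_trans ?_ h
      rw [hA, ← Measure.restrict_apply hAm0, ← lintegral_indicator_const hAm0]
      refine lintegral_mono fun x => ?_
      by_cases hx : k < u x
      · rw [indicator_of_mem (show x ∈ {x | k < u x} from hx)]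
        refine ENNReal.ofReal_le_ofReal (pow_le_pow_left₀ hD.le ?_ 2)
        exact le_max_of_le_left (by linarith)
      · rw [indicator_of_notMem (show x ∉ {x | k < u x} from hx)]
        exact zero_le
    rw [ENNReal.ofReal_div_of_pos (by positivity), ENNReal.le_div_iff_mul_le
      (Or.inl (ENNReal.ofReal_pos.2 (by positivity)).ne') (Or.inl ENNReal.ofReal_ne_top), mul_comm]
    exact h1
  have hZ : ∫⁻ x in B, ENNReal.ofReal (max (u x - k) 0) ≤ ENNReal.ofReal (G / D) := by
    rw [ENNReal.ofReal_div_of_pos hD, ENNReal.le_div_iff_mul_le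
      (Or.inl (ENNReal.ofReal_pos.2 hD).ne') (Or.inl ENNReal.ofReal_ne_top), mul_comm,
      ← lintegral_const_mul _ ((hum.sub_const k).max measurable_const).ennreal_ofReal]
    refine (lintegral_mono fun x => ?_).trans h
    rw [← ENNReal.ofReal_mul hD.le]
    refine ENNReal.ofReal_le_ofReal ?_
    rcases le_total (u x) k with hx | hx
    · rw [max_eq_right (by linarith)]
      simp only [mul_zero]
      positivity
    · rw [max_eq_left (by linarith), max_eq_left (by linarith)]
      nlinarith
  have hY : ∫⁻ x in B, ENNReal.ofReal (max (u x - k) 0 ^ 2) ≤ ENNReal.ofReal G := by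
    refine (lintegral_mono fun x => ENNReal.ofReal_le_ofReal ?_).trans h
    exact pow_le_pow_left₀ (le_max_right _ _) (max_le_max (by linarith) le_rfl) 2
  set m := M + R ^ α * F
  have hm : 0 ≤ m := by positivity
  set X := (∫⁻ x in B, ENNReal.ofReal ((cut x₀ r ρ x * max (u x - k) 0) ^ 2) ^
        ((d : ℝ) / (d - α))) ^ (((d : ℝ) - α) / d) with hX
  have hXle : X ≤ ENNReal.ofReal (growthConst α Λ ℓ C * (ρ ^ (-α) * (G + k ^ 2 * (G / D ^ 2) +
        m * (G / D)) + k ^ 2 * (G / D ^ 2) ^ (((d : ℝ) - α) / d + γ))) := by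
    rw [ENNReal.ofReal_mul hc.le, ENNReal.ofReal_add (by positivity) (by positivity),
      ENNReal.ofReal_mul (p := ρ ^ (-α)) (by positivity),
      ENNReal.ofReal_add (p := G + k ^ 2 * (G / D ^ 2)) (by positivity) (by positivity),
      ENNReal.ofReal_add (p := G) (by positivity) (by positivity),
      ENNReal.ofReal_mul (p := k ^ 2) (by positivity), ENNReal.ofReal_mul (p := m) hm,
      ENNReal.ofReal_mul (p := k ^ 2) (by positivity),
      ← ENNReal.ofReal_rpow_of_nonneg (by positivity) he]
    refine key.trans ?_
    have := ENNReal.rpow_le_rpow hV he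
    exact mul_le_mul' le_rfl (add_le_add (mul_le_mul' le_rfl (add_le_add (add_le_add hY
      (mul_le_mul' le_rfl hV)) (mul_le_mul' le_rfl hZ))) (mul_le_mul' le_rfl this))
  have hgm : Measurable fun x => ENNReal.ofReal ((cut x₀ r ρ x * max (u x - k) 0) ^ 2) :=
    ((continuous_cut.measurable.mul
      ((hum.sub_const k).max measurable_const)).pow_const 2).ennreal_ofReal
  have hH := lintegral_le_rpow_mul_measure_rpow hα0 hα (B := B) hAm0 hgm (fun x _ hx => by
    have : u x - k ≤ 0 := by simpa using hx
    simp [max_eq_right this]) measurableSet_ball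
  calc ∫⁻ x in ball x₀ r, ENNReal.ofReal (max (u x - k) 0 ^ 2)
      = ∫⁻ x in ball x₀ r, ENNReal.ofReal ((cut x₀ r ρ x * max (u x - k) 0) ^ 2) := by
        refine setLIntegral_congr_fun measurableSet_ball fun x hx => ?_
        rw [cut_eq_one hρ (mem_ball.1 hx).le, one_mul]
    _ ≤ _ := lintegral_mono_set (ball_subset_ball (by linarith))
    _ ≤ _ := hH
    _ ≤ _ := by
      rw [ENNReal.ofReal_mul (by positivity),
        ← ENNReal.ofReal_rpow_of_nonneg (by positivity) (by positivity)]
      exact mul_le_mul' hXle (ENNReal.rpow_le_rpow hV (by positivity))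

end

/-- The recursion of the De Giorgi iteration, in normalized form. -/
lemma normalized_growth_le {α γ δ κ R c m Y : ℝ} (hα0 : 0 < α) (hα2 : α < 2) (hα : α < d)
    (hγ : 0 ≤ γ) (hγ' : γ ≤ α / d) (hδ : 0 < δ) (hκ : 0 < κ) (hR : 0 < R) (hR1 : R ≤ 1)
    (hc : 0 ≤ c) (hm0 : 0 ≤ m) (hm : δ * m ≤ κ) (hY0 : 0 ≤ Y) (hY1 : Y ≤ 1) (i : ℕ)
    {ρ k D G : ℝ} (hρ : ρ = R / 2 ^ (i + 3)) (hk0 : 0 ≤ k) (hk : k ≤ κ)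
    (hD : D = κ / 2 ^ (i + 1)) (hG : G = κ ^ 2 * R ^ d * Y) :
    c * (ρ ^ (-α) * (G + k ^ 2 * (G / D ^ 2) + m * (G / D)) +
        k ^ 2 * (G / D ^ 2) ^ (((d : ℝ) - α) / d + γ)) * (G / D ^ 2) ^ (α / d) ≤
      κ ^ 2 * R ^ d * (c * (1024 * (2 + 1 / δ) + 64) * 64 ^ i * Y ^ (1 + γ)) := by
  have hd : (0 : ℝ) < d := hα0.trans hα
  set T : ℝ := 2 ^ (i + 1) with hT
  have hT1 : 1 ≤ T := one_le_pow₀ (by norm_num)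
  have hT0 : 0 < T := by positivity
  have e0 : 0 ≤ ((d : ℝ) - α) / d + γ := add_nonneg (div_nonneg (by linarith) hd.le) hγ
  have e1 : ((d : ℝ) - α) / d + γ ≤ 1 := by
    have : ((d : ℝ) - α) / d + α / d = 1 := by field_simp; ring
    linarith
  set e := ((d : ℝ) - α) / d + γ with he
  have hGD2 : G / D ^ 2 = Y * R ^ d * T ^ 2 := by
    rw [hG, hD]; field_simp
  have hGD : m * (G / D) ≤ κ ^ 2 * R ^ d * Y * (T / δ) := by
    have : m ≤ κ / δ := by rw [le_div_iff₀ hδ]; linarith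
    calc m * (G / D) ≤ κ / δ * (G / D) := by
          rw [hG, hD]; gcongr
      _ = _ := by rw [hG, hD]; field_simp
  have hρ' : ρ ^ (-α) ≤ R ^ (-α) * (16 * T ^ 2) := by
    rw [hρ, Real.div_rpow hR.le (by positivity), Real.rpow_neg (by positivity) (x := 2 ^ (i + 3)),
      div_inv_eq_mul]
    gcongr
    calc ((2 : ℝ) ^ (i + 3)) ^ α ≤ ((2 : ℝ) ^ (i + 3)) ^ (2 : ℝ) :=
          Real.rpow_le_rpow_of_exponent_le (one_le_pow₀ (by norm_num)) hα2.le
      _ = _ := by rw [Real.rpow_two, hT]; ring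
  have hRd : R ^ (-α) * (R ^ d) * (R ^ d) ^ (α / d) = R ^ d := by
    rw [← Real.rpow_natCast R d, ← Real.rpow_mul hR.le, mul_div_cancel₀ _ hd.ne',
      ← Real.rpow_add hR, ← Real.rpow_add hR]
    congr 1; ring
  have hRe : (R ^ d) ^ e * (R ^ d) ^ (α / d) ≤ R ^ d := by
    rw [← Real.rpow_add (by positivity)]
    calc (R ^ d) ^ (e + α / d) ≤ (R ^ d) ^ (1 : ℝ) := by
          refine Real.rpow_le_rpow_of_exponent_ge (by positivity) (pow_le_one₀ hR.le hR1) ?_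
          have : ((d : ℝ) - α) / d + α / d = 1 := by field_simp; ring
          linarith
      _ = _ := Real.rpow_one _
  have hYe : Y ^ e * Y ^ (α / d) = Y ^ (1 + γ) := by
    rw [← Real.rpow_add_of_nonneg hY0 e0 (by positivity)]
    congr 1
    rw [he]; field_simp; ring
  have hYα : Y * Y ^ (α / d) ≤ Y ^ (1 + γ) := by
    rw [Real.rpow_add_of_nonneg hY0 zero_le_one hγ, Real.rpow_one]
    exact mul_le_mul_of_nonneg_left
      (Real.rpow_le_rpow_of_exponent_ge' hY0 hY1 hγ hγ') hY0
  have hTe : (T ^ 2) ^ e ≤ T ^ 2 := by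
    calc (T ^ 2) ^ e ≤ (T ^ 2) ^ (1 : ℝ) :=
          Real.rpow_le_rpow_of_exponent_le (one_le_pow₀ hT1) e1
      _ = _ := Real.rpow_one _
  have hTα : (T ^ 2) ^ (α / d) ≤ T ^ 2 := by
    calc (T ^ 2) ^ (α / d) ≤ (T ^ 2) ^ (1 : ℝ) :=
          Real.rpow_le_rpow_of_exponent_le (one_le_pow₀ hT1) (by rw [div_le_one hd]; exact hα.le)
      _ = _ := Real.rpow_one _
  have hk2 : k ^ 2 ≤ κ ^ 2 := pow_le_pow_left₀ hk0 hk 2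
  have hT64 : T ^ 6 = 64 * 64 ^ i := by
    rw [hT, ← pow_mul, mul_comm, pow_mul]; norm_num; ring
  have hT46 : T ^ 4 ≤ T ^ 6 := pow_le_pow_right₀ hT1 (by norm_num)
  rw [hGD2, Real.mul_rpow (by positivity) (by positivity), Real.mul_rpow hY0 (by positivity),
    Real.mul_rpow (by positivity) (by positivity), Real.mul_rpow hY0 (by positivity)]
  have hG0 : 0 ≤ G := by rw [hG]; positivity
  have hGD0 : 0 ≤ G / D := div_nonneg hG0 (by rw [hD]; positivity)
  have b1 : G + k ^ 2 * (Y * R ^ d * T ^ 2) + m * (G / D) ≤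
      κ ^ 2 * R ^ d * Y * (T ^ 2 * (2 + 1 / δ)) := by
    have hT2 : 1 ≤ T ^ 2 := one_le_pow₀ hT1
    have i1 : G ≤ κ ^ 2 * R ^ d * Y * T ^ 2 := by
      rw [hG]; exact le_mul_of_one_le_right (by positivity) hT2
    have i2 : k ^ 2 * (Y * R ^ d * T ^ 2) ≤ κ ^ 2 * (Y * R ^ d * T ^ 2) := by gcongr
    have i3 : m * (G / D) ≤ κ ^ 2 * R ^ d * Y * (T ^ 2 * (1 / δ)) := by
      refine hGD.trans ?_
      gcongr
      rw [div_eq_mul_one_div]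
      gcongr
      nlinarith
    linarith
  have p1 : ρ ^ (-α) * (G + k ^ 2 * (Y * R ^ d * T ^ 2) + m * (G / D)) *
      (Y ^ (α / d) * (R ^ d) ^ (α / d) * (T ^ 2) ^ (α / d)) ≤
      κ ^ 2 * R ^ d * (16 * (2 + 1 / δ) * T ^ 6 * Y ^ (1 + γ)) := by
    calc _ ≤ R ^ (-α) * (16 * T ^ 2) * (κ ^ 2 * R ^ d * Y * (T ^ 2 * (2 + 1 / δ))) *
        (Y ^ (α / d) * (R ^ d) ^ (α / d) * T ^ 2) := by gcongr
      _ = (R ^ (-α) * (R ^ d) * (R ^ d) ^ (α / d)) * (κ ^ 2 * (16 * (2 + 1 / δ) * T ^ 6) *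
          (Y * Y ^ (α / d))) := by ring
      _ ≤ R ^ d * (κ ^ 2 * (16 * (2 + 1 / δ) * T ^ 6) * Y ^ (1 + γ)) := by
          rw [hRd]; gcongr
      _ = _ := by ring
  have p2 : k ^ 2 * (Y ^ e * (R ^ d) ^ e * (T ^ 2) ^ e) *
      (Y ^ (α / d) * (R ^ d) ^ (α / d) * (T ^ 2) ^ (α / d)) ≤
      κ ^ 2 * R ^ d * (T ^ 6 * Y ^ (1 + γ)) := by
    calc _ ≤ κ ^ 2 * (Y ^ e * (R ^ d) ^ e * T ^ 2) *
        (Y ^ (α / d) * (R ^ d) ^ (α / d) * T ^ 2) := by gcongr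
      _ = κ ^ 2 * ((R ^ d) ^ e * (R ^ d) ^ (α / d)) * (T ^ 4 * (Y ^ e * Y ^ (α / d))) := by ring
      _ ≤ κ ^ 2 * R ^ d * (T ^ 6 * Y ^ (1 + γ)) := by
          rw [hYe]; gcongr
  set Q := Y ^ (α / d) * (R ^ d) ^ (α / d) * (T ^ 2) ^ (α / d)
  set N := Y ^ (1 + γ)
  have hN : 0 ≤ N := by positivity
  set P := κ ^ 2 * R ^ d
  have hP : 0 ≤ P := by positivity
  calc _ = c * (ρ ^ (-α) * (G + k ^ 2 * (Y * R ^ d * T ^ 2) + m * (G / D)) * Q +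
        k ^ 2 * (Y ^ e * (R ^ d) ^ e * (T ^ 2) ^ e) * Q) := by ring
    _ ≤ c * (P * (16 * (2 + 1 / δ) * T ^ 6 * N) + P * (T ^ 6 * N)) := by gcongr
    _ = P * (c * (16 * (2 + 1 / δ) + 1) * T ^ 6 * N) := by ring
    _ = P * (c * (16 * (2 + 1 / δ) + 1) * 64 * 64 ^ i * N) := by rw [hT64]; ring
    _ = _ := by ring

/-- Fast geometric convergence: the choice of the smallness parameter. -/
lemma exists_iteration_threshold {γ A : ℝ} (hγ : 0 < γ) (hA : 0 < A) :
    ∃ ν q : ℝ, 0 < ν ∧ ν ≤ 1 ∧ 0 < q ∧ q < 1 ∧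
      ∀ i : ℕ, A * 64 ^ i * (ν * q ^ i) ^ (1 + γ) ≤ ν * q ^ (i + 1) := by
  set q : ℝ := 64 ^ (-(1 / γ)) with hq
  have hq0 : 0 < q := by positivity
  have hq1 : q < 1 := Real.rpow_lt_one_of_one_lt_of_neg (by norm_num) (by simpa using hγ)
  have hqγ : 64 * q ^ γ = 1 := by
    rw [hq, ← Real.rpow_mul (by norm_num)]
    have : -(1 / γ) * γ = -1 := by field_simp
    rw [this, Real.rpow_neg_one]; norm_num
  set ν : ℝ := min 1 ((q / A) ^ (1 / γ)) with hν
  have hν0 : 0 < ν := lt_min one_pos (by positivity)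
  have hνγ : A * ν ^ γ ≤ q := by
    have h1 : ν ^ γ ≤ ((q / A) ^ (1 / γ)) ^ γ :=
      Real.rpow_le_rpow hν0.le (min_le_right _ _) hγ.le
    rw [← Real.rpow_mul (by positivity), one_div_mul_cancel hγ.ne', Real.rpow_one] at h1
    rw [mul_comm]
    exact (le_div_iff₀ hA).1 h1
  refine ⟨ν, q, hν0, min_le_left _ _, hq0, hq1, fun i => ?_⟩
  have h1 : (64 : ℝ) ^ i * (q ^ i) ^ γ = 1 := by
    have : (q ^ i) ^ γ = (q ^ γ) ^ i := by
      rw [← Real.rpow_natCast q i, ← Real.rpow_mul hq0.le, mul_comm, Real.rpow_mul hq0.le,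
        Real.rpow_natCast]
    rw [this, ← mul_pow, hqγ, one_pow]
  rw [Real.rpow_add (by positivity), Real.rpow_one, Real.mul_rpow hν0.le (by positivity)]
  calc A * 64 ^ i * (ν * q ^ i * (ν ^ γ * (q ^ i) ^ γ))
      = (A * ν ^ γ) * (ν * q ^ i) * (64 ^ i * (q ^ i) ^ γ) := by ring
    _ ≤ q * (ν * q ^ i) := by rw [h1, mul_one]; gcongr
    _ = _ := by ring

/-- The smallness of `∫ u²` forces `u ≤ κ` on the smaller ball. -/
theorem exists_le_of_lintegral_le {α Λ η ℓ γ C δ : ℝ} (hα0 : 0 < α) (hα2 : α < 2) (hα : α < d)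
    (hΛ : 1 ≤ Λ) (hℓ : 0 ≤ ℓ) (hη : 16 * Λ ^ 2 * η ≤ 1 / 2) (hγ : 0 < γ) (hγ' : γ ≤ α / d)
    (hC : 0 ≤ C) (hδ : 0 < δ) :
    ∃ ν : ℝ, 0 < ν ∧ ∀ (b : Bool) (K J : Kernel d) (x₀ : EuclideanSpace ℝ (Fin d)) (R M F : ℝ)
      (u : EuclideanSpace ℝ (Fin d) → ℝ), LocalSetting α Λ η ℓ K J x₀ R →
      LocalSolution b K x₀ R M F u → TailBound b α C K x₀ R M F u →
      (b = true → ∀ A ⊆ ball x₀ R, MeasurableSet A →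
        ∫⁻ x in A, driftWeight K J (ball x₀ R) x ≤
          ENNReal.ofReal ℓ * volume A ^ (((d : ℝ) - α) / d + γ)) →
      ∀ κ : ℝ, 0 < κ → δ * (M + R ^ α * F) ≤ κ →
        ∫⁻ x in ball x₀ R, ENNReal.ofReal (u x ^ 2) ≤ ENNReal.ofReal (κ ^ 2 * R ^ d * ν) →
        ∀ᵐ x ∂volume.restrict (ball x₀ (R / 2)), u x ≤ κ := by
  have hc := growthConst_pos (α := α) hΛ hℓ hC
  set A := growthConst α Λ ℓ C * (1024 * (2 + 1 / δ) + 64) with hA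
  obtain ⟨ν, q, hν0, hν1, hq0, hq1, hit⟩ := exists_iteration_threshold (A := A) hγ (by positivity)
  refine ⟨ν, hν0, ?_⟩
  intro b K J x₀ R M F u S U hT hdual κ hκ hm h0
  have hR := S.R_pos
  have hM := U.bound_pos
  have hF := U.rhs_nonneg
  have hum := U.measurable
  have claim : ∀ i : ℕ, ∫⁻ x in ball x₀ (R / 2 + R / 2 ^ (i + 2)),
      ENNReal.ofReal (max (u x - κ * (1 - 1 / 2 ^ i)) 0 ^ 2) ≤
        ENNReal.ofReal (κ ^ 2 * R ^ d * (ν * q ^ i)) := by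
    intro i
    induction i with
    | zero =>
      refine le_trans ?_ (h0.trans (le_of_eq (by simp)))
      refine (lintegral_mono_set (ball_subset_ball (by norm_num; linarith))).trans
        (lintegral_mono fun x => ?_)
      simp [max_eq_left (U.nonneg x)]
    | succ i ih =>
      have hp : (0 : ℝ) < 2 ^ i := by positivity
      have e1 : R / 2 + R / 2 ^ (i + 2) = (R / 2 + R / 2 ^ (i + 1 + 2)) + R / 2 ^ (i + 3) := by
        field_simp; ring
      have e2 : κ * (1 - 1 / 2 ^ (i + 1)) = κ * (1 - 1 / 2 ^ i) + κ / 2 ^ (i + 1) := by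
        field_simp; ring
      have hp1 : 1 / (2 : ℝ) ^ i ≤ 1 := by
        rw [div_le_one hp]; exact one_le_pow₀ (by norm_num)
      have hl : 0 ≤ κ * (1 - 1 / 2 ^ i) := mul_nonneg hκ.le (by linarith)
      rw [e1] at ih
      rw [e2]
      have hqi : q ^ i ≤ 1 := pow_le_one₀ hq0.le hq1.le
      refine (U.growth S hα0 hα (by positivity) (by positivity) ?_ hη hγ.le hC hT hdual hl
        (by positivity) (by positivity) ih).trans (ENNReal.ofReal_le_ofReal ?_)
      · rw [← e1]
        have : R / 2 ^ (i + 2) ≤ R / 2 ^ 2 :=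
          div_le_div_of_nonneg_left hR.le (by norm_num) (pow_le_pow_right₀ (by norm_num) (by omega))
        linarith
      · refine (normalized_growth_le (Y := ν * q ^ i) hα0 hα2 hα hγ.le hγ' hδ hκ hR S.R_le_one hc.le
          (by positivity) hm (by positivity) (mul_le_one₀ hν1 (by positivity) hqi) i rfl
          (by positivity) ?_ rfl rfl).trans ?_
        · rw [← e2]
          have : 0 ≤ κ * (1 / 2 ^ (i + 1)) := by positivity
          linarith
        · have := hit i
          gcongr
  have hfinal : ∫⁻ x in ball x₀ (R / 2), ENNReal.ofReal (max (u x - κ) 0 ^ 2) = 0 := by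
    have hlim : Filter.Tendsto (fun i : ℕ => ENNReal.ofReal (κ ^ 2 * R ^ d * (ν * q ^ i)))
        Filter.atTop (nhds 0) := by
      rw [← ENNReal.ofReal_zero]
      refine ENNReal.tendsto_ofReal ?_
      have := ((tendsto_pow_atTop_nhds_zero_of_lt_one hq0.le hq1).const_mul ν).const_mul
        (κ ^ 2 * R ^ d)
      simpa using this
    refine le_antisymm (ge_of_tendsto' hlim fun i => ?_) zero_le
    refine le_trans ?_ (claim i)
    have hp : (0 : ℝ) < 2 ^ i := by positivity
    refine (lintegral_mono_set (ball_subset_ball (by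
      have : 0 ≤ R / 2 ^ (i + 2) := by positivity
      linarith))).trans (lintegral_mono fun x => ENNReal.ofReal_le_ofReal ?_)
    refine pow_le_pow_left₀ (le_max_right _ _) (max_le_max ?_ le_rfl) 2
    have : 0 ≤ κ * (1 / 2 ^ i) := by positivity
    linarith
  rw [lintegral_eq_zero_iff (((hum.sub_const κ).max measurable_const).pow_const 2).ennreal_ofReal]
    at hfinal
  filter_upwards [hfinal] with x hx
  have h1 : max (u x - κ) 0 ^ 2 ≤ 0 := by simpa using hx
  have h2 : max (u x - κ) 0 = 0 := by
    have := sq_nonneg (max (u x - κ) 0)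
    exact pow_eq_zero_iff (two_ne_zero) |>.1 (le_antisymm h1 this)
  have := le_max_left (u x - κ) 0
  linarith

/-- The local boundedness estimate in a fixed ball. -/
theorem exists_local_bound {α Λ η ℓ γ c δ : ℝ} (hα0 : 0 < α) (hα2 : α < 2) (hα : α < d)
    (hΛ : 1 ≤ Λ) (hℓ : 0 ≤ ℓ) (hη0 : 0 ≤ η) (hη : 16 * Λ ^ 2 * η ≤ 1 / 2) (hγ : 0 < γ)
    (hγ' : γ ≤ α / d) (hc : 0 ≤ c) (hδ : 0 < δ) :
    ∃ c' : ℝ, 0 < c' ∧ ∀ (b : Bool) (K J : Kernel d) (x₀ : EuclideanSpace ℝ (Fin d)) (R M F : ℝ)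
      (u : EuclideanSpace ℝ (Fin d) → ℝ), LocalSetting α Λ η ℓ K J x₀ R →
      LocalSolution b K x₀ R M F u → LocalUJS b c K x₀ R →
      (b = true → ∀ A ⊆ ball x₀ R, MeasurableSet A →
        ∫⁻ x in A, driftWeight K J (ball x₀ R) x ≤
          ENNReal.ofReal ℓ * volume A ^ (((d : ℝ) - α) / d + γ)) →
      supOn (ball x₀ (R / 2)) u ≤
        ENNReal.ofReal c' * (⨍⁻ x in ball x₀ R, ENNReal.ofReal (u x ^ 2) ∂volume) ^ (1 / 2 : ℝ) +
          ENNReal.ofReal (δ * (M + R ^ α * F)) := by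
  obtain ⟨C, hC, htail⟩ := exists_tailBound (d := d) hα0 hα hΛ hη0 hℓ hc
  obtain ⟨ν, hν, key⟩ := exists_le_of_lintegral_le (d := d) hα0 hα2 hα hΛ hℓ hη hγ hγ' hC hδ
  have hω := ballVol_pos (d := d)
  refine ⟨(ballVol d / ν) ^ (1 / 2 : ℝ), by positivity, ?_⟩
  intro b K J x₀ R M F u S U hU hdual
  have hR := S.R_pos
  have hM := U.bound_pos
  have hF := U.rhs_nonneg
  have hT := htail b K J x₀ R M F u S U hU
  set m := M + R ^ α * F
  have hm : 0 < m := by positivity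
  set I := ∫⁻ x in ball x₀ R, ENNReal.ofReal (u x ^ 2) with hI
  have hIfin : I ≠ ∞ := by
    refine ((setLIntegral_mono' (g := fun _ => ENNReal.ofReal (M ^ 2)) measurableSet_ball
      fun x hx => ENNReal.ofReal_le_ofReal ?_).trans_lt ?_).ne
    · exact pow_le_pow_left₀ (U.nonneg x) (U.le_bound x hx) 2
    · rw [setLIntegral_const]
      exact ENNReal.mul_lt_top ENNReal.ofReal_lt_top measure_ball_lt_top
  set t := I.toReal
  have ht : 0 ≤ t := ENNReal.toReal_nonneg
  set a : ℝ := (t / (ν * R ^ d)) ^ (1 / 2 : ℝ) with ha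
  have ha0 : 0 ≤ a := by positivity
  have ha2 : a ^ 2 = t / (ν * R ^ d) := by
    rw [ha, ← Real.sqrt_eq_rpow, Real.sq_sqrt (by positivity)]
  have hle := key b K J x₀ R M F u S U hT hdual (a + δ * m) (by positivity) (by linarith) (by
    rw [← hI, ← ENNReal.ofReal_toReal hIfin]
    refine ENNReal.ofReal_le_ofReal ?_
    have h1 : a ^ 2 ≤ (a + δ * m) ^ 2 :=
      pow_le_pow_left₀ ha0 (le_add_of_nonneg_right (by positivity)) 2
    calc t = a ^ 2 * R ^ d * ν := by rw [ha2]; field_simp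
      _ ≤ _ := by gcongr)
  have hsup : supOn (ball x₀ (R / 2)) u ≤ ENNReal.ofReal (a + δ * m) :=
    essSup_le_of_ae_le _ (hle.mono fun x hx => ENNReal.ofReal_le_ofReal hx)
  refine hsup.trans ?_
  rw [ENNReal.ofReal_add ha0 (by positivity)]
  refine add_le_add (le_of_eq ?_) le_rfl
  rw [setLAverage_eq, ← hI, volume_ball_eq _ hR, ← ENNReal.ofReal_toReal hIfin,
    ← ENNReal.ofReal_div_of_pos (by positivity), ENNReal.ofReal_rpow_of_nonneg (by positivity)
    (by norm_num), ← ENNReal.ofReal_mul (by positivity), ← Real.mul_rpow (by positivity)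
    (by positivity), ha]
  congr 2
  field_simp
  rfl

/-! ### Bounds for the drift -/

section Level

variable {X : Type*} [MeasurableSpace X] {μ : Measure X}

/-- Splitting the weight at the level `ℓ`. -/
lemma lintegral_mul_le_of_level {α η ℓ : ℝ} (hα0 : 0 < α) (hα : α < d) (hη : 0 ≤ η)
    {W g : X → ℝ≥0∞} (hW : Measurable W) (hg : Measurable g)
    (h : ∫⁻ x in {x | ENNReal.ofReal ℓ < W x}, W x ^ ((d : ℝ) / α) ∂μ ≤
      ENNReal.ofReal (η ^ ((d : ℝ) / α))) :
    ∫⁻ x, g x * W x ∂μ ≤ ENNReal.ofReal ℓ * (∫⁻ x, g x ∂μ) +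
      ENNReal.ofReal η * (∫⁻ x, g x ^ ((d : ℝ) / (d - α)) ∂μ) ^ (((d : ℝ) - α) / d) := by
  have hd : (0 : ℝ) < d := hα0.trans hα
  have hpq : ((d : ℝ) / (d - α)).HolderConjugate (d / α) := by
    refine ⟨?_, div_pos hd (by linarith), div_pos hd hα0⟩
    rw [inv_div, inv_div]
    field_simp
    ring
  set S := {x | ENNReal.ofReal ℓ < W x}
  have hS : MeasurableSet S := measurableSet_lt measurable_const hW
  have h1 : ∀ x, g x * W x ≤ ENNReal.ofReal ℓ * g x + (g * S.indicator W) x := fun x => by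
    by_cases hx : x ∈ S
    · simp only [Pi.mul_apply, indicator_of_mem hx]
      exact le_add_self
    · simp only [Pi.mul_apply, indicator_of_notMem hx, mul_zero, add_zero]
      rw [mul_comm]
      exact mul_le_mul' (not_lt.1 hx) le_rfl
  refine (lintegral_mono h1).trans ?_
  rw [lintegral_add_left (hg.const_mul _), lintegral_const_mul _ hg]
  refine add_le_add le_rfl ?_
  refine (ENNReal.lintegral_mul_le_Lp_mul_Lq μ hpq hg.aemeasurable
    (hW.indicator hS).aemeasurable).trans ?_
  rw [one_div_div, one_div_div, mul_comm]
  refine mul_le_mul' ?_ le_rfl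
  have e : ∀ x, S.indicator W x ^ ((d : ℝ) / α) =
      S.indicator (fun x => W x ^ ((d : ℝ) / α)) x := fun x => by
    by_cases hx : x ∈ S
    · simp [hx]
    · simp [hx, div_pos hd hα0]
  simp_rw [e]
  rw [lintegral_indicator hS]
  calc _ ≤ (ENNReal.ofReal (η ^ ((d : ℝ) / α))) ^ (α / d) := by gcongr
    _ = _ := by
      rw [ENNReal.ofReal_rpow_of_nonneg (by positivity) (by positivity), ← Real.rpow_mul hη]
      have : (d : ℝ) / α * (α / d) = 1 := by field_simp
      rw [this, Real.rpow_one]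

/-- A uniform level in the subcritical case. -/
lemma exists_level_of_eLpNorm_le {q η C : ℝ} {θ : ℝ≥0∞} (hq : 0 < q) (hθ : ENNReal.ofReal q < θ)
    (hη : 0 < η) :
    ∃ ℓ : ℝ, 0 ≤ ℓ ∧ ∀ {X : Type} [MeasurableSpace X] (μ : Measure X) (W : X → ℝ≥0∞),
      Measurable W → eLpNorm W θ μ ≤ ENNReal.ofReal C →
        ∫⁻ x in {x | ENNReal.ofReal ℓ < W x}, W x ^ q ∂μ ≤ ENNReal.ofReal η := by
  rcases eq_or_ne θ ∞ with rfl | hθt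
  · refine ⟨max C 0, le_max_right _ _, fun μ W hW h => ?_⟩
    have h0 : μ {x | ENNReal.ofReal (max C 0) < W x} = 0 := by
      rw [eLpNorm_exponent_top] at h
      have := ae_le_eLpNormEssSup (f := W) (μ := μ)
      refine measure_mono_null (fun x hx => ?_) (ae_iff.1 this)
      simp only [mem_ofPred_eq, not_le, enorm_eq_self] at hx ⊢
      exact h.trans_lt ((ENNReal.ofReal_le_ofReal (le_max_left _ _)).trans_lt hx)
    rw [Measure.restrict_eq_zero.2 h0, lintegral_zero_measure]
    exact zero_le
  · set p := θ.toReal with hp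
    have hqp : q < p := (ENNReal.ofReal_lt_iff_lt_toReal hq.le hθt).1 hθ
    have hp0 : 0 < p := hq.trans hqp
    set A : ℝ := max C 0 ^ p with hA
    have hA0 : 0 ≤ A := by positivity
    set ℓ : ℝ := (A / η) ^ (1 / (p - q)) + 1 with hℓ
    have hpq : 0 < p - q := by linarith
    have hℓ0 : 0 < ℓ := by positivity
    have hℓA : A * ℓ ^ (q - p) ≤ η := by
      have h1 : A / η ≤ ℓ ^ (p - q) := by
        calc A / η = ((A / η) ^ (1 / (p - q))) ^ (p - q) := by
              rw [← Real.rpow_mul (by positivity), one_div_mul_cancel hpq.ne', Real.rpow_one]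
          _ ≤ _ := by gcongr; linarith
      rw [show q - p = -(p - q) by ring, Real.rpow_neg hℓ0.le, ← div_eq_mul_inv,
        div_le_iff₀ (by positivity), mul_comm]
      exact (div_le_iff₀ hη).1 h1
    refine ⟨ℓ, hℓ0.le, fun μ W hW h => ?_⟩
    have hI : ∫⁻ x, W x ^ p ∂μ ≤ ENNReal.ofReal A := by
      rw [eLpNorm_eq_lintegral_rpow_enorm_toReal (ne_bot_of_gt hθ) hθt] at h
      simp only [enorm_eq_self] at h
      have h2 := h.trans (ENNReal.ofReal_le_ofReal (le_max_left C 0))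
      rw [one_div, ENNReal.rpow_inv_le_iff hp0, ENNReal.ofReal_rpow_of_nonneg (le_max_right _ _)
        hp0.le] at h2
      exact h2
    have hS : MeasurableSet {x | ENNReal.ofReal ℓ < W x} := measurableSet_lt measurable_const hW
    calc ∫⁻ x in {x | ENNReal.ofReal ℓ < W x}, W x ^ q ∂μ
        ≤ ∫⁻ x in {x | ENNReal.ofReal ℓ < W x}, ENNReal.ofReal (ℓ ^ (q - p)) * W x ^ p ∂μ := by
          refine setLIntegral_mono' hS fun x hx => ?_
          have hx' : ENNReal.ofReal ℓ < W x := hx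
          rcases eq_or_ne (W x) ∞ with ht | ht
          · rw [ht, ENNReal.top_rpow_of_pos hp0, ENNReal.mul_top]
            · exact le_top
            · exact (ENNReal.ofReal_pos.2 (by positivity)).ne'
          · rw [← ENNReal.ofReal_rpow_of_pos hℓ0]
            have h3 : W x ^ (q - p) ≤ ENNReal.ofReal ℓ ^ (q - p) := by
              rw [show q - p = -(p - q) by ring, ENNReal.rpow_neg, ENNReal.rpow_neg]
              gcongr
            refine le_trans (le_of_eq ?_) (mul_le_mul' h3 le_rfl)
            rw [← ENNReal.rpow_add _ _ (by exact ne_bot_of_gt hx') ht, sub_add_cancel]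
      _ ≤ ∫⁻ x, ENNReal.ofReal (ℓ ^ (q - p)) * W x ^ p ∂μ := setLIntegral_le_lintegral _ _
      _ = ENNReal.ofReal (ℓ ^ (q - p)) * ∫⁻ x, W x ^ p ∂μ :=
          lintegral_const_mul _ (hW.pow_const p)
      _ ≤ ENNReal.ofReal (ℓ ^ (q - p)) * ENNReal.ofReal A := by gcongr
      _ = ENNReal.ofReal (A * ℓ ^ (q - p)) := by
          rw [← ENNReal.ofReal_mul (by positivity), mul_comm]
      _ ≤ _ := ENNReal.ofReal_le_ofReal hℓA

/-- Absolute continuity: a level for a single weight. -/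
lemma exists_level_of_lintegral_ne_top {q η : ℝ} (hq : 0 < q) (hη : 0 < η) {W : X → ℝ≥0∞}
    (hW : Measurable W) (h : ∫⁻ x, W x ^ q ∂μ ≠ ∞) :
    ∃ ℓ : ℝ, 0 ≤ ℓ ∧ ∫⁻ x in {x | ENNReal.ofReal ℓ < W x}, W x ^ q ∂μ ≤ ENNReal.ofReal η := by
  have hS : ∀ n : ℕ, MeasurableSet {x | ENNReal.ofReal n < W x} := fun n =>
    measurableSet_lt measurable_const hW
  have hWq : Measurable fun x => W x ^ q := hW.pow_const q
  have hlim := tendsto_lintegral_of_dominated_convergence (μ := μ)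
    (F := fun n : ℕ => {x | ENNReal.ofReal n < W x}.indicator fun x => W x ^ q) (f := fun _ => 0)
    (fun x => W x ^ q) (fun n => hWq.indicator (hS n))
    (fun n => Filter.Eventually.of_forall fun x => indicator_le_self _ _ x) h (by
      filter_upwards [ae_lt_top hWq h] with x hx
      have hx' : W x ≠ ∞ := fun ht => by simp [ht, hq] at hx
      obtain ⟨N, hN⟩ := ENNReal.exists_nat_gt hx'
      refine tendsto_const_nhds.congr' ?_
      filter_upwards [Filter.eventually_ge_atTop N] with n hn
      rw [indicator_of_notMem]
      simp only [mem_ofPred_eq, not_lt, ENNReal.ofReal_natCast]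
      exact hN.le.trans (by exact_mod_cast hn))
  rw [lintegral_zero] at hlim
  obtain ⟨n, hn⟩ := (hlim.eventually (gt_mem_nhds (ENNReal.ofReal_pos.2 hη))).exists
  refine ⟨n, n.cast_nonneg, ?_⟩
  rw [lintegral_indicator (hS n)] at hn
  exact hn.le

end Level

section Setting

variable {α Λ η ℓ : ℝ} {K J : Kernel d} {x₀ : EuclideanSpace ℝ (Fin d)} {R : ℝ}

lemma driftWeight_mono_set {U V : Set (EuclideanSpace ℝ (Fin d))} (h : U ⊆ V)
    (x : EuclideanSpace ℝ (Fin d)) : driftWeight K J U x ≤ driftWeight K J V x :=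
  lintegral_mono_set h

lemma driftWeight_anti {J' : Kernel d} (h : ∀ x y, J x y ≤ J' x y)
    (U : Set (EuclideanSpace ℝ (Fin d))) (x : EuclideanSpace ℝ (Fin d)) :
    driftWeight K J' U x ≤ driftWeight K J U x :=
  lintegral_mono fun y => ENNReal.div_le_div_left (h x y) _

/-- The common constant of the local setting. -/
noncomputable def settingConst (α cCut cSob cJ cK : ℝ) : ℝ :=
  (max cJ 0 + max cCut 0) * levyConst α + max cK 0 + max cSob 0 + 1

/-- The assumptions provide the local setting in `B_R(x₀)` if `B_{2R}(x₀) ⊆ Ω`. -/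
theorem LocalSetting.of_assumptions {cCut cSob cJ cK : ℝ} (hα0 : 0 < α) (hα2 : α < 2)
    (hα : α < d) (hη : 0 ≤ η) (hℓ : 0 ≤ ℓ) {Ω : Set (EuclideanSpace ℝ (Fin d))}
    (hK : Measurable (Function.uncurry K)) (hCut : Cutoff α cCut Ω (symPart K))
    (hSob : Sob α cSob Ω (symPart K)) (hJ : IsComparisonKernel α cJ Ω J)
    (hE : EnergyComparison cK Ω K J) (hR : 0 < R) (hR1 : R ≤ 1) (hΩ : ball x₀ (2 * R) ⊆ Ω)
    (hdrift : ∫⁻ x in {x | ENNReal.ofReal ℓ < driftWeight K J (ball x₀ R) x},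
      driftWeight K J (ball x₀ R) x ^ ((d : ℝ) / α) ∂volume.restrict (ball x₀ R) ≤
        ENNReal.ofReal (η ^ ((d : ℝ) / α))) :
    LocalSetting α (settingConst α cCut cSob cJ cK) η ℓ K (fun x y => J x y + symPart K x y)
      x₀ R := by
  have hL := levyConst_nonneg hα2
  have m1 := le_max_left cJ 0
  have m1' := le_max_right cJ 0
  have m2 := le_max_left cCut 0
  have m2' := le_max_right cCut 0
  have m3 := le_max_left cK 0
  have m3' := le_max_right cK 0
  have m4 := le_max_left cSob 0
  have m4' := le_max_right cSob 0
  have mL : 0 ≤ (max cJ 0 + max cCut 0) * levyConst α := by positivity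
  set Λ := settingConst α cCut cSob cJ cK with hΛ
  rw [settingConst] at hΛ
  have hsm := measurable_symPart hK
  have hmono : ∀ {c c' : ℝ} {k : Kernel d}, c ≤ c' → Cutoff α c Ω k → Cutoff α c' Ω k := by
    intro c c' k hc h z r ρ h1 h2 h3 h4
    obtain ⟨τ, h5, h6⟩ := h z r ρ h1 h2 h3 h4
    exact ⟨τ, h5, fun x hx => (h6 x hx).trans (ENNReal.ofReal_le_ofReal (by gcongr))⟩
  refine ⟨hK, hJ.measurable.add hsm, fun x y => by rw [hJ.symm x y, symPart_symm x y],
    fun x y => le_add_self, hR, hR1, by linarith, hℓ, ?_, ?_, ?_, ?_⟩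
  · intro x hx ρ hρ hρR
    have hsub : ball x ρ ⊆ Ω := by
      refine (ball_subset_ball' ?_).trans hΩ
      have := mem_ball.1 hx
      linarith
    have h1 := Cutoff.lintegral_le hα2 m1' hJ.measurable (hmono m1 hJ.cutoff) hρ
      (hρR.trans hR1) hsub
    have h2 := Cutoff.lintegral_le hα2 m2' hsm (hmono m2 hCut) hρ (hρR.trans hR1) hsub
    simp_rw [mul_add]
    have hmeas : Measurable fun y => ENNReal.ofReal (min (dist x y ^ 2 / ρ ^ 2) 1) * J x y :=
      Measurable.mul (by fun_prop) hJ.measurable.of_uncurry_left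
    rw [lintegral_add_left hmeas]
    refine (add_le_add h1 h2).trans ?_
    rw [← ENNReal.ofReal_add (by positivity) (by positivity)]
    refine ENNReal.ofReal_le_ofReal ?_
    rw [← add_mul, ← add_mul]
    gcongr
    linarith
  · intro s hs hsR v hv
    have hs2 : (2 : ℝ) * (s / 2) = s := by ring
    have h1 := hE x₀ (s / 2) (by positivity) (by linarith)
      (by rw [hs2]; exact (ball_subset_ball (by linarith)).trans hΩ) v (by rwa [hs2])
    rw [hs2] at h1
    have e : energyOn (fun x y => J x y + symPart K x y) (ball x₀ s) v ≤
        energyOn J (ball x₀ s) v + energyOn (symPart K) (ball x₀ s) v := by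
      obtain ⟨w, hw, hvw⟩ := hv.1
      have hcongr : ∀ k : Kernel d, energyOn k (ball x₀ s) v = energyOn k (ball x₀ s) w := by
        intro k
        refine lintegral_congr_ae (hvw.mono fun x hx => ?_)
        refine lintegral_congr_ae (hvw.mono fun y hy => ?_)
        simp only [hx, hy]
      simp_rw [hcongr, energyOn, mul_add]
      rw [lintegral_lintegral_add (measurable_sub_sq_mul hw.measurable hJ.measurable)]
    refine e.trans ((add_le_add h1 le_rfl).trans ?_)
    rw [← add_one_mul]
    refine mul_le_mul' ?_ le_rfl
    calc ENNReal.ofReal cK + 1 ≤ ENNReal.ofReal (max cK 0) + ENNReal.ofReal 1 := by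
          rw [ENNReal.ofReal_one]; gcongr
      _ ≤ _ := by
        rw [← ENNReal.ofReal_add m3' zero_le_one]
        exact ENNReal.ofReal_le_ofReal (by linarith)
  · intro r ρ hρ hρr hrR v hv
    refine (hSob x₀ r ρ hρ hρr (by linarith) ((ball_subset_ball (by linarith)).trans hΩ) v
      hv).trans ?_
    have : cSob ≤ Λ := by linarith
    gcongr
  · intro g hg
    have hW := measurable_driftWeight hK hJ.measurable (ball x₀ R)
    refine le_trans (lintegral_mono fun x => ?_)
      (lintegral_mul_le_of_level hα0 hα hη hW hg hdrift)
    exact mul_le_mul' le_rfl (driftWeight_anti (fun x y => le_self_add) _ _)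

end Setting

/-- A uniform level for the drift on all balls centred in a compact set, at the critical
exponent. -/
theorem exists_level_of_isCompact {α η : ℝ} (hα0 : 0 < α) (hα : α < d) (hη : 0 < η)
    {K J : Kernel d} (hK : Measurable (Function.uncurry K)) (hJ : Measurable (Function.uncurry J))
    {Ω D : Set (EuclideanSpace ℝ (Fin d))} (hΩ : IsOpen Ω) (hD : IsCompact D) (hDΩ : D ⊆ Ω)
    (h : ∀ (z : EuclideanSpace ℝ (Fin d)) (r : ℝ), 0 < r → r ≤ 1 → ball z (2 * r) ⊆ Ω →
      ∫⁻ x in ball z (2 * r), driftWeight K J (ball z (2 * r)) x ^ ((d : ℝ) / α) ≠ ∞) :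
    ∃ ℓ : ℝ, 0 ≤ ℓ ∧ ∀ (x₀ : EuclideanSpace ℝ (Fin d)) (R : ℝ), x₀ ∈ D → 0 < R → R ≤ 1 →
      ball x₀ (2 * R) ⊆ Ω →
      ∫⁻ x in {x | ENNReal.ofReal ℓ < driftWeight K J (ball x₀ R) x},
        driftWeight K J (ball x₀ R) x ^ ((d : ℝ) / α) ∂volume.restrict (ball x₀ R) ≤
          ENNReal.ofReal η := by
  have hq : 0 < (d : ℝ) / α := div_pos (hα0.trans hα) hα0
  set P : Set (EuclideanSpace ℝ (Fin d) × ℝ) :=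
    (D ×ˢ Icc 0 1) ∩ {p | ball p.1 (2 * p.2) ⊆ Ω} with hP
  have hclosed : IsClosed {p : EuclideanSpace ℝ (Fin d) × ℝ | ball p.1 (2 * p.2) ⊆ Ω} := by
    have e : {p : EuclideanSpace ℝ (Fin d) × ℝ | ball p.1 (2 * p.2) ⊆ Ω} =
        ⋂ y ∈ Ωᶜ, {p | 2 * p.2 ≤ dist y p.1} := by
      ext p
      simp only [mem_ofPred_eq, mem_iInter, mem_compl_iff, subset_def, mem_ball]
      exact ⟨fun h y hy => not_lt.1 fun hlt => hy (h y hlt), fun h y hy => by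
        by_contra hne
        exact absurd (h y hne) (not_le.2 hy)⟩
    rw [e]
    exact isClosed_biInter fun y _ => isClosed_le (by fun_prop) (by fun_prop)
  have hPc : IsCompact P := (hD.prod isCompact_Icc).inter_right hclosed
  have key : ∃ ℓ : ℝ, 0 ≤ ℓ ∧ ∀ p ∈ P, 0 < p.2 →
      ∫⁻ x in {x | ENNReal.ofReal ℓ < driftWeight K J (ball p.1 p.2) x},
        driftWeight K J (ball p.1 p.2) x ^ ((d : ℝ) / α) ∂volume.restrict (ball p.1 p.2) ≤
          ENNReal.ofReal η := by
    have hmono : ∀ {ℓ ℓ' : ℝ}, ℓ ≤ ℓ' → ∀ p : EuclideanSpace ℝ (Fin d) × ℝ,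
        ∫⁻ x in {x | ENNReal.ofReal ℓ' < driftWeight K J (ball p.1 p.2) x},
          driftWeight K J (ball p.1 p.2) x ^ ((d : ℝ) / α) ∂volume.restrict (ball p.1 p.2) ≤
        ∫⁻ x in {x | ENNReal.ofReal ℓ < driftWeight K J (ball p.1 p.2) x},
          driftWeight K J (ball p.1 p.2) x ^ ((d : ℝ) / α) ∂volume.restrict (ball p.1 p.2) :=
      fun hle p => lintegral_mono_set fun x hx =>
        (ENNReal.ofReal_le_ofReal hle).trans_lt hx
    refine hPc.induction_on (p := fun T => ∃ ℓ : ℝ, 0 ≤ ℓ ∧ ∀ p ∈ T, 0 < p.2 →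
      ∫⁻ x in {x | ENNReal.ofReal ℓ < driftWeight K J (ball p.1 p.2) x},
        driftWeight K J (ball p.1 p.2) x ^ ((d : ℝ) / α) ∂volume.restrict (ball p.1 p.2) ≤
          ENNReal.ofReal η) ⟨0, le_rfl, by simp⟩ ?_ ?_ ?_
    · rintro s t hst ⟨ℓ, h0, h1⟩
      exact ⟨ℓ, h0, fun p hp => h1 p (hst hp)⟩
    · rintro s t ⟨ℓ, h0, h1⟩ ⟨ℓ', h0', h1'⟩
      refine ⟨max ℓ ℓ', le_max_of_le_left h0, ?_⟩
      rintro p (hp | hp) hpos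
      · exact (hmono (le_max_left _ _) p).trans (h1 p hp hpos)
      · exact (hmono (le_max_right _ _) p).trans (h1' p hp hpos)
    · rintro ⟨z, r⟩ ⟨⟨hz, hr⟩, hsub⟩
      simp only at hz hr
      obtain ⟨s, hs0, hs1, hrs, hsΩ⟩ : ∃ s : ℝ, 0 < s ∧ s ≤ 1 ∧ r < 2 * s ∧ ball z (2 * s) ⊆ Ω := by
        rcases hr.1.eq_or_lt with h0 | h0
        · obtain ⟨ε, hε, hεΩ⟩ := Metric.isOpen_iff.1 hΩ z (hDΩ hz)
          refine ⟨min (ε / 2) 1, by positivity, min_le_right _ _, by rw [← h0]; positivity,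
            (ball_subset_ball ?_).trans hεΩ⟩
          linarith [min_le_left (ε / 2) 1]
        · exact ⟨r, h0, hr.2, by linarith, hsub⟩
      set A := ball z (2 * s)
      have hWA := measurable_driftWeight hK hJ A
      obtain ⟨ℓ, hℓ0, hℓ⟩ := exists_level_of_lintegral_ne_top hq hη hWA (h z s hs0 hs1 hsΩ)
      refine ⟨{p | dist p.1 z + p.2 < 2 * s}, ?_, ℓ, hℓ0, ?_⟩
      · refine mem_nhdsWithin_of_mem_nhds (IsOpen.mem_nhds
          (isOpen_lt (by fun_prop) (by fun_prop)) ?_)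
        simpa using hrs
      · rintro ⟨x₀, R⟩ hp _
        simp only [mem_ofPred_eq] at hp
        have hBA : ball x₀ R ⊆ A := ball_subset_ball' (by linarith)
        have hWle := driftWeight_mono_set (K := K) (J := J) hBA
        refine le_trans ?_ hℓ
        calc _ ≤ ∫⁻ x in {x | ENNReal.ofReal ℓ < driftWeight K J (ball x₀ R) x},
              driftWeight K J A x ^ ((d : ℝ) / α) ∂volume.restrict (ball x₀ R) :=
              lintegral_mono fun x => ENNReal.rpow_le_rpow (hWle x) hq.le
          _ ≤ ∫⁻ x in {x | ENNReal.ofReal ℓ < driftWeight K J A x},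
              driftWeight K J A x ^ ((d : ℝ) / α) ∂volume.restrict (ball x₀ R) :=
              lintegral_mono_set fun x hx => lt_of_lt_of_le hx (hWle x)
          _ ≤ _ := lintegral_mono' (Measure.restrict_mono_measure
              (Measure.restrict_mono_set _ hBA) _) le_rfl
  obtain ⟨ℓ, h0, h1⟩ := key
  exact ⟨ℓ, h0, fun x₀ R hx hR hR1 hsub => h1 (x₀, R) ⟨⟨hx, hR.le, hR1⟩, hsub⟩ hR⟩

lemma setLIntegral_le_eLpNorm_mul {X : Type*} [MeasurableSpace X] {μ : Measure X} {W : X → ℝ≥0∞}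
    (hW : Measurable W) {θ : ℝ≥0∞} (hθ : 1 ≤ θ) (A : Set X) :
    ∫⁻ x in A, W x ∂μ ≤ eLpNorm W θ μ * μ A ^ (1 - 1 / θ.toReal) := by
  have h := eLpNorm_le_eLpNorm_mul_rpow_measure_univ (μ := μ.restrict A) hθ
    hW.aestronglyMeasurable
  rw [eLpNorm_one_eq_lintegral_enorm, Measure.restrict_apply_univ, ENNReal.toReal_one,
    one_div_one] at h
  simp only [enorm_eq_self] at h
  exact h.trans (mul_le_mul' (eLpNorm_mono_measure _ Measure.restrict_le_self) le_rfl)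

section

variable {c R : ℝ} {K : Kernel d} {Ω : Set (EuclideanSpace ℝ (Fin d))}
  {x₀ : EuclideanSpace ℝ (Fin d)}

lemma radius_le_of_mem {x y : EuclideanSpace ℝ (Fin d)} (hR1 : R ≤ 1)
    (hx : x ∈ ball x₀ (3 / 4 * R)) (hy : y ∉ ball x₀ R) :
    R / 16 ≤ min (1 / 4) (dist x y / 4) := by
  rw [mem_ball] at hx
  rw [mem_ball, not_lt] at hy
  have := dist_triangle_left y x₀ x
  refine le_min (by linarith) (by linarith)

lemma LocalUJS.of_UJS (h : UJS c Ω K) (hR : 0 < R) (hR1 : R ≤ 1) (hΩ : ball x₀ (2 * R) ⊆ Ω) :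
    LocalUJS false (max c 0) K x₀ R := fun x hx y hy => by
  have hsub : ball x (R / 16) ⊆ Ω := by
    refine (ball_subset_ball' ?_).trans hΩ
    have := mem_ball.1 hx
    linarith
  refine (h x y (R / 16) (by positivity) (radius_le_of_mem hR1 hx hy) hsub).trans ?_
  exact mul_le_mul' (ENNReal.ofReal_le_ofReal (le_max_left _ _)) le_rfl

lemma LocalUJS.of_UJSdual (h : UJSdual c Ω K) (hR : 0 < R) (hR1 : R ≤ 1)
    (hΩ : ball x₀ (2 * R) ⊆ Ω) : LocalUJS true (max c 0) K x₀ R := fun x hx y hy => by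
  have hsub : ball x (R / 16) ⊆ Ω := by
    refine (ball_subset_ball' ?_).trans hΩ
    have := mem_ball.1 hx
    linarith
  refine (h x y (R / 16) (by positivity) (radius_le_of_mem hR1 hx hy) hsub).trans ?_
  exact mul_le_mul' (ENNReal.ofReal_le_ofReal (le_max_left _ _)) le_rfl

end

/-! ### Weak solutions -/

section

variable {b : Bool} {K : Kernel d} {x₀ : EuclideanSpace ℝ (Fin d)} {R : ℝ}
  {f u v : EuclideanSpace ℝ (Fin d) → ℝ}

/-- The common content of the two notions of weak solution. -/
structure TestedSolution (b : Bool) (K : Kernel d) (U : Set (EuclideanSpace ℝ (Fin d)))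
    (f u : EuclideanSpace ℝ (Fin d) → ℝ) : Prop where
  rhs_memLp : MemLp f ∞ (volume.restrict U)
  memV : MemV (symPart K) U u
  test : ∀ φ, MemH (symPart K) U φ → ((∀ x, φ x ≤ 0) ∨ ∀ x, 0 ≤ φ x) →
    Integrable (symIntegrand K u φ)
      ((volume : Measure (EuclideanSpace ℝ (Fin d))).prod volume) →
    Integrable (bif b then antiIntegrand K φ u else antiIntegrand K u φ)
      ((volume : Measure (EuclideanSpace ℝ (Fin d))).prod volume) →
    ∫ p, pairing b K u φ p ∂((volume : Measure (EuclideanSpace ℝ (Fin d))).prod volume) ≤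
      ∫ x in U, f x * φ x

lemma IsWeakSolution.testedSolution {U : Set (EuclideanSpace ℝ (Fin d))}
    (h : IsWeakSolution K U f u) : TestedSolution false K U f u where
  rhs_memLp := h.rhs_memLp
  memV := h.memV
  test φ hφ hs h1 h2 := by
    have e : ∫ p, pairing false K u φ p ∂((volume : Measure (EuclideanSpace ℝ (Fin d))).prod
        volume) = form K u φ := integral_add h1 h2
    rw [e]
    rcases hs with hs | hs
    · exact h.super φ hφ hs ⟨h1, h2⟩
    · exact h.sub φ hφ hs ⟨h1, h2⟩

lemma symIntegrand_comm (φ : EuclideanSpace ℝ (Fin d) → ℝ) :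
    symIntegrand K u φ = symIntegrand K φ u := by
  ext p
  simp only [symIntegrand]
  ring

lemma IsWeakSolutionDual.testedSolution {θ : ℝ≥0∞} {U : Set (EuclideanSpace ℝ (Fin d))}
    (h : IsWeakSolutionDual θ K U f u) : TestedSolution true K U f u where
  rhs_memLp := h.rhs_memLp
  memV := h.memV
  test φ hφ hs h1 h2 := by
    have e : ∫ p, pairing true K u φ p ∂((volume : Measure (EuclideanSpace ℝ (Fin d))).prod
        volume) = form K φ u := by
      rw [form, ← symIntegrand_comm]
      exact integral_add h1 h2
    rw [e]
    rw [symIntegrand_comm] at h1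
    rcases hs with hs | hs
    · exact h.super φ hφ hs ⟨h1, h2⟩
    · exact h.sub φ hφ hs ⟨h1, h2⟩

lemma ae_prod_eq (h : v =ᵐ[volume] u) :
    ∀ᵐ p ∂((volume : Measure (EuclideanSpace ℝ (Fin d))).prod volume),
      v p.1 = u p.1 ∧ v p.2 = u p.2 :=
  (Measure.quasiMeasurePreserving_fst.ae h).and (Measure.quasiMeasurePreserving_snd.ae h)

/-- A bounded weak solution is a local solution up to a modification on a null set. -/
theorem TestedSolution.exists_localSolution (h : TestedSolution b K (ball x₀ (2 * R)) f u)
    (hR : 0 < R) (hu : ∀ᵐ x, 0 ≤ u x) (h0 : supOn (ball x₀ R) u ≠ 0)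
    (ht : supOn (ball x₀ R) u ≠ ∞) :
    ∃ v, v =ᵐ[volume] u ∧ LocalSolution b K x₀ R (supOn (ball x₀ R) u).toReal
      (eLpNorm f ∞ (volume.restrict (ball x₀ (2 * R)))).toReal v := by
  classical
  set M := (supOn (ball x₀ R) u).toReal with hM
  have hM0 : 0 < M := ENNReal.toReal_pos h0 ht
  set F := (eLpNorm f ∞ (volume.restrict (ball x₀ (2 * R)))).toReal with hF
  have hF0 : 0 ≤ F := ENNReal.toReal_nonneg
  obtain ⟨w, hw, huw⟩ := h.memV.aestronglyMeasurable
  have hwm := hw.measurable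
  set v : EuclideanSpace ℝ (Fin d) → ℝ :=
    (ball x₀ R).piecewise (fun x => min (max (w x) 0) M) (fun x => max (w x) 0) with hv
  have hle : ∀ᵐ x, x ∈ ball x₀ R → u x ≤ M := by
    have h1 : ∀ᵐ x ∂volume.restrict (ball x₀ R), ENNReal.ofReal (u x) ≤ supOn (ball x₀ R) u :=
      ENNReal.ae_le_essSup _
    refine ((ae_restrict_iff' measurableSet_ball).1 h1).mono fun x hx hxb => ?_
    exact (ENNReal.ofReal_le_iff_le_toReal ht).1 (hx hxb)
  have hvu : v =ᵐ[volume] u := by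
    filter_upwards [huw, hu, hle] with x h1 h2 h3
    by_cases hx : x ∈ ball x₀ R
    · rw [hv, piecewise_eq_of_mem _ _ _ hx, ← h1, max_eq_left h2, min_eq_left (h3 hx)]
    · rw [hv, piecewise_eq_of_notMem _ _ _ hx, ← h1, max_eq_left h2]
  have hsub : ball x₀ R ⊆ ball x₀ (2 * R) := ball_subset_ball (by linarith)
  have hprod := ae_prod_eq hvu
  refine ⟨v, hvu, ?_, ?_, ?_, hM0, hF0, ?_, ?_⟩
  · exact Measurable.piecewise measurableSet_ball ((hwm.max measurable_const).min measurable_const)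
      (hwm.max measurable_const)
  · intro x
    by_cases hx : x ∈ ball x₀ R
    · rw [hv, piecewise_eq_of_mem _ _ _ hx]
      exact le_min (le_max_right _ _) hM0.le
    · rw [hv, piecewise_eq_of_notMem _ _ _ hx]
      exact le_max_right _ _
  · intro x hx
    rw [hv, piecewise_eq_of_mem _ _ _ hx]
    exact min_le_right _ _
  · have e : ∫⁻ x in ball x₀ R, ∫⁻ y, ENNReal.ofReal ((v x - v y) ^ 2) * symPart K x y =
        ∫⁻ x in ball x₀ R, ∫⁻ y, ENNReal.ofReal ((u x - u y) ^ 2) * symPart K x y := by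
      refine lintegral_congr_ae ((ae_restrict_of_ae hvu).mono fun x hx => ?_)
      refine lintegral_congr_ae (hvu.mono fun y hy => ?_)
      simp only [hx, hy]
    rw [e]
    exact (lintegral_mono_set hsub).trans_lt h.memV.energy_lt_top
  · intro φ hφ hs i1 i2
    have e1 : symIntegrand K v φ =ᵐ[(volume : Measure (EuclideanSpace ℝ (Fin d))).prod volume]
        symIntegrand K u φ := hprod.mono fun p hp => by simp only [symIntegrand, hp.1, hp.2]
    have e2 : (bif b then antiIntegrand K φ v else antiIntegrand K v φ)
        =ᵐ[(volume : Measure (EuclideanSpace ℝ (Fin d))).prod volume]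
        (bif b then antiIntegrand K φ u else antiIntegrand K u φ) :=
      hprod.mono fun p hp => by cases b <;> simp only [cond_true, cond_false, antiIntegrand, hp.1, hp.2]
    have e3 : pairing b K v φ =ᵐ[(volume : Measure (EuclideanSpace ℝ (Fin d))).prod volume]
        pairing b K u φ := hprod.mono fun p hp => by
      cases b <;> simp only [pairing, cond_true, cond_false, symIntegrand, antiIntegrand, hp.1, hp.2]
    have hφ2 : MemH (symPart K) (ball x₀ (2 * R)) φ :=
      ⟨hφ.memV, fun x hx => hφ.eq_zero x fun hx' => hx (hsub hx')⟩
    rw [integral_congr_ae e3]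
    refine (h.test φ hφ2 hs (i1.congr e1) (i2.congr e2)).trans ?_
    have hfin : IsFiniteMeasure (volume.restrict (ball x₀ (2 * R))) :=
      ⟨by simpa using measure_ball_lt_top⟩
    have hφi : Integrable φ (volume.restrict (ball x₀ (2 * R))) :=
      (hφ.memV.memLp.mono_measure (by
        rw [Measure.restrict_univ]; exact Measure.restrict_le_self)).integrable one_le_two
    have hfF : ∀ᵐ x ∂volume.restrict (ball x₀ (2 * R)), ‖f x * φ x‖ ≤ F * |φ x| := by
      have h1 := ae_le_eLpNormEssSup (f := f) (μ := volume.restrict (ball x₀ (2 * R)))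
      rw [← eLpNorm_exponent_top] at h1
      refine h1.mono fun x hx => ?_
      rw [norm_mul, Real.norm_eq_abs (φ x)]
      refine mul_le_mul_of_nonneg_right ?_ (abs_nonneg _)
      rw [← toReal_enorm]
      exact ENNReal.toReal_mono h.rhs_memLp.2.ne hx
    refine (le_abs_self _).trans ((norm_integral_le_of_norm_le (hφi.abs.const_mul F) hfF).trans ?_)
    rw [integral_const_mul]
    refine le_of_eq ?_
    congr 1
    refine (setIntegral_eq_of_subset_of_forall_sdiff_eq_zero measurableSet_ball hsub
      fun x hx => ?_)
    rw [hφ.eq_zero x hx.2, abs_zero]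

/-- The passage from the estimate for local solutions to the claimed estimate. -/
theorem TestedSolution.localBound {α δ c : ℝ} (h : TestedSolution b K (ball x₀ (2 * R)) f u)
    (hδ : 0 < δ) (hδ1 : δ ≤ 1) (hR : 0 < R) (hu : ∀ᵐ x, 0 ≤ u x)
    (hloc : ∀ (M F : ℝ) (v : EuclideanSpace ℝ (Fin d) → ℝ), LocalSolution b K x₀ R M F v →
      supOn (ball x₀ (R / 2)) v ≤
        ENNReal.ofReal c * (⨍⁻ x in ball x₀ R, ENNReal.ofReal (v x ^ 2) ∂volume) ^ (1 / 2 : ℝ) +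
          ENNReal.ofReal (δ * (M + R ^ α * F))) :
    LocalBound α δ (max c 1) x₀ R f u := by
  unfold LocalBound
  rcases eq_or_ne (supOn (ball x₀ R) u) 0 with h0 | h0
  · have : supOn (ball x₀ (R / 2)) u ≤ supOn (ball x₀ R) u :=
      essSup_mono_measure (Measure.absolutelyContinuous_of_le
        (Measure.restrict_mono_set _ (ball_subset_ball (by linarith))))
    rw [h0] at this
    exact this.trans zero_le
  rcases eq_or_ne (supOn (ball x₀ R) u) ∞ with ht | ht
  · rw [ht, ENNReal.mul_top (ENNReal.ofReal_pos.2 hδ).ne']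
    simp
  obtain ⟨v, hvu, hv⟩ := h.exists_localSolution hR hu h0 ht
  have key := hloc _ _ v hv
  have e1 : supOn (ball x₀ (R / 2)) v = supOn (ball x₀ (R / 2)) u :=
    essSup_congr_ae ((ae_restrict_of_ae hvu).mono fun x hx => by simp only [hx])
  have e2 : ⨍⁻ x in ball x₀ R, ENNReal.ofReal (v x ^ 2) ∂volume =
      ⨍⁻ x in ball x₀ R, ENNReal.ofReal (u x ^ 2) ∂volume := by
    rw [setLAverage_eq, setLAverage_eq]
    congr 1
    exact lintegral_congr_ae ((ae_restrict_of_ae hvu).mono fun x hx => by simp only [hx])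
  rw [e1, e2] at key
  refine key.trans ?_
  rw [add_assoc]
  refine add_le_add (mul_le_mul' (ENNReal.ofReal_le_ofReal (le_max_left _ _)) le_rfl) ?_
  rw [mul_add, ENNReal.ofReal_add (by positivity) (by positivity), ENNReal.ofReal_mul hδ.le,
    ENNReal.ofReal_toReal ht]
  refine add_le_add le_rfl ?_
  rw [← mul_assoc, ENNReal.ofReal_mul (by positivity), ENNReal.ofReal_toReal h.rhs_memLp.2.ne]
  refine mul_le_mul' (ENNReal.ofReal_le_ofReal ?_) le_rfl
  gcongr
  exact hδ1.trans (le_max_right _ _)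

end

/-! ### Conclusion -/

/-- The admissible size of the critical part of the drift. -/
noncomputable def driftThreshold (Λ : ℝ) : ℝ := 1 / (32 * Λ ^ 2)

lemma settingConst_pos {α cCut cSob cJ cK : ℝ} (hα : α < 2) :
    1 ≤ settingConst α cCut cSob cJ cK := by
  have := levyConst_nonneg hα
  have : 0 ≤ (max cJ 0 + max cCut 0) * levyConst α := by positivity
  have : 0 ≤ max cK 0 := le_max_right _ _
  have : 0 ≤ max cSob 0 := le_max_right _ _
  unfold settingConst
  linarith

lemma driftThreshold_pos {Λ : ℝ} (hΛ : 1 ≤ Λ) : 0 < driftThreshold Λ := by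
  have : 0 < Λ := by linarith
  unfold driftThreshold
  positivity

theorem exists_localBound {α γ δ ℓ : ℝ} (cCut cSob cJ cK cU : ℝ) (hα0 : 0 < α) (hα2 : α < 2)
    (hα : α < d) (hγ : 0 < γ) (hγ' : γ ≤ α / d) (hδ : 0 < δ) (hδ1 : δ ≤ 1) (hℓ : 0 ≤ ℓ) :
    ∃ c : ℝ, 0 < c ∧ ∀ (b : Bool) (Ω : Set (EuclideanSpace ℝ (Fin d))) (K J : Kernel d)
      (x₀ : EuclideanSpace ℝ (Fin d)) (R : ℝ) (f u : EuclideanSpace ℝ (Fin d) → ℝ),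
      Measurable (Function.uncurry K) → Cutoff α cCut Ω (symPart K) → Sob α cSob Ω (symPart K) →
      IsComparisonKernel α cJ Ω J → EnergyComparison cK Ω K J → LocalUJS b (max cU 0) K x₀ R →
      0 < R → R ≤ 1 → ball x₀ (2 * R) ⊆ Ω →
      ∫⁻ x in {x | ENNReal.ofReal ℓ < driftWeight K J (ball x₀ R) x},
        driftWeight K J (ball x₀ R) x ^ ((d : ℝ) / α) ∂volume.restrict (ball x₀ R) ≤
          ENNReal.ofReal (driftThreshold (settingConst α cCut cSob cJ cK) ^ ((d : ℝ) / α)) →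
      (b = true → ∀ A ⊆ ball x₀ R, MeasurableSet A →
        ∫⁻ x in A, driftWeight K J (ball x₀ R) x ≤
          ENNReal.ofReal ℓ * volume A ^ (((d : ℝ) - α) / d + γ)) →
      (∀ᵐ x, 0 ≤ u x) → TestedSolution b K (ball x₀ (2 * R)) f u → LocalBound α δ c x₀ R f u := by
  set Λ := settingConst α cCut cSob cJ cK
  have hΛ : 1 ≤ Λ := settingConst_pos hα2
  have hη := driftThreshold_pos hΛ
  have hη' : 16 * Λ ^ 2 * driftThreshold Λ ≤ 1 / 2 := by
    have : 0 < Λ := by linarith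
    unfold driftThreshold
    exact le_of_eq (by field_simp; norm_num)
  obtain ⟨c, hc, key⟩ := exists_local_bound (d := d) (δ := δ) hα0 hα2 hα hΛ hℓ hη.le hη' hγ hγ'
    (le_max_right cU 0) hδ
  refine ⟨max c 1, lt_max_of_lt_left hc, ?_⟩
  intro b Ω K J x₀ R f u hK hCut hSob hJ hE hU hR hR1 hΩ hdrift hdual hu h
  have S := LocalSetting.of_assumptions hα0 hα2 hα hη.le hℓ hK hCut hSob hJ hE hR hR1 hΩ hdrift
  refine h.localBound hδ hδ1 hR hu fun M F v hv => key b K _ x₀ R M F v S hv hU fun hb A hA hAm =>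
    (lintegral_mono fun x => driftWeight_anti (fun _ _ => le_self_add) _ _).trans
      (hdual hb A hA hAm)

end NonlocalForm

theorem mainTheorem6 (d : ℕ) (α : ℝ) (hα₀ : 0 < α) (hα₂ : α < 2) (hαd : α < d) (θ : ℝ≥0∞) :
    -- the equation `-L u = f`, `θ ∈ (d/α, ∞]`
    (ENNReal.ofReal (d / α) < θ →
      ∀ cCut cSob cJ cK cU δ : ℝ, 0 < δ → δ ≤ 1 → ∃ c : ℝ, 0 < c ∧
        ∀ (Ω : Set (EuclideanSpace ℝ (Fin d))) (K : NonlocalForm.Kernel d),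
          IsOpen Ω → NonlocalForm.IsJumpingKernel K →
          NonlocalForm.Cutoff α cCut Ω (NonlocalForm.symPart K) →
          NonlocalForm.Sob α cSob Ω (NonlocalForm.symPart K) →
          NonlocalForm.K1loc α cJ cK θ Ω K → NonlocalForm.UJS cU Ω K →
          ∀ (x₀ : EuclideanSpace ℝ (Fin d)) (R : ℝ), 0 < R → R ≤ 1 → ball x₀ (2 * R) ⊆ Ω →
            ∀ f u : EuclideanSpace ℝ (Fin d) → ℝ, (∀ᵐ x, 0 ≤ u x) →
              NonlocalForm.IsWeakSolution K (ball x₀ (2 * R)) f u →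
              NonlocalForm.LocalBound α δ c x₀ R f u) ∧
    -- the equation `-L u = f`, critical exponent `θ = d/α`
    (θ = ENNReal.ofReal (d / α) →
      ∀ cCut cSob cJ cK cU : ℝ,
        ∀ (Ω : Set (EuclideanSpace ℝ (Fin d))) (K : NonlocalForm.Kernel d),
          IsOpen Ω → NonlocalForm.IsJumpingKernel K →
          NonlocalForm.Cutoff α cCut Ω (NonlocalForm.symPart K) →
          NonlocalForm.Sob α cSob Ω (NonlocalForm.symPart K) →
          NonlocalForm.K1loc α cJ cK θ Ω K → NonlocalForm.UJS cU Ω K →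
          ∀ D : Set (EuclideanSpace ℝ (Fin d)), IsCompact D → D ⊆ Ω →
          ∀ δ : ℝ, 0 < δ → δ ≤ 1 → ∃ c : ℝ, 0 < c ∧
            ∀ (x₀ : EuclideanSpace ℝ (Fin d)) (R : ℝ), x₀ ∈ D → 0 < R → R ≤ 1 →
              ball x₀ (2 * R) ⊆ Ω →
              ∀ f u : EuclideanSpace ℝ (Fin d) → ℝ, (∀ᵐ x, 0 ≤ u x) →
                NonlocalForm.IsWeakSolution K (ball x₀ (2 * R)) f u →
                NonlocalForm.LocalBound α δ c x₀ R f u) ∧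
    -- the dual equation `-L̂ u = f`, `θ ∈ (d/α, ∞]`
    (ENNReal.ofReal (d / α) < θ →
      ∀ cCut cSob cJ cK cU δ : ℝ, 0 < δ → δ ≤ 1 → ∃ c : ℝ, 0 < c ∧
        ∀ (Ω : Set (EuclideanSpace ℝ (Fin d))) (K : NonlocalForm.Kernel d),
          IsOpen Ω → NonlocalForm.IsJumpingKernel K →
          NonlocalForm.Cutoff α cCut Ω (NonlocalForm.symPart K) →
          NonlocalForm.Sob α cSob Ω (NonlocalForm.symPart K) →
          NonlocalForm.K1glob α cJ cK θ Ω K → NonlocalForm.UJSdual cU Ω K →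
          ∀ (x₀ : EuclideanSpace ℝ (Fin d)) (R : ℝ), 0 < R → R ≤ 1 → ball x₀ (2 * R) ⊆ Ω →
            ∀ f u : EuclideanSpace ℝ (Fin d) → ℝ, (∀ᵐ x, 0 ≤ u x) →
              NonlocalForm.IsWeakSolutionDual θ K (ball x₀ (2 * R)) f u →
              NonlocalForm.LocalBound α δ c x₀ R f u) := by
  have hd : (0 : ℝ) < d := hα₀.trans hαd
  have hq : 0 < (d : ℝ) / α := div_pos hd hα₀
  have hγ : 0 < α / (d : ℝ) := div_pos hα₀ hd
  refine ⟨fun hθ cCut cSob cJ cK cU δ hδ hδ1 => ?_,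
    fun hθ cCut cSob cJ cK cU Ω K hΩ hK hCut hSob hK1 hU D hD hDΩ δ hδ hδ1 => ?_,
    fun hθ cCut cSob cJ cK cU δ hδ hδ1 => ?_⟩
  · have hη := NonlocalForm.driftThreshold_pos
      (NonlocalForm.settingConst_pos (cCut := cCut) (cSob := cSob) (cJ := cJ) (cK := cK) hα₂)
    obtain ⟨ℓ, hℓ, hlev⟩ := NonlocalForm.exists_level_of_eLpNorm_le (C := cK) hq hθ
      (Real.rpow_pos_of_pos hη ((d : ℝ) / α))
    obtain ⟨c, hc, key⟩ := NonlocalForm.exists_localBound cCut cSob cJ cK cU hα₀ hα₂ hαd hγ le_rfl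
      hδ hδ1 hℓ
    refine ⟨c, hc, fun Ω K _ hK hCut hSob ⟨J, hJ, hE, hW⟩ hU x₀ R hR hR1 hsub f u hu hsol => ?_⟩
    refine key false Ω K J x₀ R f u hK.measurable hCut hSob hJ hE
      (NonlocalForm.LocalUJS.of_UJS hU hR hR1 hsub) hR hR1 hsub ?_ (by simp) hu hsol.testedSolution
    have h2 : (2 : ℝ) * (R / 2) = R := by ring
    have h := hW x₀ (R / 2) (by positivity) (by linarith)
      (by rw [h2]; exact (ball_subset_ball (by linarith)).trans hsub)
    rw [h2] at h
    exact hlev _ _ (NonlocalForm.measurable_driftWeight hK.measurable hJ.measurable _) h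
  · obtain ⟨J, hJ, hE, hW⟩ := hK1
    have hη := NonlocalForm.driftThreshold_pos
      (NonlocalForm.settingConst_pos (cCut := cCut) (cSob := cSob) (cJ := cJ) (cK := cK) hα₂)
    obtain ⟨ℓ, hℓ, hlev⟩ := NonlocalForm.exists_level_of_isCompact (K := K) (J := J) hα₀ hαd
      (Real.rpow_pos_of_pos hη ((d : ℝ) / α)) hK.measurable hJ.measurable hΩ hD hDΩ
      (fun z r hr hr1 hz => by
        have h := hW z r hr hr1 hz
        rw [hθ, eLpNorm_eq_lintegral_rpow_enorm_toReal (ENNReal.ofReal_pos.2 hq).ne'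
          ENNReal.ofReal_ne_top, ENNReal.toReal_ofReal hq.le] at h
        simp only [enorm_eq_self] at h
        intro htop
        rw [htop, ENNReal.top_rpow_of_pos (by positivity)] at h
        exact ENNReal.ofReal_ne_top (top_le_iff.1 h))
    obtain ⟨c, hc, key⟩ := NonlocalForm.exists_localBound cCut cSob cJ cK cU hα₀ hα₂ hαd hγ le_rfl
      hδ hδ1 hℓ
    exact ⟨c, hc, fun x₀ R hx₀ hR hR1 hsub f u hu hsol => key false Ω K J x₀ R f u hK.measurable
      hCut hSob hJ hE (NonlocalForm.LocalUJS.of_UJS hU hR hR1 hsub) hR hR1 hsub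
      (hlev x₀ R hx₀ hR hR1 hsub) (by simp) hu hsol.testedSolution⟩
  · have hη := NonlocalForm.driftThreshold_pos
      (NonlocalForm.settingConst_pos (cCut := cCut) (cSob := cSob) (cJ := cJ) (cK := cK) hα₂)
    obtain ⟨ℓ, hℓ, hlev⟩ := NonlocalForm.exists_level_of_eLpNorm_le (C := cK) hq hθ
      (Real.rpow_pos_of_pos hη ((d : ℝ) / α))
    have hγ1 : 0 < α / d - 1 / θ.toReal := by
      rcases eq_or_ne θ ∞ with rfl | ht
      · simpa using hγ
      · have := (ENNReal.ofReal_lt_iff_lt_toReal hq.le ht).1 hθ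
        have h1 : 1 / θ.toReal < 1 / ((d : ℝ) / α) := one_div_lt_one_div_of_lt hq this
        rw [one_div_div] at h1
        linarith
    have hθ0 : 0 ≤ 1 / θ.toReal := by positivity
    have hθ1 : 1 ≤ θ := by
      refine le_trans ?_ hθ.le
      rw [ENNReal.one_le_ofReal, one_le_div hα₀]
      exact hαd.le
    obtain ⟨c, hc, key⟩ := NonlocalForm.exists_localBound (ℓ := max ℓ cK) cCut cSob cJ cK cU hα₀
      hα₂ hαd hγ1 (by linarith) hδ hδ1 (le_max_of_le_left hℓ)
    refine ⟨c, hc, fun Ω K _ hK hCut hSob ⟨J, hJ, hE, hW⟩ hU x₀ R hR hR1 hsub f u hu hsol => ?_⟩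
    have hWm := NonlocalForm.measurable_driftWeight hK.measurable hJ.measurable (ball x₀ R)
    have hWle : eLpNorm (NonlocalForm.driftWeight K J (ball x₀ R)) θ volume ≤
        ENNReal.ofReal cK := by
      refine le_trans (eLpNorm_mono_enorm fun x => ?_) hW
      simp only [enorm_eq_self]
      exact NonlocalForm.driftWeight_mono_set (subset_univ _) x
    refine key true Ω K J x₀ R f u hK.measurable hCut hSob hJ hE
      (NonlocalForm.LocalUJS.of_UJSdual hU hR hR1 hsub) hR hR1 hsub ?_ ?_ hu hsol.testedSolution
    · refine le_trans (lintegral_mono_set fun x hx => ?_) (hlev _ _ hWm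
        ((eLpNorm_mono_measure _ Measure.restrict_le_self).trans hWle))
      exact (ENNReal.ofReal_le_ofReal (le_max_left _ _)).trans_lt hx
    · intro _ A _ _
      refine (NonlocalForm.setLIntegral_le_eLpNorm_mul hWm hθ1 A).trans ?_
      have e : 1 - 1 / θ.toReal = ((d : ℝ) - α) / d + (α / d - 1 / θ.toReal) := by
        field_simp; ring
      rw [e]
      exact mul_le_mul' (hWle.trans (ENNReal.ofReal_le_ofReal (le_max_right _ _))) le_rfl
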